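/- Let $k$ be a field of characteristic zero and $X=GM$ a finite group factorization (subgroups $G,M$ such that multiplication $G\times M\to X$ is bijective), with actions $s\triangleright u\in G$, $s\triangleleft u\in M$ defined by $su=(s\triangleright u)(s\triangleleft u)$ for $s\in M$, $u\in G$. Let $A=k(M)\blacktriangleright\!\!\triangleleft kG$ be the bicrossproduct Hopf algebra with basis $\delta_s\otimes u$ and $$(\delta_s\otimes u)(\delta_t\otimes v)=\delta_{s\triangleleft u,t}\,\delta_s\otimes uv,\qquad 1=\sum_s\delta_s\otimes e,\qquad \Delta(\delta_s\otimes u)=\sum_{ab=s}(\delta_a\otimes b\triangleright u)\otimes(\delta_b\otimes u),$$ $$\varepsilon(\delta_s\otimes u)=\delta_{s,e},\qquad S(\delta_s\otimes u)=\delta_{(s\triangleleft u)^{-1}}\otimes(s\triangleright u)^{-1}.$$ Write $\delta_s=\delta_s\otimes e$ and $u=\sum_s\delta_s\otimes u$ in $A$. Let $H=A^*$, with basis $t\otimes\delta_v$ dual to $\delta_t\otimes v$, and $H^+=\{h\in H: h(1)=0\}$. For $v,u\in G$ and $t,s\in M$ put $\|vt\|=v^{-1}t^{-1}v$ and $vt\,\tilde\triangleleft\,us=(\tilde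 s\triangleright vu)(\tilde s t\tilde s^{-1})$, where $\tilde s=s^{-1}\triangleleft(vu)^{-1}$. This makes $kX$ an $X$-graded right $X$-module with $\|w\tilde\triangleleft x\|=x^{-1}\|w\|x$; let $J_z\subset kX$ be the part of degree $z$. Every $z\in X$ factors uniquely as $z=\langle z\rangle^{-1}|z|$ with $\langle z\rangle\in M$, $|z|\in G$; for $w\in J_z$ nonzero write $\langle w\rangle=\langle z\rangle$, $|w|=|z|$, so $\|w\|=\langle w\rangle^{-1}|w|$. Let $\Pi:kX\to H^+$, $\Pi(vt)=t\otimes\delta_v-\delta_{v,e}1_H$ (where $1_H=\varepsilon$). Let $z_0\in Z=\{\|x\|:x\in X\}$ with conjugacy class $C$ in $X$, and let $\mathcal M_0\subset J_{z_0}$ be an irreducible right subrepresentation of the centralizer of $z_0$ in $X$, not the trivial representation if $z_0=e$. Put $\mathcal M=\bigoplus_{z\in C}\mathcal M_0\tilde\triangleleft\bar z$, where $z=\bar z^{-1}z_0\bar z$, and $L=\Pi(\mathcal M)\subset H^+$. For a bicovariant first order differential calculus $(\Omega^1,d)$ on $A$, let $\Lambda^1\subset\Omega^1$ be the space of left-invariant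 1-forms and $\pi:A^+=\ker\varepsilon\to\Lambda^1$, $\pi(x)=\sum S(x_{(1)})\,d x_{(2)}$. Its quantum tangent space is the set of $h\in H^+$ that vanish on $\ker\pi$; it is paired with $\Lambda^1$ by $\langle\pi(x),h\rangle=h(x)$. A nonzero calculus is irreducible if it has no proper quotients. **Theorem.** (0) For any choice of representatives $\bar z$ ($z\in C$) and any basis $(f_i)$ of $\mathcal M_0$, the vectors $f_{iz}=f_i\tilde\triangleleft\bar z$ form a basis of $\mathcal M$, with $\|f_{iz}\|=z$. The map $\Pi$ is injective on $\mathcal M$, and there is an irreducible bicovariant calculus on $A$ with quantum tangent space $L$. Now let $(\Omega^1,d)$ be any bicovariant calculus on $A$ with quantum tangent space $L$, and let $(f_a)_{a\in I}$ be any basis of $\mathcal M$ consisting of homogeneous elements (for example $(f_{iz})$). Identify $\mathcal M$ with $L$ by $\Pi$. Then $\Lambda^1$ has a unique basis $(e_a)_{a\in I}$ dual to $(f_a)$, and with $c_a=\langle\delta_{\langle f_a\rangle},f_a\rangle$ (the coefficient of $\langle f_a\rangle\in M\subset X$ in $f_a\in kX$) the following hold. (i) $\Omega^1=A\otimes\Lambda^1$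 as left $A$-modules: $A\otimes\Lambda^1\to\Omega^1$, $a\otimes\omega\mapsto a\omega$, is bijective. (ii) For $s\in M$ and $u\in G$, $$e_a\,\delta_s=\delta_{s\langle f_a\rangle^{-1}}\,e_a,\qquad e_a\,u=(\langle f_a\rangle\triangleright u)\,(e_a*u),$$ where $e_a*x=\sum_{b\in I}\langle e_a,f_b\tilde\triangleleft x^{-1}\rangle e_b$, $x\in X$, is the right action of $X$ on $\Lambda^1$ adjoint to the left action $x*f=f\tilde\triangleleft x^{-1}$ on $\mathcal M\cong L$. (iii) For $s\in M$ and $u\in G$, $$d\delta_s=\sum_{a}c_a\,(\delta_{s\langle f_a\rangle^{-1}}-\delta_s)\,e_a,\qquad du=\sum_a c_a\,(\langle f_a\rangle\triangleright u)\,(e_a*u)-\sum_a c_a\,u\,e_a.$$ -/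

import Mathlib

open scoped TensorProduct

universe u v w w₁

/-! ## Bicovariant first order differential calculi on a Hopf algebra -/

/-- A first order differential calculus on a `k`-algebra `A`, with space of 1-forms `Ω`:
an `A`-`A`-bimodule structure on `Ω` (with `left a ω = a ω` and `right a ω = ω a`) and a linear map
`d : A → Ω` obeying the Leibniz rule and such that `a ⊗ b ↦ a (d b)` maps `A ⊗ A` onto `Ω`. -/
structure FirstOrderCalculus (k : Type*) (A : Type*) (Ω : Type*) [Field k] [Ring A] [Algebra k A]
    [AddCommGroup Ω] [Module k Ω] where
  left : A →ₗ[k] Ω →ₗ[k] Ω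
  right : A →ₗ[k] Ω →ₗ[k] Ω
  d : A →ₗ[k] Ω
  left_one : ∀ ω, left 1 ω = ω
  left_mul : ∀ a b ω, left (a * b) ω = left a (left b ω)
  right_one : ∀ ω, right 1 ω = ω
  right_mul : ∀ a b ω, right (a * b) ω = right b (right a ω)
  left_right : ∀ a b ω, right b (left a ω) = left a (right b ω)
  leibniz : ∀ a b, d (a * b) = left a (d b) + right b (d a)
  surjective : Function.Surjective (TensorProduct.lift (left.compl₂ d))

/-- A bicovariant calculus on a Hopf algebra `A`: a first order calculus whose 1-forms are an
`A`-`A`-bicomodule by coactions which are bimodule maps (`A ⊗ Ω` and `Ω ⊗ A` being bimodules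
through the coproduct) and for which `d` is a map of bicomodules. -/
structure BicovariantCalculus (k : Type*) (A : Type*) (Ω : Type*) [Field k] [Ring A]
    [HopfAlgebra k A] [AddCommGroup Ω] [Module k Ω] extends FirstOrderCalculus k A Ω where
  coactL : Ω →ₗ[k] A ⊗[k] Ω
  coactR : Ω →ₗ[k] Ω ⊗[k] A
  coactL_coassoc : ∀ ω, TensorProduct.assoc k A A Ω
    ((Coalgebra.comul (R := k) (A := A)).rTensor Ω (coactL ω)) = coactL.lTensor A (coactL ω)
  coactL_counit : ∀ ω, TensorProduct.lid k Ω
    ((Coalgebra.counit (R := k) (A := A)).rTensor Ω (coactL ω)) = ω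
  coactR_coassoc : ∀ ω, TensorProduct.assoc k Ω A A (coactR.rTensor A (coactR ω)) =
    (Coalgebra.comul (R := k) (A := A)).lTensor Ω (coactR ω)
  coactR_counit : ∀ ω, TensorProduct.rid k Ω
    ((Coalgebra.counit (R := k) (A := A)).lTensor Ω (coactR ω)) = ω
  coact_comm : ∀ ω, TensorProduct.assoc k A Ω A (coactL.rTensor A (coactR ω)) =
    coactR.lTensor A (coactL ω)
  coactL_left : ∀ a ω, coactL (left a ω) =
    TensorProduct.map₂ (LinearMap.mul k A) left (Coalgebra.comul (R := k) a) (coactL ω)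
  coactL_right : ∀ a ω, coactL (right a ω) =
    TensorProduct.map₂ (LinearMap.mul k A).flip right (Coalgebra.comul (R := k) a) (coactL ω)
  coactR_left : ∀ a ω, coactR (left a ω) =
    TensorProduct.map₂ left (LinearMap.mul k A) (Coalgebra.comul (R := k) a) (coactR ω)
  coactR_right : ∀ a ω, coactR (right a ω) =
    TensorProduct.map₂ right (LinearMap.mul k A).flip (Coalgebra.comul (R := k) a) (coactR ω)
  coactL_d : ∀ a, coactL (d a) = d.lTensor A (Coalgebra.comul (R := k) a)
  coactR_d : ∀ a, coactR (d a) = d.rTensor A (Coalgebra.comul (R := k) a)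

namespace BicovariantCalculus

variable {k : Type*} {A : Type*} {Ω : Type*} [Field k] [Ring A] [HopfAlgebra k A]
  [AddCommGroup Ω] [Module k Ω]

/-- The space `Λ¹` of left-invariant 1-forms. -/
noncomputable def leftInvariant (Γ : BicovariantCalculus k A Ω) : Submodule k Ω :=
  LinearMap.eqLocus Γ.coactL (TensorProduct.mk k A Ω 1)

/-- The left-module map `A ⊗ Λ¹ → Ω¹`, `a ⊗ ω ↦ a ω`. -/
noncomputable def leftFree (Γ : BicovariantCalculus k A Ω) : A ⊗[k] Γ.leftInvariant →ₗ[k] Ω :=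
  TensorProduct.lift (Γ.left.compl₂ Γ.leftInvariant.subtype)

/-- The Maurer-Cartan map `a ↦ ∑ S(a₁) d(a₂)`. Restricted to the augmentation ideal
`A⁺ = ker ε` it is the projection of `A⁺` onto `Λ¹`. -/
noncomputable def maurerCartan (Γ : BicovariantCalculus k A Ω) : A →ₗ[k] Ω :=
  TensorProduct.lift ((Γ.left ∘ₗ HopfAlgebra.antipode k).compl₂ Γ.d) ∘ₗ Coalgebra.comul

/-- The quantum tangent space `L ⊆ H⁺ ⊆ H = A*`: the functionals on `A` which vanish on `1` and
on the kernel of the projection `A⁺ → Λ¹`. -/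
def tangentSpace (Γ : BicovariantCalculus k A Ω) : Submodule k (Module.Dual k A) where
  carrier := {h | h 1 = 0 ∧
    ∀ a, Coalgebra.counit (R := k) a = 0 → Γ.maurerCartan a = 0 → h a = 0}
  add_mem' := by
    rintro g h ⟨hg, hg'⟩ ⟨hh, hh'⟩
    refine ⟨by simp [hg, hh], fun a ha ha' => by simp [hg' a ha ha', hh' a ha ha']⟩
  zero_mem' := by simp
  smul_mem' := by
    rintro c h ⟨hh, hh'⟩
    refine ⟨by simp [hh], fun a ha ha' => by simp [hh' a ha ha']⟩

/-- `Γ.Pairs ω h c` says that `⟨ω, h⟩ = c` in the pairing of `Λ¹` with the quantum tangent space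
`L`, by which the projection `A⁺ → Λ¹` is adjoint to the inclusion `L ⊆ H⁺`:
the value is `h x` whenever `ω` is the projection of `x ∈ A⁺`. -/
def Pairs (Γ : BicovariantCalculus k A Ω) (ω : Ω) (h : Module.Dual k A) (c : k) : Prop :=
  ∃ x : A, Coalgebra.counit (R := k) x = 0 ∧ Γ.maurerCartan x = ω ∧ h x = c

/-- `e` is the basis of `Λ¹` dual to the family `h` of elements of the quantum tangent space. -/
structure IsDualBasis {ι : Type*} [DecidableEq ι] (Γ : BicovariantCalculus k A Ω)
    (h : ι → Module.Dual k A) (e : ι → Γ.leftInvariant) : Prop where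
  linearIndependent : LinearIndependent k e
  span_eq_top : Submodule.span k (Set.range e) = ⊤
  pairs : ∀ i j, Γ.Pairs (e i) (h j) (if i = j then 1 else 0)

/-- A nonzero bicovariant calculus is irreducible if it has no proper quotients, that is, if it has
no proper nonzero sub-bimodule which is also a sub-bicomodule. -/
def IsIrreducible (Γ : BicovariantCalculus k A Ω) : Prop :=
  Nontrivial Ω ∧ ∀ N : Submodule k Ω,
    (∀ a, ∀ ω ∈ N, Γ.left a ω ∈ N) → (∀ a, ∀ ω ∈ N, Γ.right a ω ∈ N) →
    (∀ ω ∈ N, Γ.coactL ω ∈ LinearMap.range (N.subtype.lTensor A)) →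
    (∀ ω ∈ N, Γ.coactR ω ∈ LinearMap.range (N.subtype.rTensor A)) →
    N = ⊥ ∨ N = ⊤

end BicovariantCalculus

/-! ## Group factorizations and their bicrossproduct Hopf algebras -/

/-- A factorization `X = GM` of a group: multiplication `G × M → X` is a bijection. -/
structure GroupFactorization (X : Type*) [Group X] where
  G : Subgroup X
  M : Subgroup X
  compl : Subgroup.IsComplement' G M

namespace GroupFactorization

variable {X : Type v} [Group X] (F : GroupFactorization X)

/-- The factor `v ∈ G` of `x = v t`. -/
noncomputable def fstG (x : X) : F.G := (F.compl.equiv x).1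

/-- The factor `t ∈ M` of `x = v t`. -/
noncomputable def sndM (x : X) : F.M := (F.compl.equiv x).2

theorem fstG_mul_sndM (x : X) : (F.fstG x : X) * F.sndM x = x :=
  F.compl.equiv_fst_mul_equiv_snd x

theorem factor_unique {g g' : F.G} {m m' : F.M} (h : (g : X) * m = g' * m') : g = g' ∧ m = m' := by
  have := F.compl.1 (a₁ := (g, m)) (a₂ := (g', m')) h
  simpa using this

theorem fstG_eq {x : X} {g : F.G} {m : F.M} (h : x = g * m) : F.fstG x = g :=
  (F.factor_unique ((F.fstG_mul_sndM x).trans h)).1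

theorem sndM_eq {x : X} {g : F.G} {m : F.M} (h : x = g * m) : F.sndM x = m :=
  (F.factor_unique ((F.fstG_mul_sndM x).trans h)).2

/-- The left action `s ▷ u` of `M` on `G`, where `s u = (s ▷ u) (s ◁ u)`. -/
noncomputable def up (s : F.M) (u : F.G) : F.G := F.fstG (s * u)

/-- The right action `s ◁ u` of `G` on `M`, where `s u = (s ▷ u) (s ◁ u)`. -/
noncomputable def dn (s : F.M) (u : F.G) : F.M := F.sndM (s * u)

theorem up_mul_dn (s : F.M) (u : F.G) : (F.up s u : X) * F.dn s u = s * u := F.fstG_mul_sndM _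

theorem up_eq {s : F.M} {u g : F.G} {m : F.M} (h : (s : X) * u = g * m) : F.up s u = g :=
  F.fstG_eq h

theorem dn_eq {s : F.M} {u g : F.G} {m : F.M} (h : (s : X) * u = g * m) : F.dn s u = m :=
  F.sndM_eq h

@[simp] theorem up_one (s : F.M) : F.up s 1 = 1 := F.up_eq (m := s) (by simp)
@[simp] theorem dn_one (s : F.M) : F.dn s 1 = s := F.dn_eq (g := 1) (by simp)
@[simp] theorem one_up (u : F.G) : F.up 1 u = u := F.up_eq (m := 1) (by simp)
@[simp] theorem one_dn (u : F.G) : F.dn 1 u = 1 := F.dn_eq (g := u) (by simp)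

theorem up_mul_aux (s : F.M) (u v : F.G) :
    (s : X) * (u * v : F.G) = (F.up s u * F.up (F.dn s u) v : F.G) * F.dn (F.dn s u) v := by
  push_cast
  rw [mul_assoc, F.up_mul_dn (F.dn s u) v, ← mul_assoc, ← mul_assoc, F.up_mul_dn]

theorem up_mul (s : F.M) (u v : F.G) : F.up s (u * v) = F.up s u * F.up (F.dn s u) v :=
  F.up_eq (F.up_mul_aux s u v)

theorem dn_mul (s : F.M) (u v : F.G) : F.dn s (u * v) = F.dn (F.dn s u) v :=
  F.dn_eq (F.up_mul_aux s u v)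

theorem mul_up_aux (s t : F.M) (u : F.G) :
    ((s * t : F.M) : X) * u = F.up s (F.up t u) * (F.dn s (F.up t u) * F.dn t u : F.M) := by
  push_cast
  rw [← mul_assoc, F.up_mul_dn, mul_assoc, mul_assoc, F.up_mul_dn]

theorem mul_up (s t : F.M) (u : F.G) : F.up (s * t) u = F.up s (F.up t u) :=
  F.up_eq (F.mul_up_aux s t u)

theorem mul_dn (s t : F.M) (u : F.G) : F.dn (s * t) u = F.dn s (F.up t u) * F.dn t u :=
  F.dn_eq (F.mul_up_aux s t u)

theorem inv_aux (s : F.M) (u : F.G) :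
    (((F.dn s u)⁻¹ : F.M) : X) * ((F.up s u)⁻¹ : F.G) = (u⁻¹ : F.G) * (s⁻¹ : F.M) := by
  push_cast
  rw [← mul_inv_rev, ← mul_inv_rev, F.up_mul_dn]

theorem inv_up_inv (s : F.M) (u : F.G) : F.up (F.dn s u)⁻¹ (F.up s u)⁻¹ = u⁻¹ :=
  F.up_eq (F.inv_aux s u)

theorem inv_dn_inv (s : F.M) (u : F.G) : F.dn (F.dn s u)⁻¹ (F.up s u)⁻¹ = s⁻¹ :=
  F.dn_eq (F.inv_aux s u)

theorem dn_dn_inv (s : F.M) (u : F.G) : F.dn (F.dn s u) u⁻¹ = s := by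
  rw [← F.dn_mul]; simp

theorem dn_inv_dn (s : F.M) (u : F.G) : F.dn (F.dn s u⁻¹) u = s := by
  rw [← F.dn_mul]; simp

theorem dn_left_inj {s t : F.M} (u : F.G) : F.dn s u = F.dn t u ↔ s = t :=
  ⟨fun h => by rw [← F.dn_dn_inv s u, h, F.dn_dn_inv], fun h => h ▸ rfl⟩

noncomputable instance [Finite X] : Fintype F.M := Fintype.ofFinite _

/-- The underlying vector space of the bicrossproduct Hopf algebra `k(M) ▶◁ kG`, with basis
`δ_s ⊗ u` for `s ∈ M`, `u ∈ G`. -/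
def Bicross (k : Type u) [Field k] : Type max u v := F.M × F.G →₀ k

namespace Bicross

variable (k : Type u) [Field k]

noncomputable instance : AddCommGroup (F.Bicross k) := inferInstanceAs (AddCommGroup (_ →₀ k))
noncomputable instance : Module k (F.Bicross k) := inferInstanceAs (Module k (_ →₀ k))

/-- The basis `δ_s ⊗ u` of `k(M) ▶◁ kG`. -/
noncomputable def basis : Module.Basis (F.M × F.G) k (F.Bicross k) :=
  Module.Basis.ofRepr (LinearEquiv.refl k (F.M × F.G →₀ k))

variable {k} in
theorem hom_ext {N : Type*} [AddCommGroup N] [Module k N] {f g : F.Bicross k →ₗ[k] N}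
    (h : ∀ s u, f (basis F k (s, u)) = g (basis F k (s, u))) : f = g :=
  (basis F k).ext fun p => h p.1 p.2

open Classical in
/-- The product `(δ_s ⊗ u) (δ_t ⊗ v) = δ_{s ◁ u, t} δ_s ⊗ u v`. -/
noncomputable def mulMap : F.Bicross k →ₗ[k] F.Bicross k →ₗ[k] F.Bicross k :=
  (basis F k).constr k fun p => (basis F k).constr k fun q =>
    if F.dn p.1 p.2 = q.1 then basis F k (p.1, p.2 * q.2) else 0

open Classical in
theorem mulMap_basis (s t : F.M) (u v : F.G) :
    mulMap F k (basis F k (s, u)) (basis F k (t, v)) =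
      if F.dn s u = t then basis F k (s, u * v) else 0 := by
  simp [mulMap]

variable [Finite X]

/-- The unit `1 = ∑ δ_s ⊗ e`. -/
noncomputable def unit : F.Bicross k := ∑ s : F.M, basis F k (s, 1)

noncomputable instance : Ring (F.Bicross k) where
  __ := (inferInstance : AddCommGroup (F.Bicross k))
  mul a b := mulMap F k a b
  one := unit F k
  left_distrib a b c := map_add (mulMap F k a) b c
  right_distrib a b c := by
    change mulMap F k (a + b) c = mulMap F k a c + mulMap F k b c
    simp
  zero_mul a := by
    change mulMap F k 0 a = 0
    simp
  mul_zero a := map_zero (mulMap F k a)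
  mul_assoc a b c := by
    change mulMap F k (mulMap F k a b) c = mulMap F k a (mulMap F k b c)
    have : (mulMap F k).compr₂ (mulMap F k) =
        (LinearMap.lcomp k _ (mulMap F k) ∘ₗ (LinearMap.llcomp k _ _ _) ∘ₗ mulMap F k) := by
      refine hom_ext F fun s u => hom_ext F fun t v => hom_ext F fun r w => ?_
      simp only [LinearMap.compr₂_apply, LinearMap.comp_apply, LinearMap.lcomp_apply,
        LinearMap.llcomp_apply, mulMap_basis]
      by_cases h1 : F.dn s u = t <;> by_cases h2 : F.dn t v = r <;>
        simp [h1, h2, mulMap_basis, F.dn_mul, mul_assoc]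
    exact congr($this a b c)
  one_mul a := by
    change mulMap F k (unit F k) a = a
    have : mulMap F k (unit F k) = LinearMap.id :=
      hom_ext F fun s u => by
        have h (t : F.M) : F.dn t 1 = t := F.dn_one t
        simp only [unit, map_sum, LinearMap.sum_apply, mulMap_basis, one_mul]
        rw [Finset.sum_congr rfl fun t _ => by rw [h t]]
        simp
    exact congr($this a)
  mul_one a := by
    change (mulMap F k).flip (unit F k) a = a
    have : (mulMap F k).flip (unit F k) = LinearMap.id :=
      hom_ext F fun s u => by simp [unit, mulMap_basis]
    exact congr($this a)

open Classical in
theorem basis_mul (s t : F.M) (u v : F.G) : basis F k (s, u) * basis F k (t, v) =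
    if F.dn s u = t then basis F k (s, u * v) else 0 := mulMap_basis F k s t u v

theorem one_def : (1 : F.Bicross k) = ∑ s : F.M, basis F k (s, 1) := rfl

noncomputable instance : Algebra k (F.Bicross k) :=
  Algebra.ofModule
    (fun r a b => by
      change mulMap F k (r • a) b = r • mulMap F k a b
      simp)
    (fun r a b => map_smul (mulMap F k a) r b)

/-- The coproduct `Δ (δ_s ⊗ u) = ∑_{a b = s} (δ_a ⊗ b ▷ u) ⊗ (δ_b ⊗ u)`, the counit
`ε (δ_s ⊗ u) = δ_{s, e}`. -/
noncomputable instance : CoalgebraStruct k (F.Bicross k) where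
  comul := (basis F k).constr k fun p =>
    ∑ b : F.M, basis F k (p.1 * b⁻¹, F.up b p.2) ⊗ₜ[k] basis F k (b, p.2)
  counit := by
    classical exact (basis F k).constr k fun p => if p.1 = 1 then 1 else 0

theorem comul_basis (s : F.M) (u : F.G) : Coalgebra.comul (R := k) (basis F k (s, u)) =
    ∑ b : F.M, basis F k (s * b⁻¹, F.up b u) ⊗ₜ[k] basis F k (b, u) := by
  simp [Coalgebra.comul]

open Classical in
theorem counit_basis (s : F.M) (u : F.G) :
    Coalgebra.counit (R := k) (basis F k (s, u)) = if s = 1 then 1 else 0 := by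
  simp [Coalgebra.counit]

noncomputable instance : Coalgebra k (F.Bicross k) where
  coassoc := hom_ext F fun s u => by
    simp only [LinearMap.comp_apply, comul_basis, map_sum, LinearMap.rTensor_tmul,
      LinearMap.lTensor_tmul, TensorProduct.sum_tmul, TensorProduct.tmul_sum,
      LinearEquiv.coe_coe, TensorProduct.assoc_tmul]
    rw [Finset.sum_comm (γ := F.M) (f := fun b c => _ ⊗ₜ[k] (_ ⊗ₜ[k] basis F k (c, u)))]
    refine Finset.sum_congr rfl fun c _ => ?_
    refine Fintype.sum_equiv (Equiv.mulRight c) _ _ fun b => ?_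
    simp [F.mul_up, mul_assoc]
  rTensor_counit_comp_comul := hom_ext F fun s u => by
    classical
    simp [comul_basis, counit_basis, mul_inv_eq_one, TensorProduct.ite_tmul]
  lTensor_counit_comp_comul := hom_ext F fun s u => by
    classical
    simp [comul_basis, counit_basis, TensorProduct.tmul_ite]

theorem counit_mul' (a b : F.Bicross k) : Coalgebra.counit (R := k) (a * b) =
    Coalgebra.counit (R := k) a * Coalgebra.counit (R := k) b := by
  classical
  have : (LinearMap.mul k (F.Bicross k)).compr₂ (Coalgebra.counit (R := k)) =
      (LinearMap.mul k k).compl₁₂ (Coalgebra.counit (R := k)) (Coalgebra.counit (R := k)) := by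
    refine hom_ext F fun s u => hom_ext F fun t v => ?_
    simp only [LinearMap.compr₂_apply, LinearMap.compl₁₂_apply, LinearMap.mul_apply', basis_mul,
      counit_basis]
    by_cases hs : s = 1
    · subst hs
      by_cases ht : t = 1
      · simp [ht, counit_basis]
      · simp [ht, Ne.symm ht]
    · by_cases h : F.dn s u = t
      · simp [h, hs, counit_basis]
      · simp [h, hs]
  exact congr($this a b)

theorem comul_mul' (a b : F.Bicross k) : Coalgebra.comul (R := k) (a * b) =
    Coalgebra.comul (R := k) a * Coalgebra.comul (R := k) b := by
  classical
  have : (LinearMap.mul k (F.Bicross k)).compr₂ (Coalgebra.comul (R := k)) =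
      (LinearMap.mul k (F.Bicross k ⊗[k] F.Bicross k)).compl₁₂
        (Coalgebra.comul (R := k)) (Coalgebra.comul (R := k)) := by
    refine hom_ext F fun s u => hom_ext F fun t v => ?_
    simp only [LinearMap.compr₂_apply, LinearMap.compl₁₂_apply, LinearMap.mul_apply', basis_mul,
      comul_basis, Finset.sum_mul, Finset.mul_sum, Algebra.TensorProduct.tmul_mul_tmul]
    have key (b c : F.M) : (F.dn (s * b⁻¹) (F.up b u) = t * c⁻¹ ∧ F.dn b u = c) ↔
        (F.dn s u = t ∧ F.dn b u = c) := by
      refine and_congr_left fun h => ?_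
      have : F.dn s u = F.dn (s * b⁻¹) (F.up b u) * F.dn b u := by
        rw [← F.mul_dn, inv_mul_cancel_right]
      rw [this, h, eq_mul_inv_iff_mul_eq]
    have e (b c : F.M) : (if F.dn (s * b⁻¹) (F.up b u) = t * c⁻¹ then
          basis F k (s * b⁻¹, F.up b u * F.up c v) else 0) ⊗ₜ[k]
        (if F.dn b u = c then basis F k (b, u * v) else 0) =
        if F.dn b u = c then (if F.dn s u = t then
          basis F k (s * b⁻¹, F.up b (u * v)) ⊗ₜ[k] basis F k (b, u * v) else 0) else 0 := by
      have := key b c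
      by_cases h : F.dn b u = c
      · subst h
        by_cases h' : F.dn s u = t
        · simp_all [F.up_mul]
        · simp_all
      · simp [h]
    simp only [e]
    rw [Finset.sum_comm]
    simp only [Finset.sum_ite_eq, Finset.mem_univ, if_true]
    by_cases h' : F.dn s u = t
    · simp [h', comul_basis]
    · simp [h']
  exact congr($this a b)

theorem comul_one' : Coalgebra.comul (R := k) (1 : F.Bicross k) = 1 := by
  rw [Algebra.TensorProduct.one_def, one_def]
  simp only [map_sum, comul_basis, F.up_one, TensorProduct.sum_tmul, TensorProduct.tmul_sum]
  rw [Finset.sum_comm]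
  refine Finset.sum_congr rfl fun b _ => ?_
  exact Fintype.sum_equiv (Equiv.mulRight b⁻¹) _ _ fun s => by simp

noncomputable instance : Bialgebra k (F.Bicross k) :=
  Bialgebra.mk' k (F.Bicross k)
    (by classical simp [one_def, counit_basis])
    (fun {a b} => counit_mul' F k a b) (comul_one' F k) (fun {a b} => comul_mul' F k a b)

/-- The antipode `S (δ_s ⊗ u) = δ_{(s ◁ u)⁻¹} ⊗ (s ▷ u)⁻¹`. -/
noncomputable instance : HopfAlgebraStruct k (F.Bicross k) where
  antipode := (basis F k).constr k fun p => basis F k ((F.dn p.1 p.2)⁻¹, (F.up p.1 p.2)⁻¹)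

theorem antipode_basis (s : F.M) (u : F.G) : HopfAlgebra.antipode k (basis F k (s, u)) =
    basis F k ((F.dn s u)⁻¹, (F.up s u)⁻¹) := by
  simp [HopfAlgebra.antipode]

noncomputable instance : HopfAlgebra k (F.Bicross k) where
  mul_antipode_rTensor_comul := hom_ext F fun s u => by
    classical
    have hd (b : F.M) : F.dn (s * b⁻¹) (F.up b u) = F.dn s u * (F.dn b u)⁻¹ := by
      rw [eq_mul_inv_iff_mul_eq, ← F.mul_dn, inv_mul_cancel_right]
    have hu (b : F.M) : F.up (s * b⁻¹) (F.up b u) = F.up s u := by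
      rw [← F.mul_up, inv_mul_cancel_right]
    have hi (b : F.M) : F.dn (F.dn b u * (F.dn s u)⁻¹) (F.up s u)⁻¹ = b * s⁻¹ := by
      rw [F.mul_dn, F.inv_up_inv, F.inv_dn_inv, F.dn_dn_inv]
    simp only [LinearMap.comp_apply, comul_basis, map_sum, LinearMap.rTensor_tmul, antipode_basis,
      LinearMap.mul'_apply, basis_mul, hd, hu, mul_inv_rev, inv_inv, hi, counit_basis]
    by_cases hs : s = 1
    · subst hs
      simp only [inv_one, mul_one, F.one_dn, F.one_up, if_true, inv_mul_cancel,
        Algebra.linearMap_apply, map_one, one_def]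
      refine Fintype.sum_bijective (fun b => F.dn b u)
        ⟨fun a b h => (F.dn_left_inj u).1 h, fun b => ⟨F.dn b u⁻¹, F.dn_inv_dn b u⟩⟩ _ _ ?_
      simp
    · simp [hs]
  mul_antipode_lTensor_comul := hom_ext F fun s u => by
    classical
    have hd (b : F.M) : F.dn (s * b⁻¹) (F.up b u) = F.dn s u * (F.dn b u)⁻¹ := by
      rw [eq_mul_inv_iff_mul_eq, ← F.mul_dn, inv_mul_cancel_right]
    simp only [LinearMap.comp_apply, comul_basis, map_sum, LinearMap.lTensor_tmul, antipode_basis,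
      LinearMap.mul'_apply, basis_mul, hd, counit_basis]
    by_cases hs : s = 1
    · subst hs
      simp only [F.one_dn, one_mul, if_true, mul_inv_cancel, Algebra.linearMap_apply, map_one,
        one_def]
      exact Fintype.sum_equiv (Equiv.inv F.M) _ _ fun b => by simp
    · have hs' : F.dn s u ≠ 1 := fun h => hs ((F.dn_left_inj u).1 (by simpa using h))
      simp [hs, hs']

/-- The function `δ_s ∈ k(M)` as the element `δ_s ⊗ e` of `k(M) ▶◁ kG`. -/
noncomputable def delta (s : F.M) : F.Bicross k := basis F k (s, 1)

/-- The group element `u ∈ G ⊆ kG` as the element `∑ δ_s ⊗ u` of `k(M) ▶◁ kG`. -/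
noncomputable def grp (u : F.G) : F.Bicross k := ∑ s : F.M, basis F k (s, u)

end Bicross

/-! ## The `X`-crossed module `kX` and the quantum tangent spaces -/

/-- The degree `||v t|| = v⁻¹ t⁻¹ v` of `v t ∈ X`. -/
noncomputable def deg (x : X) : X := (F.fstG x : X)⁻¹ * (F.sndM x : X)⁻¹ * F.fstG x

/-- The factor `⟨z⟩ ∈ M` in the factorization `z = ⟨z⟩⁻¹ |z|` of `z ∈ X`, where `|z| ∈ G`. -/
noncomputable def mPart (z : X) : F.M := F.sndM z⁻¹

/-- The factor `|z| ∈ G` in the factorization `z = ⟨z⟩⁻¹ |z|` of `z ∈ X`, where `⟨z⟩ ∈ M`. -/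
noncomputable def gPart (z : X) : F.G := (F.fstG z⁻¹)⁻¹

theorem mPart_inv_mul_gPart (z : X) : (F.mPart z : X)⁻¹ * F.gPart z = z := by
  have := congrArg (·⁻¹) (F.fstG_mul_sndM z⁻¹)
  simpa [mPart, gPart] using this

/-- The right action of `X` on its underlying set which takes `x = v t` and `y = u s` to
`(r ▷ (v u)) (r t r⁻¹)`, where `r = s⁻¹ ◁ (v u)⁻¹` in the sense of the action of `G` on `M`. -/
noncomputable def act (x y : X) : X :=
  let v := F.fstG x
  let t := F.sndM x
  let u := F.fstG y
  let s := F.sndM y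
  let r := F.dn s⁻¹ (v * u)⁻¹
  F.up r (v * u) * (r * t * r⁻¹ : F.M)

theorem act_eq {x y : X} {m : F.M} {g : F.G} (h : (F.fstG x : X) * y = m * g) :
    F.act x y = g * (m⁻¹ * F.sndM x * m : F.M) := by
  set w := F.fstG x * F.fstG y with hw
  have h1 : ((F.sndM y)⁻¹ : X) * (w : X)⁻¹ = (g : X)⁻¹ * (m : X)⁻¹ := by
    rw [← mul_inv_rev, ← mul_inv_rev, ← h, hw]
    push_cast
    rw [mul_assoc, F.fstG_mul_sndM]
  have h2 : F.dn (F.sndM y)⁻¹ w⁻¹ = m⁻¹ := F.dn_eq (g := g⁻¹) (by push_cast; exact h1)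
  have h3 : F.up m⁻¹ w = g := F.up_eq (m := (F.sndM y)⁻¹) (by
    have h4 := congrArg (fun p => (g : X) * p * w) h1
    push_cast
    simpa [mul_assoc] using h4.symm)
  simp only [act, ← hw, h2, h3, inv_inv]

theorem exists_factor (x : X) : ∃ (m : F.M) (g : F.G), x = m * g :=
  ⟨(F.mPart x)⁻¹, F.gPart x, by push_cast; exact (F.mPart_inv_mul_gPart x).symm⟩

theorem act_one (x : X) : F.act x 1 = x := by
  rw [F.act_eq (m := 1) (g := F.fstG x) (by simp)]
  simpa using F.fstG_mul_sndM x

theorem act_act (x y z : X) : F.act (F.act x y) z = F.act x (y * z) := by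
  obtain ⟨m, g, h⟩ := F.exists_factor (F.fstG x * y)
  obtain ⟨n, l, h'⟩ := F.exists_factor (g * z)
  have h1 := F.act_eq h
  have hg : F.fstG (F.act x y) = g := F.fstG_eq h1
  have hm : F.sndM (F.act x y) = m⁻¹ * F.sndM x * m := F.sndM_eq h1
  rw [F.act_eq (x := F.act x y) (y := z) (m := n) (g := l) (by rw [hg, h']),
    F.act_eq (x := x) (y := y * z) (m := m * n) (g := l) (by
      rw [← mul_assoc, h, mul_assoc, h']; push_cast; rw [mul_assoc]), hm]
  simp [mul_assoc]

section Tangent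

variable (k : Type u) [Field k]

/-- The right action `w ◁ y` of `y ∈ X` on `w ∈ kX`. -/
noncomputable def actMap (y : X) : (X →₀ k) →ₗ[k] (X →₀ k) :=
  Finsupp.lmapDomain k k (fun x => F.act x y)

theorem actMap_actMap (y z : X) (w : X →₀ k) :
    F.actMap k z (F.actMap k y w) = F.actMap k (y * z) w := by
  simp only [actMap, Finsupp.lmapDomain_apply, ← Finsupp.mapDomain_comp]
  congr 1
  funext x
  exact F.act_act x y z

/-- The space `J_z ⊆ kX` of elements of `X`-degree `z`, spanned by the `x ∈ X` with
`||x|| = z`. -/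
noncomputable def homogeneous (z : X) : Submodule k (X →₀ k) :=
  Finsupp.supported k k {x | F.deg x = z}

variable {k}

/-- `M₀ ⊆ J_{z₀}` is an irreducible right subrepresentation of the centralizer of `z₀` in `X`, where
`z₀` lies in the image `Z` of `||·||`, and `M₀` is not the trivial representation in case
`z₀ = e`. -/
structure IsDatum (z₀ : X) (M₀ : Submodule k (X →₀ k)) : Prop where
  mem_range : z₀ ∈ Set.range F.deg
  le : M₀ ≤ F.homogeneous k z₀
  stable : ∀ x ∈ Subgroup.centralizer {z₀}, ∀ w ∈ M₀, F.actMap k x w ∈ M₀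
  ne_bot : M₀ ≠ ⊥
  irreducible : ∀ N ≤ M₀, (∀ x ∈ Subgroup.centralizer {z₀}, ∀ w ∈ N, F.actMap k x w ∈ N) →
    N = ⊥ ∨ N = M₀
  nontrivial : z₀ = 1 → ∃ x : X, ∃ w ∈ M₀, F.actMap k x w ≠ w

/-- The subrepresentation `𝓜 = ⨁_{z ∈ C} M₀ ◁ z̄` of `kX`, where `C` is the conjugacy class of
`z₀` and `z = z̄⁻¹ z₀ z̄`. It is written as the sum of all `M₀ ◁ x`, `x ∈ X`, because
`M₀ ◁ x` depends only on `x⁻¹ z₀ x` when `M₀` is stable under the centralizer of `z₀`. -/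
noncomputable def induced (M₀ : Submodule k (X →₀ k)) : Submodule k (X →₀ k) :=
  ⨆ x : X, M₀.map (F.actMap k x)

theorem actMap_mem_induced (M₀ : Submodule k (X →₀ k)) (y : X) :
    ∀ w ∈ F.induced M₀, F.actMap k y w ∈ F.induced M₀ := by
  intro w hw
  have : F.induced M₀ ≤ (F.induced M₀).comap (F.actMap k y) := by
    refine iSup_le fun x => ?_
    rintro _ ⟨m, hm, rfl⟩
    rw [Submodule.mem_comap, actMap_actMap]
    exact Submodule.mem_iSup_of_mem (x * y) ⟨m, hm, rfl⟩
  exact this hw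

/-- The right action of `X` on `𝓜`. -/
noncomputable def actInduced (M₀ : Submodule k (X →₀ k)) (y : X) :
    F.induced M₀ →ₗ[k] F.induced M₀ :=
  (F.actMap k y).restrict (F.actMap_mem_induced M₀ y)

variable (k) [Finite X]

open Classical in
/-- The map `Π : kX → H⁺ ⊆ H = A*`, `v t ↦ t ⊗ δ_v - δ_{v, e} 1`, where `A = k(M) ▶◁ kG`,
`t ⊗ δ_v` is the basis of `H` dual to the basis `δ_t ⊗ v` of `A`, and the unit `1` of `H` is the
counit of `A`. -/
noncomputable def proj : (X →₀ k) →ₗ[k] Module.Dual k (F.Bicross k) :=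
  Finsupp.linearCombination k fun x : X =>
    (Bicross.basis F k).coord (F.sndM x, F.fstG x) -
      if F.fstG x = 1 then (Coalgebra.counit : F.Bicross k →ₗ[k] k) else 0

end Tangent

end GroupFactorization

/-! A bicovariant calculus is controlled by its Maurer-Cartan map `π(a) = ∑ S(a₁) d a₂`. Convolution
with the antipode is invertible (`lift_antipode_cancel`), so `d a = ∑ a₁ π(a₂)` and `ω b = ∑ b₁ (ω ◁
b₂)` with `ω ◁ b = ∑ S(b₁) ω b₂`, while `π(x b) = π(x) ◁ b` for `x ∈ A⁺`. Hence `Ω¹ = A ⊗ Λ¹`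
(`leftFree_bijective`). Since the tangent space is finite-dimensional here, the pairing identifies
`Λ¹` with its dual, that is with `𝓜*` through `Π`. Every formula of the theorem then becomes the
dual of an operator on `kX`.

The two operators that matter are computed in `toDual_mul_basis` and `toDual_coadjoint`. The dual of
right multiplication by `δ_r ⊗ w` is the action of `w⁻¹` followed by projection to the degrees `z`
with `⟨z⟩ = r`. The dual of the coadjoint operator of the coordinate `(r, w)` is the action of `r ◁
w ∈ M` followed by projection to the degrees with `|z| = w`. So the product and the adjoint coaction
of `A` encode exactly the `X`-action and the `X`-grading of `kX`. For a homogeneous dual basis, `e_a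
◁ (δ_r ⊗ u)` is `e_a * u` if `r = ⟨f_a⟩` and `0` otherwise, and the coproduct of `A` turns this into
the commutation relations. The formulas for `d` come from the values of `Π(f)` on the basis of `A`:
a homogeneous vector meets `M ⊂ X` only at `⟨f_a⟩`, so just the coefficient `c_a` enters.

Existence: let `K ⊆ A` be the annihilator of `𝓜 ⊆ kX ≅ A*`. By the two operator formulas `K` is a
right ideal stable under the adjoint coaction. The counit corresponds to `∑_{u ∈ G} u`, an invariant
vector of degree `e`; excluding the trivial representation keeps it out of `𝓜`, which gives both
injectivity of `Π` and an element of `K` with counit `1`. In the Hopf bimodule `A ⊗ A` with `θ = 1 ⊗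
1`, the elements `κ(y) = ∑ S(y₁) θ y₂`, `y ∈ K`, generate a sub-bimodule and sub-bicomodule; the
commutator `[θ, ·]` on the quotient is the calculus sought.

Irreducibility: a sub-bimodule and sub-bicomodule annihilates a subspace of the tangent space stable
under the same operators, hence a graded `X`-submodule of `𝓜`. Such a submodule is determined by its
part of degree `z₀`, to which irreducibility of `M₀` applies. -/

/-! ## Hopf bimodules -/

section Convolution

variable {k A C W : Type*} [Field k] [Ring A] [HopfAlgebra k A] [AddCommGroup C] [Module k C]
  [AddCommGroup W] [Module k W]

/-- If the linear endomorphisms `S` and `T` of `A` are mutually inverse for convolution, then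
acting by `T` and then by `S` along a coaction `ρ` is the identity. -/
theorem lift_antipode_cancel (lam : A →ₗ[k] W →ₗ[k] W) (h1 : ∀ w, lam 1 w = w)
    (hm : ∀ a b w, lam (a * b) w = lam a (lam b w)) (ρ : C →ₗ[k] A ⊗[k] C)
    (hρ : ∀ x, TensorProduct.assoc k A A C
      ((Coalgebra.comul (R := k) (A := A)).rTensor C (ρ x)) = ρ.lTensor A (ρ x))
    (hε : ∀ x, TensorProduct.lid k C ((Coalgebra.counit (R := k) (A := A)).rTensor C (ρ x)) = x)
    (S T : A →ₗ[k] A)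
    (hST : ∀ a, LinearMap.mul' k A (TensorProduct.map S T (Coalgebra.comul (R := k) a)) =
      algebraMap k A (Coalgebra.counit a)) (φ : C →ₗ[k] W) (x : C) :
    TensorProduct.lift ((lam ∘ₗ S).compl₂ (TensorProduct.lift ((lam ∘ₗ T).compl₂ φ) ∘ₗ ρ)) (ρ x) =
      φ x := by
  set G : A ⊗[k] (A ⊗[k] C) →ₗ[k] W :=
    TensorProduct.lift ((lam ∘ₗ S).compl₂ (TensorProduct.lift ((lam ∘ₗ T).compl₂ φ))) with hG
  have e1 : TensorProduct.lift ((lam ∘ₗ S).compl₂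
      (TensorProduct.lift ((lam ∘ₗ T).compl₂ φ) ∘ₗ ρ)) = G ∘ₗ ρ.lTensor A := by
    ext a c; simp [hG]
  have e2 : G ∘ₗ (TensorProduct.assoc k A A C).toLinearMap ∘ₗ
      (Coalgebra.comul (R := k) (A := A)).rTensor C =
      φ ∘ₗ (TensorProduct.lid k C).toLinearMap ∘ₗ
        (Coalgebra.counit (R := k) (A := A)).rTensor C := by
    ext a c
    have : ∀ t : A ⊗[k] A, G (TensorProduct.assoc k A A C (t ⊗ₜ c)) =
        lam (LinearMap.mul' k A (TensorProduct.map S T t)) (φ c) := by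
      intro t
      induction t with
      | zero => simp
      | add x y hx hy => simp [TensorProduct.add_tmul, hx, hy]
      | tmul x y => simp [hG, hm]
    simp [this, hST, Algebra.algebraMap_eq_smul_one, h1]
  have := congr($e2 (ρ x))
  simp only [LinearMap.comp_apply, LinearEquiv.coe_coe, hρ, hε] at this
  rw [e1, LinearMap.comp_apply, this]

theorem mul'_map_antipode_id (a : A) : LinearMap.mul' k A (TensorProduct.map (HopfAlgebra.antipode k)
    LinearMap.id (Coalgebra.comul (R := k) a)) = algebraMap k A (Coalgebra.counit a) :=
  HopfAlgebra.mul_antipode_rTensor_comul_apply a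

theorem mul'_map_id_antipode (a : A) : LinearMap.mul' k A (TensorProduct.map LinearMap.id
    (HopfAlgebra.antipode k) (Coalgebra.comul (R := k) a)) = algebraMap k A (Coalgebra.counit a) :=
  HopfAlgebra.mul_antipode_lTensor_comul_apply a

/-- A map from `A` to an `A`-module is determined by its left convolution with the action. -/
theorem eq_of_lift_compl₂_comul (lam : A →ₗ[k] W →ₗ[k] W) (h1 : ∀ w, lam 1 w = w)
    (hm : ∀ a b w, lam (a * b) w = lam a (lam b w)) {φ ψ : A →ₗ[k] W}
    (h : ∀ a, TensorProduct.lift (lam.compl₂ φ) (Coalgebra.comul (R := k) a) =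
      TensorProduct.lift (lam.compl₂ ψ) (Coalgebra.comul (R := k) a)) : φ = ψ := by
  have h' : TensorProduct.lift (lam.compl₂ φ) ∘ₗ Coalgebra.comul =
      TensorProduct.lift (lam.compl₂ ψ) ∘ₗ Coalgebra.comul := LinearMap.ext h
  have key (χ : A →ₗ[k] W) (a : A) := lift_antipode_cancel lam h1 hm (Coalgebra.comul (R := k))
    Coalgebra.coassoc_apply (by simp) _ _ mul'_map_antipode_id χ a
  simp only [LinearMap.comp_id] at key
  ext a
  rw [← key φ, ← key ψ, h']

end Convolution

/-- A Hopf bimodule over a Hopf algebra `A`: a bimodule and bicomodule with the coactions being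
bimodule maps. -/
structure HopfBimodule (k : Type*) (A : Type*) (Ω : Type*) [Field k] [Ring A]
    [HopfAlgebra k A] [AddCommGroup Ω] [Module k Ω] where
  left : A →ₗ[k] Ω →ₗ[k] Ω
  right : A →ₗ[k] Ω →ₗ[k] Ω
  left_one : ∀ ω, left 1 ω = ω
  left_mul : ∀ a b ω, left (a * b) ω = left a (left b ω)
  right_one : ∀ ω, right 1 ω = ω
  right_mul : ∀ a b ω, right (a * b) ω = right b (right a ω)
  left_right : ∀ a b ω, right b (left a ω) = left a (right b ω)
  coactL : Ω →ₗ[k] A ⊗[k] Ω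
  coactR : Ω →ₗ[k] Ω ⊗[k] A
  coactL_coassoc : ∀ ω, TensorProduct.assoc k A A Ω
    ((Coalgebra.comul (R := k) (A := A)).rTensor Ω (coactL ω)) = coactL.lTensor A (coactL ω)
  coactL_counit : ∀ ω, TensorProduct.lid k Ω
    ((Coalgebra.counit (R := k) (A := A)).rTensor Ω (coactL ω)) = ω
  coactR_coassoc : ∀ ω, TensorProduct.assoc k Ω A A (coactR.rTensor A (coactR ω)) =
    (Coalgebra.comul (R := k) (A := A)).lTensor Ω (coactR ω)
  coactR_counit : ∀ ω, TensorProduct.rid k Ω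
    ((Coalgebra.counit (R := k) (A := A)).lTensor Ω (coactR ω)) = ω
  coact_comm : ∀ ω, TensorProduct.assoc k A Ω A (coactL.rTensor A (coactR ω)) =
    coactR.lTensor A (coactL ω)
  coactL_left : ∀ a ω, coactL (left a ω) =
    TensorProduct.map₂ (LinearMap.mul k A) left (Coalgebra.comul (R := k) a) (coactL ω)
  coactL_right : ∀ a ω, coactL (right a ω) =
    TensorProduct.map₂ (LinearMap.mul k A).flip right (Coalgebra.comul (R := k) a) (coactL ω)
  coactR_left : ∀ a ω, coactR (left a ω) =
    TensorProduct.map₂ left (LinearMap.mul k A) (Coalgebra.comul (R := k) a) (coactR ω)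
  coactR_right : ∀ a ω, coactR (right a ω) =
    TensorProduct.map₂ right (LinearMap.mul k A).flip (Coalgebra.comul (R := k) a) (coactR ω)

namespace HopfBimodule

variable {k A Ω : Type*} [Field k] [Ring A] [HopfAlgebra k A] [AddCommGroup Ω] [Module k Ω]
  (B : HopfBimodule k A Ω)

/-- The left convolution `a ↦ ∑ S(a₁) D(a₂)` of a linear map `D : A → Ω` with the antipode. -/
noncomputable def maurerCartan (D : A →ₗ[k] Ω) : A →ₗ[k] Ω :=
  TensorProduct.lift ((B.left ∘ₗ HopfAlgebra.antipode k).compl₂ D) ∘ₗ Coalgebra.comul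

/-- The right adjoint action `ω ◁ b = ∑ S(b₁) ω b₂`. -/
noncomputable def adjoint (ω : Ω) : A →ₗ[k] Ω := B.maurerCartan (B.right.flip ω)

/-- Convolution with the identity undoes convolution with the antipode. For `D = d` this recovers
the differential from `π`. -/
theorem eq_lift_maurerCartan (D : A →ₗ[k] Ω) (a : A) :
    D a = TensorProduct.lift (B.left.compl₂ (B.maurerCartan D)) (Coalgebra.comul (R := k) a) := by
  have := lift_antipode_cancel B.left B.left_one B.left_mul (Coalgebra.comul (R := k))
    Coalgebra.coassoc_apply (by simp) _ _ mul'_map_id_antipode D a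
  simpa [maurerCartan] using this.symm

theorem right_eq_lift_adjoint (a : A) (ω : Ω) : B.right a ω =
    TensorProduct.lift (B.left.compl₂ (B.adjoint ω)) (Coalgebra.comul (R := k) a) :=
  B.eq_lift_maurerCartan (B.right.flip ω) a

/-- The action of `A` on `A ⊗ Ω` through the coproduct. -/
noncomputable def diagL : A →ₗ[k] A ⊗[k] Ω →ₗ[k] A ⊗[k] Ω :=
  TensorProduct.map₂ (LinearMap.mul k A) B.left ∘ₗ Coalgebra.comul

/-- The action of `A` on `Ω ⊗ A` through the coproduct. -/
noncomputable def diagR : A →ₗ[k] Ω ⊗[k] A →ₗ[k] Ω ⊗[k] A :=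
  TensorProduct.map₂ B.left (LinearMap.mul k A) ∘ₗ Coalgebra.comul

theorem map₂_mul_left_mul (x y : A ⊗[k] A) (z : A ⊗[k] Ω) :
    TensorProduct.map₂ (LinearMap.mul k A) B.left (x * y) z =
    TensorProduct.map₂ (LinearMap.mul k A) B.left x
      (TensorProduct.map₂ (LinearMap.mul k A) B.left y z) := by
  induction x with
  | zero => simp
  | add x x' hx hx' => simp [add_mul, hx, hx']
  | tmul a b =>
    induction y with
    | zero => simp
    | add x x' hx hx' => simp [mul_add, hx, hx']
    | tmul c d =>
      induction z with
      | zero => simp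
      | add x x' hx hx' => simp only [map_add, hx, hx']
      | tmul e ω => simp [B.left_mul, mul_assoc]

theorem map₂_left_mul_mul (x y : A ⊗[k] A) (z : Ω ⊗[k] A) :
    TensorProduct.map₂ B.left (LinearMap.mul k A) (x * y) z =
    TensorProduct.map₂ B.left (LinearMap.mul k A) x
      (TensorProduct.map₂ B.left (LinearMap.mul k A) y z) := by
  induction x with
  | zero => simp
  | add x x' hx hx' => simp [add_mul, hx, hx']
  | tmul a b =>
    induction y with
    | zero => simp
    | add x x' hx hx' => simp [mul_add, hx, hx']
    | tmul c d =>
      induction z with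
      | zero => simp
      | add x x' hx hx' => simp only [map_add, hx, hx']
      | tmul e ω => simp [B.left_mul, mul_assoc]

theorem diagL_mul (a b : A) (z : A ⊗[k] Ω) : B.diagL (a * b) z = B.diagL a (B.diagL b z) := by
  simp [diagL, map₂_mul_left_mul]

theorem diagR_mul (a b : A) (z : Ω ⊗[k] A) : B.diagR (a * b) z = B.diagR a (B.diagR b z) := by
  simp [diagR, map₂_left_mul_mul]

theorem diagL_one (z : A ⊗[k] Ω) : B.diagL 1 z = z := by
  induction z with
  | zero => simp
  | add x x' hx hx' => simp only [map_add, hx, hx']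
  | tmul e ω => simp [diagL, Algebra.TensorProduct.one_def, B.left_one]

theorem diagR_one (z : Ω ⊗[k] A) : B.diagR 1 z = z := by
  induction z with
  | zero => simp
  | add x x' hx hx' => simp only [map_add, hx, hx']
  | tmul e ω => simp [diagR, Algebra.TensorProduct.one_def, B.left_one]

/-- After left convolution with the diagonal action both maps `A → A ⊗ Ω` become `∑ a₁ ⊗ D(a₂)`, one
by reconstruction of `D`, the other by coassociativity. The convolution is then cancelled, which
avoids the coproduct of `S(a)`. -/
theorem coactL_maurerCartan (D : A →ₗ[k] Ω)
    (hD : ∀ a, B.coactL (D a) = D.lTensor A (Coalgebra.comul (R := k) a)) (a : A) :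
    B.coactL (B.maurerCartan D a) = 1 ⊗ₜ[k] B.maurerCartan D a := by
  have : B.coactL ∘ₗ B.maurerCartan D = TensorProduct.mk k A Ω 1 ∘ₗ B.maurerCartan D := by
    refine eq_of_lift_compl₂_comul B.diagL B.diagL_one B.diagL_mul fun a => ?_
    have h1 : TensorProduct.lift (B.diagL.compl₂ (B.coactL ∘ₗ B.maurerCartan D)) =
        B.coactL ∘ₗ TensorProduct.lift (B.left.compl₂ (B.maurerCartan D)) := by
      ext x y; simp [B.coactL_left, diagL]
    have h2 : TensorProduct.lift (B.diagL.compl₂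
        (TensorProduct.mk k A Ω 1 ∘ₗ B.maurerCartan D)) =
        (TensorProduct.lift (B.left.compl₂ (B.maurerCartan D))).lTensor A ∘ₗ
          (TensorProduct.assoc k A A A).toLinearMap ∘ₗ Coalgebra.comul.rTensor A := by
      ext x y
      simp only [diagL, TensorProduct.AlgebraTensorModule.curry_apply, TensorProduct.curry_apply,
        LinearMap.coe_restrictScalars, TensorProduct.lift.tmul, LinearMap.compl₂_apply,
        LinearMap.comp_apply, TensorProduct.mk_apply, LinearEquiv.coe_coe, LinearMap.rTensor_tmul]
      generalize Coalgebra.comul (R := k) x = t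
      induction t with
      | zero => simp
      | add x x' hx hx' => simp [TensorProduct.add_tmul, hx, hx']
      | tmul e ω => simp
    rw [h1, h2]
    simp only [LinearMap.comp_apply, ← eq_lift_maurerCartan, hD, LinearEquiv.coe_coe,
      Coalgebra.coassoc_apply]
    rw [← LinearMap.comp_apply (LinearMap.lTensor A _) (LinearMap.lTensor A _),
      ← LinearMap.lTensor_comp]
    congr 2
    ext x
    exact B.eq_lift_maurerCartan D x
  exact congr($this a)

end HopfBimodule

/-! ### The right adjoint coaction, and the coinvariants of a Hopf bimodule -/

namespace HopfAlgebra

variable (k A : Type*) [Field k] [Ring A] [HopfAlgebra k A]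

/-- The action of `A` on `A ⊗ A` by left multiplication on the second factor. -/
noncomputable def mulSnd : A →ₗ[k] A ⊗[k] A →ₗ[k] A ⊗[k] A :=
  LinearMap.lTensorHom A ∘ₗ LinearMap.mul k A

/-- The right adjoint coaction `a ↦ ∑ a₂ ⊗ S(a₁) a₃`. -/
noncomputable def adjointCoaction : A →ₗ[k] A ⊗[k] A :=
  TensorProduct.lift ((mulSnd k A ∘ₗ HopfAlgebra.antipode k).compl₂ Coalgebra.comul) ∘ₗ
    Coalgebra.comul

variable {k A}

theorem mulSnd_one (z : A ⊗[k] A) : mulSnd k A 1 z = z := by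
  have : LinearMap.mul k A 1 = LinearMap.id := by ext; simp
  simp [mulSnd, this]

theorem mulSnd_mul (a b : A) (z : A ⊗[k] A) :
    mulSnd k A (a * b) z = mulSnd k A a (mulSnd k A b z) := by
  have : LinearMap.mul k A (a * b) = LinearMap.mul k A a ∘ₗ LinearMap.mul k A b := by
    ext; simp [mul_assoc]
  simp [mulSnd, this, LinearMap.lTensor_comp]

theorem lift_mulSnd_adjointCoaction (a : A) : TensorProduct.lift
    ((mulSnd k A).compl₂ (adjointCoaction k A)) (Coalgebra.comul (R := k) a) =
      Coalgebra.comul (R := k) a := by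
  have := lift_antipode_cancel (mulSnd k A) mulSnd_one mulSnd_mul (Coalgebra.comul (R := k))
    Coalgebra.coassoc_apply (by simp) _ _ mul'_map_id_antipode (Coalgebra.comul (R := k)) a
  simpa [adjointCoaction] using this

end HopfAlgebra

namespace HopfBimodule

open HopfAlgebra

variable {k A Ω : Type*} [Field k] [Ring A] [HopfAlgebra k A] [AddCommGroup Ω] [Module k Ω]
  (B : HopfBimodule k A Ω)

/-- The same cancellation with `A` acting diagonally on `Ω ⊗ A`: `lift_mulSnd_adjointCoaction`
collapses the adjoint coaction to the coproduct, and both sides become `∑ D(a₁) ⊗ a₂`. -/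
theorem coactR_maurerCartan (D : A →ₗ[k] Ω)
    (hD : ∀ a, B.coactR (D a) = D.rTensor A (Coalgebra.comul (R := k) a)) (a : A) :
    B.coactR (B.maurerCartan D a) = (B.maurerCartan D).rTensor A (adjointCoaction k A a) := by
  have : B.coactR ∘ₗ B.maurerCartan D = (B.maurerCartan D).rTensor A ∘ₗ adjointCoaction k A := by
    refine eq_of_lift_compl₂_comul B.diagR B.diagR_one B.diagR_mul fun a => ?_
    have h1 : TensorProduct.lift (B.diagR.compl₂ (B.coactR ∘ₗ B.maurerCartan D)) =
        B.coactR ∘ₗ TensorProduct.lift (B.left.compl₂ (B.maurerCartan D)) := by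
      ext x y; simp [B.coactR_left, diagR]
    -- `H` sends `x ⊗ (y ⊗ z)` to `x π(y) ⊗ z`, where `π` is the Maurer-Cartan map of `D`.
    set H : A ⊗[k] (A ⊗[k] A) →ₗ[k] Ω ⊗[k] A := TensorProduct.lift
      ((LinearMap.rTensorHom A ∘ₗ B.left).compl₂ ((B.maurerCartan D).rTensor A)) with hH
    have h2 : TensorProduct.lift (B.diagR.compl₂
        ((B.maurerCartan D).rTensor A ∘ₗ adjointCoaction k A)) =
        H ∘ₗ (TensorProduct.lift ((mulSnd k A).compl₂ (adjointCoaction k A))).lTensor A ∘ₗ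
          (TensorProduct.assoc k A A A).toLinearMap ∘ₗ Coalgebra.comul.rTensor A := by
      ext x y
      simp only [diagR, TensorProduct.AlgebraTensorModule.curry_apply, TensorProduct.curry_apply,
        LinearMap.coe_restrictScalars, TensorProduct.lift.tmul, LinearMap.compl₂_apply,
        LinearMap.comp_apply, LinearEquiv.coe_coe, LinearMap.rTensor_tmul]
      generalize Coalgebra.comul (R := k) x = t
      induction t with
      | zero => simp
      | add x x' hx hx' => simp only [TensorProduct.add_tmul, map_add, LinearMap.add_apply, hx, hx']
      | tmul e f =>
        simp only [TensorProduct.map₂_apply_tmul, TensorProduct.assoc_tmul, hH,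
          TensorProduct.lift.tmul, LinearMap.compl₂_apply, LinearMap.comp_apply,
          LinearMap.lTensor_tmul]
        generalize adjointCoaction k A y = z
        induction z with
        | zero => simp
        | add x x' hx hx' => simp only [map_add, hx, hx']
        | tmul x y => simp [mulSnd]
    have h3 : H ∘ₗ Coalgebra.comul.lTensor A =
        (TensorProduct.lift (B.left.compl₂ (B.maurerCartan D))).rTensor A ∘ₗ
          (TensorProduct.assoc k A A A).symm.toLinearMap ∘ₗ Coalgebra.comul.lTensor A := by
      ext x y
      simp only [hH, TensorProduct.AlgebraTensorModule.curry_apply, TensorProduct.curry_apply,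
        LinearMap.coe_restrictScalars, TensorProduct.lift.tmul, LinearMap.compl₂_apply,
        LinearMap.comp_apply, LinearEquiv.coe_coe, LinearMap.lTensor_tmul]
      generalize Coalgebra.comul (R := k) y = t
      induction t with
      | zero => simp
      | add x x' hx hx' => simp only [TensorProduct.tmul_add, map_add, hx, hx']
      | tmul e ω => simp
    have h4 : TensorProduct.lift ((mulSnd k A).compl₂ (adjointCoaction k A)) ∘ₗ
        Coalgebra.comul = Coalgebra.comul := LinearMap.ext lift_mulSnd_adjointCoaction
    have h5 : TensorProduct.lift (B.left.compl₂ (B.maurerCartan D)) ∘ₗ Coalgebra.comul = D :=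
      LinearMap.ext fun a => (B.eq_lift_maurerCartan D a).symm
    rw [h1, h2]
    simp only [LinearMap.comp_apply, ← eq_lift_maurerCartan, hD, LinearEquiv.coe_coe,
      Coalgebra.coassoc_apply]
    rw [← LinearMap.comp_apply (LinearMap.lTensor A _) (LinearMap.lTensor A _),
      ← LinearMap.lTensor_comp, h4, ← LinearMap.comp_apply H, h3]
    simp only [LinearMap.comp_apply, LinearEquiv.coe_coe, Coalgebra.coassoc_symm_apply]
    rw [← LinearMap.comp_apply (LinearMap.rTensor A _) (LinearMap.rTensor A _),
      ← LinearMap.rTensor_comp, h5]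
  exact congr($this a)

/-- The projection `ω ↦ ∑ S(ω₋₁) ω₀` onto the left coinvariants. -/
noncomputable def coinvProj : Ω →ₗ[k] Ω :=
  TensorProduct.lift (B.left ∘ₗ antipode k) ∘ₗ B.coactL

theorem eq_lift_coinvProj (ω : Ω) :
    TensorProduct.lift (B.left.compl₂ B.coinvProj) (B.coactL ω) = ω := by
  have := lift_antipode_cancel B.left B.left_one B.left_mul B.coactL
    B.coactL_coassoc B.coactL_counit _ _ mul'_map_id_antipode LinearMap.id ω
  simpa [coinvProj] using this

theorem coinvProj_of_coinv {ω : Ω} (h : B.coactL ω = 1 ⊗ₜ ω) : B.coinvProj ω = ω := by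
  simp [coinvProj, h, HopfAlgebra.antipode_one, B.left_one]

/-- `S` reverses products, so `S(a₁ ω₋₁) a₂ ω₀ = S(ω₋₁) S(a₁) a₂ ω₀`, and the antipode axiom
collapses `S(a₁) a₂`. -/
theorem coinvProj_left (a : A) (ω : Ω) :
    B.coinvProj (B.left a ω) = Coalgebra.counit (R := k) a • B.coinvProj ω := by
  simp only [coinvProj, LinearMap.comp_apply, coactL_left]
  have : ∀ z : A ⊗[k] Ω, TensorProduct.lift (B.left ∘ₗ antipode k)
      (TensorProduct.map₂ (LinearMap.mul k A) B.left (Coalgebra.comul (R := k) a) z) =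
      Coalgebra.counit (R := k) a • TensorProduct.lift (B.left ∘ₗ antipode k) z := by
    intro z
    induction z with
    | zero => simp
    | add x y hx hy => simp only [map_add, hx, hy, smul_add]
    | tmul x ω =>
      have : ∀ t : A ⊗[k] A, TensorProduct.lift (B.left ∘ₗ antipode k)
          (TensorProduct.map₂ (LinearMap.mul k A) B.left t (x ⊗ₜ ω)) =
          B.left (antipode k x) (B.left (LinearMap.mul' k A
            (TensorProduct.map (antipode k) LinearMap.id t)) ω) := by
        intro t
        induction t with
        | zero => simp
        | add y z hy hz => simp only [map_add, LinearMap.add_apply, hy, hz]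
        | tmul y z => simp [antipode_mul_antidistrib, B.left_mul]
      rw [this, mul'_map_antipode_id]
      simp [Algebra.algebraMap_eq_smul_one, B.left_one]
  exact this _

theorem coinvProj_apply (D : A →ₗ[k] Ω)
    (hD : ∀ a, B.coactL (D a) = D.lTensor A (Coalgebra.comul (R := k) a)) (a : A) :
    B.coinvProj (D a) = B.maurerCartan D a := by
  have : TensorProduct.lift (B.left ∘ₗ antipode k) ∘ₗ D.lTensor A =
      TensorProduct.lift ((B.left ∘ₗ HopfAlgebra.antipode k).compl₂ D) := by
    ext; simp
  simp only [coinvProj, LinearMap.comp_apply, hD, maurerCartan]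
  rw [← LinearMap.comp_apply, this]

/-- In `S(b₁) S(a₁) D(a₂ b₂)` the first summand of `hD` yields the adjoint action, and the second
leaves `S(a₁) a₂ = ε(a)`. Keeping `E` apart from `D` covers both the Leibniz rule (`E = d`) and
right multiplication of a fixed element (`E = 0`). -/
theorem maurerCartan_mul {D E : A →ₗ[k] Ω}
    (hD : ∀ x b, D (x * b) = B.right b (D x) + B.left x (E b)) (a b : A) :
    B.maurerCartan D (a * b) = B.adjoint (B.maurerCartan D a) b +
      Coalgebra.counit (R := k) a • B.maurerCartan E b := by
  have key : ∀ s t : A ⊗[k] A, TensorProduct.lift ((B.left ∘ₗ antipode k).compl₂ D) (s * t) =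
      TensorProduct.lift ((B.left ∘ₗ antipode k).compl₂ (B.right.flip
        (TensorProduct.lift ((B.left ∘ₗ antipode k).compl₂ D) s))) t +
      TensorProduct.lift ((B.left ∘ₗ antipode k).compl₂ (B.left (LinearMap.mul' k A
        (TensorProduct.map (antipode k) LinearMap.id s)) ∘ₗ E)) t := by
    intro s t
    induction t with
    | zero => simp
    | add x y hx hy => simp only [mul_add, map_add, hx, hy]; abel
    | tmul x y =>
      induction s with
      | zero => simp
      | add z w hz hw =>
        simp only [add_mul, map_add, hz, hw]
        simp only [TensorProduct.lift.tmul, LinearMap.compl₂_apply, map_add, LinearMap.comp_apply,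
          LinearMap.add_apply, LinearMap.flip_apply]
        abel
      | tmul z w =>
        simp [hD, antipode_mul_antidistrib, B.left_mul, B.left_right]
  simp only [maurerCartan, adjoint, LinearMap.comp_apply, Bialgebra.comul_mul, key,
    mul'_map_antipode_id]
  congr 1
  simp only [Algebra.algebraMap_eq_smul_one, map_smul, ← LinearMap.smul_apply]
  congr 1
  ext
  simp [B.left_one]

theorem coactL_coinv_left {ω : Ω} (h : B.coactL ω = 1 ⊗ₜ ω) (a : A) :
    B.coactL (B.left a ω) =
      (B.left.flip ω).lTensor A (Coalgebra.comul (R := k) a) := by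
  rw [coactL_left, h]
  generalize Coalgebra.comul (R := k) a = t
  induction t with
  | zero => simp
  | add x y hx hy => simp only [map_add, LinearMap.add_apply, hx, hy]
  | tmul x y => simp

end HopfBimodule

/-! ### Bicovariant calculi in terms of the Maurer-Cartan map -/

namespace BicovariantCalculus

variable {k A Ω : Type*} [Field k] [Ring A] [HopfAlgebra k A] [AddCommGroup Ω] [Module k Ω]
  (Γ : BicovariantCalculus k A Ω)

/-- The Hopf bimodule of 1-forms of a bicovariant calculus. -/
def toHopfBimodule : HopfBimodule k A Ω where
  __ := Γ

theorem coinvProj_left_d (a b : A) : Γ.toHopfBimodule.coinvProj (Γ.left a (Γ.d b)) =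
    Coalgebra.counit (R := k) a • Γ.maurerCartan b :=
  (Γ.toHopfBimodule.coinvProj_left a _).trans
    (congrArg _ (Γ.toHopfBimodule.coinvProj_apply Γ.d Γ.coactL_d b))

theorem coactL_maurerCartan (a : A) : Γ.coactL (Γ.maurerCartan a) = 1 ⊗ₜ Γ.maurerCartan a :=
  Γ.toHopfBimodule.coactL_maurerCartan Γ.d Γ.coactL_d a

theorem maurerCartan_mem (a : A) : Γ.maurerCartan a ∈ Γ.leftInvariant :=
  Γ.coactL_maurerCartan a

theorem induction_on {p : Ω → Prop} (ω : Ω) (h : ∀ a b, p (Γ.left a (Γ.d b)))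
    (hadd : ∀ x y, p x → p y → p (x + y)) : p ω := by
  obtain ⟨t, rfl⟩ := Γ.surjective ω
  induction t with
  | zero => simpa using h 0 0
  | add x y hx hy => rw [map_add]; exact hadd _ _ hx hy
  | tmul a b => simpa using h a b

theorem d_one : Γ.d 1 = 0 := by
  have := Γ.leibniz 1 1
  simpa [Γ.left_one, Γ.right_one] using this

theorem maurerCartan_one : Γ.maurerCartan 1 = 0 := by
  simp [maurerCartan, Algebra.TensorProduct.one_def, Γ.d_one]

theorem coinvProj_mem (ω : Ω) : Γ.toHopfBimodule.coinvProj ω ∈ Γ.leftInvariant := by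
  induction ω using Γ.induction_on with
  | h a b => rw [coinvProj_left_d]; exact Submodule.smul_mem _ _ (Γ.maurerCartan_mem b)
  | hadd x y hx hy => rw [map_add]; exact add_mem hx hy

/-- A left-invariant form is fixed by the coinvariant projection, which sends `a d b` to `ε(a)
π(b)`. Since `π(1) = 0`, a scalar may be subtracted to land in `A⁺`. -/
theorem exists_maurerCartan_eq (ω : Γ.leftInvariant) :
    ∃ x, Coalgebra.counit (R := k) x = 0 ∧ Γ.maurerCartan x = ω := by
  have h : ∀ ω, ∃ x, Γ.maurerCartan x = Γ.toHopfBimodule.coinvProj ω := by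
    intro ω
    induction ω using Γ.induction_on with
    | h a b => exact ⟨Coalgebra.counit (R := k) a • b, by rw [coinvProj_left_d, map_smul]⟩
    | hadd x y hx hy =>
      obtain ⟨a, ha⟩ := hx
      obtain ⟨b, hb⟩ := hy
      exact ⟨a + b, by rw [map_add, map_add, ha, hb]⟩
  obtain ⟨x, hx⟩ := h ω
  refine ⟨x - algebraMap k A (Coalgebra.counit x), by simp, ?_⟩
  rw [map_sub, hx, Γ.toHopfBimodule.coinvProj_of_coinv ω.2, Algebra.algebraMap_eq_smul_one,
    map_smul, maurerCartan_one, smul_zero, sub_zero]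

theorem d_eq_lift (a : A) : Γ.d a =
    TensorProduct.lift (Γ.left.compl₂ Γ.maurerCartan) (Coalgebra.comul (R := k) a) :=
  Γ.toHopfBimodule.eq_lift_maurerCartan Γ.d a

/-- This is the fundamental theorem of Hopf modules. With `P` the projection onto coinvariants, `ω ↦
∑ ω₋₁ ⊗ P(ω₀)` is a left inverse; surjectivity is read off from `a d b = ∑ a b₁ π(b₂)`. -/
theorem leftFree_bijective : Function.Bijective Γ.leftFree := by
  constructor
  · let R : Ω →ₗ[k] A ⊗[k] Γ.leftInvariant :=
      (Γ.toHopfBimodule.coinvProj.codRestrict Γ.leftInvariant Γ.coinvProj_mem).lTensor A ∘ₗ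
        Γ.coactL
    have h : R ∘ₗ Γ.leftFree = LinearMap.id := by
      ext a ω
      have h1 := Γ.toHopfBimodule.coactL_coinv_left (ω := ω) ω.2 a
      change R (Γ.left a ω) = a ⊗ₜ ω
      change (LinearMap.lTensor A _) (Γ.toHopfBimodule.coactL (Γ.toHopfBimodule.left a ω)) = _
      rw [h1, ← LinearMap.comp_apply (LinearMap.lTensor A _) (LinearMap.lTensor A _),
        ← LinearMap.lTensor_comp]
      have h2 : (Γ.toHopfBimodule.coinvProj.codRestrict Γ.leftInvariant Γ.coinvProj_mem) ∘ₗ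
          Γ.toHopfBimodule.left.flip ω = LinearMap.toSpanSingleton k _ ω ∘ₗ
            Coalgebra.counit (R := k) := by
        ext b
        have h3 := Γ.toHopfBimodule.coinvProj_left b (ω : Ω)
        rw [Γ.toHopfBimodule.coinvProj_of_coinv ω.2] at h3
        simpa using h3
      rw [h2, LinearMap.lTensor_comp, LinearMap.comp_apply, Coalgebra.lTensor_counit_comul]
      simp
    exact Function.LeftInverse.injective (g := R) fun x => congr($h x)
  · rw [← LinearMap.range_eq_top, eq_top_iff]
    rintro ω -
    induction ω using Γ.induction_on with
    | hadd x y hx hy => exact add_mem hx hy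
    | h a b =>
      rw [d_eq_lift]
      generalize Coalgebra.comul (R := k) b = t
      induction t with
      | zero => simp
      | add x y hx hy => rw [map_add, map_add]; exact add_mem hx hy
      | tmul x y =>
        exact ⟨(a * x) ⊗ₜ ⟨Γ.maurerCartan y, Γ.maurerCartan_mem y⟩, by simp [leftFree, Γ.left_mul]⟩

theorem maurerCartan_mul (a b : A) : Γ.maurerCartan (a * b) =
    Γ.toHopfBimodule.adjoint (Γ.maurerCartan a) b +
      Coalgebra.counit (R := k) a • Γ.maurerCartan b :=
  Γ.toHopfBimodule.maurerCartan_mul (D := Γ.d) (E := Γ.d)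
    (fun x b => by rw [Γ.leibniz, add_comm]; rfl) a b

theorem coactR_maurerCartan (a : A) : Γ.coactR (Γ.maurerCartan a) =
    Γ.maurerCartan.rTensor A (HopfAlgebra.adjointCoaction k A a) :=
  Γ.toHopfBimodule.coactR_maurerCartan Γ.d Γ.coactR_d a

end BicovariantCalculus

/-! ### Quotients of Hopf bimodules -/

namespace HopfBimodule

open HopfAlgebra

variable {k A Ω : Type*} [Field k] [Ring A] [HopfAlgebra k A] [AddCommGroup Ω] [Module k Ω]
  (B : HopfBimodule k A Ω)

/-- The quotient of a Hopf bimodule by a sub-bimodule which is a sub-bicomodule. -/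
def quotient (N : Submodule k Ω) (hl : ∀ a, N ≤ N.comap (B.left a))
    (hr : ∀ a, N ≤ N.comap (B.right a)) (hL : N ≤ LinearMap.ker (N.mkQ.lTensor A ∘ₗ B.coactL))
    (hR : N ≤ LinearMap.ker (N.mkQ.rTensor A ∘ₗ B.coactR)) : HopfBimodule k A (Ω ⧸ N) where
  left :=
    { toFun a := N.mapQ N (B.left a) (hl a)
      map_add' a b := by ext; simp
      map_smul' a b := by ext; simp }
  right :=
    { toFun a := N.mapQ N (B.right a) (hr a)
      map_add' a b := by ext; simp
      map_smul' a b := by ext; simp }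
  left_one ω := by
    obtain ⟨ω, rfl⟩ := N.mkQ_surjective ω
    simp [B.left_one]
  left_mul a b ω := by
    obtain ⟨ω, rfl⟩ := N.mkQ_surjective ω
    simp [B.left_mul]
  right_one ω := by
    obtain ⟨ω, rfl⟩ := N.mkQ_surjective ω
    simp [B.right_one]
  right_mul a b ω := by
    obtain ⟨ω, rfl⟩ := N.mkQ_surjective ω
    simp [B.right_mul]
  left_right a b ω := by
    obtain ⟨ω, rfl⟩ := N.mkQ_surjective ω
    simp [B.left_right]
  coactL := N.liftQ (N.mkQ.lTensor A ∘ₗ B.coactL) hL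
  coactR := N.liftQ (N.mkQ.rTensor A ∘ₗ B.coactR) hR
  coactL_coassoc ω := by
    obtain ⟨ω, rfl⟩ := N.mkQ_surjective ω
    have h1 : (TensorProduct.assoc k A A (Ω ⧸ N)).toLinearMap ∘ₗ
        Coalgebra.comul.rTensor (Ω ⧸ N) ∘ₗ N.mkQ.lTensor A =
        (N.mkQ.lTensor A).lTensor A ∘ₗ (TensorProduct.assoc k A A Ω).toLinearMap ∘ₗ
          Coalgebra.comul.rTensor Ω := by
      ext x y
      simp only [TensorProduct.AlgebraTensorModule.curry_apply, TensorProduct.curry_apply,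
        LinearMap.coe_restrictScalars, LinearMap.comp_apply, LinearEquiv.coe_coe,
        LinearMap.lTensor_tmul, LinearMap.rTensor_tmul]
      generalize Coalgebra.comul (R := k) x = t
      induction t with
      | zero => simp
      | add x y hx hy => simp only [map_add, TensorProduct.add_tmul, hx, hy]
      | tmul x y => simp
    have h2 : (N.liftQ (N.mkQ.lTensor A ∘ₗ B.coactL) hL).lTensor A ∘ₗ N.mkQ.lTensor A =
        (N.mkQ.lTensor A).lTensor A ∘ₗ B.coactL.lTensor A := by
      ext x y; simp
    have h3 := congr($h1 (B.coactL ω))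
    have h4 := congr($h2 (B.coactL ω))
    simp only [LinearMap.comp_apply, LinearEquiv.coe_coe, B.coactL_coassoc] at h3 h4
    simp [h3, h4]
  coactL_counit ω := by
    obtain ⟨ω, rfl⟩ := N.mkQ_surjective ω
    have h1 : (TensorProduct.lid k (Ω ⧸ N)).toLinearMap ∘ₗ
        Coalgebra.counit.rTensor (Ω ⧸ N) ∘ₗ N.mkQ.lTensor A =
        N.mkQ ∘ₗ (TensorProduct.lid k Ω).toLinearMap ∘ₗ
          (Coalgebra.counit (R := k) (A := A)).rTensor Ω := by
      ext x y; simp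
    have h3 := congr($h1 (B.coactL ω))
    simp only [LinearMap.comp_apply, LinearEquiv.coe_coe, B.coactL_counit] at h3
    simpa using h3
  coactR_coassoc ω := by
    obtain ⟨ω, rfl⟩ := N.mkQ_surjective ω
    have h1 : Coalgebra.comul.lTensor (Ω ⧸ N) ∘ₗ N.mkQ.rTensor A =
        N.mkQ.rTensor (A ⊗[k] A) ∘ₗ (Coalgebra.comul (R := k) (A := A)).lTensor Ω := by
      ext x y; simp
    have h2 : (TensorProduct.assoc k (Ω ⧸ N) A A).toLinearMap ∘ₗ
        (N.liftQ (N.mkQ.rTensor A ∘ₗ B.coactR) hR).rTensor A ∘ₗ N.mkQ.rTensor A =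
        N.mkQ.rTensor (A ⊗[k] A) ∘ₗ (TensorProduct.assoc k Ω A A).toLinearMap ∘ₗ
          B.coactR.rTensor A := by
      ext x y
      simp only [TensorProduct.AlgebraTensorModule.curry_apply, TensorProduct.curry_apply,
        LinearMap.coe_restrictScalars, LinearMap.comp_apply, LinearEquiv.coe_coe,
        LinearMap.rTensor_tmul, Submodule.mkQ_apply, Submodule.liftQ_apply]
      generalize B.coactR x = t
      induction t with
      | zero => simp
      | add x y hx hy => simp only [map_add, TensorProduct.add_tmul, hx, hy]
      | tmul x y => simp
    have h3 := congr($h1 (B.coactR ω))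
    have h4 := congr($h2 (B.coactR ω))
    simp only [LinearMap.comp_apply, LinearEquiv.coe_coe, B.coactR_coassoc] at h3 h4
    simp [h3, h4]
  coactR_counit ω := by
    obtain ⟨ω, rfl⟩ := N.mkQ_surjective ω
    have h1 : (TensorProduct.rid k (Ω ⧸ N)).toLinearMap ∘ₗ
        Coalgebra.counit.lTensor (Ω ⧸ N) ∘ₗ N.mkQ.rTensor A =
        N.mkQ ∘ₗ (TensorProduct.rid k Ω).toLinearMap ∘ₗ
          (Coalgebra.counit (R := k) (A := A)).lTensor Ω := by
      ext x y; simp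
    have h3 := congr($h1 (B.coactR ω))
    simp only [LinearMap.comp_apply, LinearEquiv.coe_coe, B.coactR_counit] at h3
    simpa using h3
  coact_comm ω := by
    obtain ⟨ω, rfl⟩ := N.mkQ_surjective ω
    have h1 : (TensorProduct.assoc k A (Ω ⧸ N) A).toLinearMap ∘ₗ
        (N.liftQ (N.mkQ.lTensor A ∘ₗ B.coactL) hL).rTensor A ∘ₗ N.mkQ.rTensor A =
        (N.mkQ.rTensor A).lTensor A ∘ₗ (TensorProduct.assoc k A Ω A).toLinearMap ∘ₗ
          B.coactL.rTensor A := by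
      ext x y
      simp only [TensorProduct.AlgebraTensorModule.curry_apply, TensorProduct.curry_apply,
        LinearMap.coe_restrictScalars, LinearMap.comp_apply, LinearEquiv.coe_coe,
        LinearMap.rTensor_tmul, Submodule.mkQ_apply, Submodule.liftQ_apply]
      generalize B.coactL x = t
      induction t with
      | zero => simp
      | add x y hx hy => simp only [map_add, TensorProduct.add_tmul, hx, hy]
      | tmul x y => simp
    have h2 : (N.liftQ (N.mkQ.rTensor A ∘ₗ B.coactR) hR).lTensor A ∘ₗ N.mkQ.lTensor A =
        (N.mkQ.rTensor A).lTensor A ∘ₗ B.coactR.lTensor A := by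
      ext x y; simp
    have h3 := congr($h1 (B.coactR ω))
    have h4 := congr($h2 (B.coactL ω))
    simp only [LinearMap.comp_apply, LinearEquiv.coe_coe, B.coact_comm] at h3 h4
    simp [h3, h4]
  coactL_left a ω := by
    obtain ⟨ω, rfl⟩ := N.mkQ_surjective ω
    simp only [LinearMap.coe_mk, AddHom.coe_mk, Submodule.mkQ_apply, Submodule.mapQ_apply,
      Submodule.liftQ_apply, LinearMap.comp_apply, B.coactL_left]
    generalize B.coactL ω = z
    generalize Coalgebra.comul (R := k) a = t
    induction t with
    | zero => simp
    | add x y hx hy => simp only [map_add, LinearMap.add_apply, hx, hy]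
    | tmul x y =>
      induction z with
      | zero => simp
      | add x y hx hy => simp only [map_add, hx, hy]
      | tmul z w => simp
  coactL_right a ω := by
    obtain ⟨ω, rfl⟩ := N.mkQ_surjective ω
    simp only [LinearMap.coe_mk, AddHom.coe_mk, Submodule.mkQ_apply, Submodule.mapQ_apply,
      Submodule.liftQ_apply, LinearMap.comp_apply, B.coactL_right]
    generalize B.coactL ω = z
    generalize Coalgebra.comul (R := k) a = t
    induction t with
    | zero => simp
    | add x y hx hy => simp only [map_add, LinearMap.add_apply, hx, hy]
    | tmul x y =>
      induction z with
      | zero => simp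
      | add x y hx hy => simp only [map_add, hx, hy]
      | tmul z w => simp
  coactR_left a ω := by
    obtain ⟨ω, rfl⟩ := N.mkQ_surjective ω
    simp only [LinearMap.coe_mk, AddHom.coe_mk, Submodule.mkQ_apply, Submodule.mapQ_apply,
      Submodule.liftQ_apply, LinearMap.comp_apply, B.coactR_left]
    generalize B.coactR ω = z
    generalize Coalgebra.comul (R := k) a = t
    induction t with
    | zero => simp
    | add x y hx hy => simp only [map_add, LinearMap.add_apply, hx, hy]
    | tmul x y =>
      induction z with
      | zero => simp
      | add x y hx hy => simp only [map_add, hx, hy]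
      | tmul z w => simp
  coactR_right a ω := by
    obtain ⟨ω, rfl⟩ := N.mkQ_surjective ω
    simp only [LinearMap.coe_mk, AddHom.coe_mk, Submodule.mkQ_apply, Submodule.mapQ_apply,
      Submodule.liftQ_apply, LinearMap.comp_apply, B.coactR_right]
    generalize B.coactR ω = z
    generalize Coalgebra.comul (R := k) a = t
    induction t with
    | zero => simp
    | add x y hx hy => simp only [map_add, LinearMap.add_apply, hx, hy]
    | tmul x y =>
      induction z with
      | zero => simp
      | add x y hx hy => simp only [map_add, hx, hy]
      | tmul z w => simp

/-! ### Bicomodules from coalgebra maps, and the Hopf bimodule `A ⊗ A` -/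

section CoalgHom

variable {C D : Type*} [AddCommGroup C] [Module k C] [Coalgebra k C] [AddCommGroup D] [Module k D]
  [Coalgebra k D] (φ : C →ₗc[k] D)

/-- A coalgebra map `φ : C → D` makes `C` a `D`-bicomodule by applying `φ` to one leg of the
coproduct. This and the next four lemmas serve the multiplication `A ⊗ A → A`, a coalgebra map
because `A` is a bialgebra. -/
theorem rTensor_comul_coassoc (x : C) : TensorProduct.assoc k D D C
    ((Coalgebra.comul (R := k) (A := D)).rTensor C
      (((φ : C →ₗ[k] D).rTensor C ∘ₗ Coalgebra.comul) x)) =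
      ((φ : C →ₗ[k] D).rTensor C ∘ₗ Coalgebra.comul).lTensor D
      (((φ : C →ₗ[k] D).rTensor C ∘ₗ Coalgebra.comul) x) := by
  have h1 : (TensorProduct.assoc k D D C).toLinearMap ∘ₗ Coalgebra.comul.rTensor C ∘ₗ
      (φ : C →ₗ[k] D).rTensor C =
      TensorProduct.map (φ : C →ₗ[k] D) ((φ : C →ₗ[k] D).rTensor C) ∘ₗ
      (TensorProduct.assoc k C C C).toLinearMap ∘ₗ Coalgebra.comul.rTensor C := by
    ext x y
    have := CoalgHomClass.map_comp_comul_apply φ x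
    simp only [TensorProduct.AlgebraTensorModule.curry_apply, TensorProduct.curry_apply,
      LinearMap.coe_restrictScalars, LinearMap.comp_apply, LinearEquiv.coe_coe,
      LinearMap.rTensor_tmul, CoalgHom.coe_toLinearMap, ← this]
    generalize Coalgebra.comul (R := k) x = t
    induction t with
    | zero => simp
    | add x y hx hy => simp only [map_add, TensorProduct.add_tmul, hx, hy]
    | tmul x y => simp
  have h2 := congr($h1 (Coalgebra.comul (R := k) x))
  simp only [LinearMap.comp_apply, LinearEquiv.coe_coe, Coalgebra.coassoc_apply] at h2
  rw [LinearMap.comp_apply, h2]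
  have h3 : ((φ : C →ₗ[k] D).rTensor C ∘ₗ Coalgebra.comul).lTensor D ∘ₗ
      (φ : C →ₗ[k] D).rTensor C = TensorProduct.map (φ : C →ₗ[k] D) ((φ : C →ₗ[k] D).rTensor C) ∘ₗ
      Coalgebra.comul.lTensor C := by
    ext x y; simp
  exact congr($h3 (Coalgebra.comul (R := k) x)).symm

theorem lTensor_comul_coassoc (x : C) : TensorProduct.assoc k C D D
      (((φ : C →ₗ[k] D).lTensor C ∘ₗ Coalgebra.comul).rTensor D
      (((φ : C →ₗ[k] D).lTensor C ∘ₗ Coalgebra.comul) x)) =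
    ((Coalgebra.comul (R := k) (A := D)).lTensor C
      (((φ : C →ₗ[k] D).lTensor C ∘ₗ Coalgebra.comul) x)) := by
  have h1 : Coalgebra.comul.lTensor C ∘ₗ (φ : C →ₗ[k] D).lTensor C =
      (TensorProduct.map (φ : C →ₗ[k] D) (φ : C →ₗ[k] D)).lTensor C ∘ₗ
      Coalgebra.comul.lTensor C := by
    ext x y
    have := CoalgHomClass.map_comp_comul_apply φ y
    simp only [TensorProduct.AlgebraTensorModule.curry_apply, TensorProduct.curry_apply,
      LinearMap.coe_restrictScalars, LinearMap.comp_apply,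
      LinearMap.lTensor_tmul, CoalgHom.coe_toLinearMap, ← this]
  have h3 : (TensorProduct.assoc k C D D).toLinearMap ∘ₗ
      ((φ : C →ₗ[k] D).lTensor C ∘ₗ Coalgebra.comul).rTensor D ∘ₗ
      (φ : C →ₗ[k] D).lTensor C = (TensorProduct.map (φ : C →ₗ[k] D) (φ : C →ₗ[k] D)).lTensor C ∘ₗ
      (TensorProduct.assoc k C C C).toLinearMap ∘ₗ Coalgebra.comul.rTensor C := by
    ext x y
    simp only [TensorProduct.AlgebraTensorModule.curry_apply, TensorProduct.curry_apply,
      LinearMap.coe_restrictScalars, LinearMap.comp_apply, LinearEquiv.coe_coe,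
      LinearMap.rTensor_tmul, LinearMap.lTensor_tmul, CoalgHom.coe_toLinearMap]
    generalize Coalgebra.comul (R := k) x = t
    induction t with
    | zero => simp
    | add x y hx hy => simp only [map_add, TensorProduct.add_tmul, hx, hy]
    | tmul x y => simp
  have h2 := congr($h1 (Coalgebra.comul (R := k) x))
  have h4 := congr($h3 (Coalgebra.comul (R := k) x))
  simp only [LinearMap.comp_apply, LinearEquiv.coe_coe, Coalgebra.coassoc_apply] at h2 h4
  rw [LinearMap.comp_apply, h2, h4]

theorem rTensor_lTensor_comul_comm (x : C) : TensorProduct.assoc k D C D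
      (((φ : C →ₗ[k] D).rTensor C ∘ₗ Coalgebra.comul).rTensor D
      (((φ : C →ₗ[k] D).lTensor C ∘ₗ Coalgebra.comul) x)) =
    (((φ : C →ₗ[k] D).lTensor C ∘ₗ Coalgebra.comul).lTensor D
      (((φ : C →ₗ[k] D).rTensor C ∘ₗ Coalgebra.comul) x)) := by
  have h1 : ((φ : C →ₗ[k] D).lTensor C ∘ₗ Coalgebra.comul).lTensor D ∘ₗ
      (φ : C →ₗ[k] D).rTensor C =
      TensorProduct.map (φ : C →ₗ[k] D) ((φ : C →ₗ[k] D).lTensor C) ∘ₗ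
      Coalgebra.comul.lTensor C := by
    ext x y; simp
  have h3 : (TensorProduct.assoc k D C D).toLinearMap ∘ₗ
      ((φ : C →ₗ[k] D).rTensor C ∘ₗ Coalgebra.comul).rTensor D ∘ₗ
      (φ : C →ₗ[k] D).lTensor C =
      TensorProduct.map (φ : C →ₗ[k] D) ((φ : C →ₗ[k] D).lTensor C) ∘ₗ
      (TensorProduct.assoc k C C C).toLinearMap ∘ₗ Coalgebra.comul.rTensor C := by
    ext x y
    simp only [TensorProduct.AlgebraTensorModule.curry_apply, TensorProduct.curry_apply,
      LinearMap.coe_restrictScalars, LinearMap.comp_apply, LinearEquiv.coe_coe,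
      LinearMap.rTensor_tmul, LinearMap.lTensor_tmul, CoalgHom.coe_toLinearMap]
    generalize Coalgebra.comul (R := k) x = t
    induction t with
    | zero => simp
    | add x y hx hy => simp only [map_add, TensorProduct.add_tmul, hx, hy]
    | tmul x y => simp
  have h2 := congr($h1 (Coalgebra.comul (R := k) x))
  have h4 := congr($h3 (Coalgebra.comul (R := k) x))
  simp only [LinearMap.comp_apply, LinearEquiv.coe_coe, Coalgebra.coassoc_apply] at h2 h4
  simp only [LinearMap.comp_apply] at h2 h4 ⊢
  rw [h2, h4]

theorem rTensor_comul_counit (x : C) : TensorProduct.lid k C ((Coalgebra.counit (R := k)).rTensor C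
    (((φ : C →ₗ[k] D).rTensor C ∘ₗ Coalgebra.comul) x)) = x := by
  have h : (Coalgebra.counit (R := k) (A := D)) ∘ₗ (φ : C →ₗ[k] D) = Coalgebra.counit :=
    φ.counit_comp
  rw [LinearMap.comp_apply, ← LinearMap.comp_apply (LinearMap.rTensor C _) (LinearMap.rTensor C _),
    ← LinearMap.rTensor_comp, h]
  simp

theorem lTensor_comul_counit (x : C) : TensorProduct.rid k C ((Coalgebra.counit (R := k)).lTensor C
    (((φ : C →ₗ[k] D).lTensor C ∘ₗ Coalgebra.comul) x)) = x := by
  have h : (Coalgebra.counit (R := k) (A := D)) ∘ₗ (φ : C →ₗ[k] D) = Coalgebra.counit :=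
    φ.counit_comp
  rw [LinearMap.comp_apply, ← LinearMap.comp_apply (LinearMap.lTensor C _) (LinearMap.lTensor C _),
    ← LinearMap.lTensor_comp, h]
  simp

end CoalgHom

variable (k A) in
/-- The Hopf bimodule `A ⊗ A` with the outer bimodule structure and the diagonal coactions. -/
noncomputable def tensorSquare : HopfBimodule k A (A ⊗[k] A) where
  left := LinearMap.mul k (A ⊗[k] A) ∘ₗ
    (Algebra.TensorProduct.includeLeft : A →ₐ[k] A ⊗[k] A).toLinearMap
  right := (LinearMap.mul k (A ⊗[k] A)).flip ∘ₗ
    (Algebra.TensorProduct.includeRight : A →ₐ[k] A ⊗[k] A).toLinearMap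
  left_one ω := by simp [← Algebra.TensorProduct.one_def]
  left_mul a b ω := by simp [← mul_assoc]
  right_one ω := by simp [← Algebra.TensorProduct.one_def]
  right_mul a b ω := by simp [mul_assoc]
  left_right a b ω := by simp [mul_assoc]
  coactL := (LinearMap.mul' k A).rTensor (A ⊗[k] A) ∘ₗ Coalgebra.comul
  coactR := (LinearMap.mul' k A).lTensor (A ⊗[k] A) ∘ₗ Coalgebra.comul
  coactL_coassoc := rTensor_comul_coassoc (Bialgebra.mulCoalgHom k A)
  coactL_counit := rTensor_comul_counit (Bialgebra.mulCoalgHom k A)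
  coactR_coassoc := lTensor_comul_coassoc (Bialgebra.mulCoalgHom k A)
  coactR_counit := lTensor_comul_counit (Bialgebra.mulCoalgHom k A)
  coact_comm := rTensor_lTensor_comul_comm (Bialgebra.mulCoalgHom k A)
  coactL_left a ω := by
    simp only [LinearMap.comp_apply]
    -- The left action is multiplication by `a ⊗ 1` in the bialgebra `A ⊗ A`, so multiplicativity of
    -- its coproduct applies.
    change (LinearMap.mul' k A).rTensor (A ⊗[k] A) (Coalgebra.comul (R := k) ((a ⊗ₜ[k] (1 : A)) * ω)) = _
    rw [Bialgebra.comul_mul, TensorProduct.comul_tmul, Bialgebra.comul_one,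
      Algebra.TensorProduct.one_def]
    generalize Coalgebra.comul (R := k) ω = z
    generalize Coalgebra.comul (R := k) a = t
    induction t with
    | zero => simp
    | add x y hx hy =>
      simp only [map_add, LinearMap.add_apply, TensorProduct.add_tmul,
        add_mul, hx, hy]
    | tmul x y =>
      induction z with
      | zero => simp
      | add x y hx hy => simp only [map_add, mul_add, hx, hy]
      | tmul p q =>
        simp only [TensorProduct.AlgebraTensorModule.tensorTensorTensorComm_tmul,
          Algebra.TensorProduct.tmul_mul_tmul, LinearMap.rTensor_tmul,
          TensorProduct.map₂_apply_tmul]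
        congr 1
        induction p with
        | zero => simp
        | add x y hx hy => simp only [map_add, mul_add, hx, hy]
        | tmul p q => simp [mul_assoc]
  coactL_right a ω := by
    simp only [LinearMap.comp_apply]
    change (LinearMap.mul' k A).rTensor (A ⊗[k] A) (Coalgebra.comul (R := k) (ω * ((1 : A) ⊗ₜ[k] a))) = _
    rw [Bialgebra.comul_mul, TensorProduct.comul_tmul, Bialgebra.comul_one,
      Algebra.TensorProduct.one_def]
    generalize Coalgebra.comul (R := k) ω = z
    generalize Coalgebra.comul (R := k) a = t
    induction t with
    | zero => simp
    | add x y hx hy =>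
      simp only [map_add, LinearMap.add_apply, TensorProduct.tmul_add,
        mul_add, hx, hy]
    | tmul x y =>
      induction z with
      | zero => simp
      | add x y hx hy => simp only [map_add, add_mul, hx, hy]
      | tmul p q =>
        simp only [TensorProduct.AlgebraTensorModule.tensorTensorTensorComm_tmul,
          Algebra.TensorProduct.tmul_mul_tmul, LinearMap.rTensor_tmul,
          TensorProduct.map₂_apply_tmul]
        congr 1
        induction p with
        | zero => simp
        | add x y hx hy => simp only [map_add, add_mul, hx, hy]
        | tmul p q => simp [mul_assoc]
  coactR_left a ω := by
    simp only [LinearMap.comp_apply]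
    change (LinearMap.mul' k A).lTensor (A ⊗[k] A) (Coalgebra.comul (R := k) ((a ⊗ₜ[k] (1 : A)) * ω)) = _
    rw [Bialgebra.comul_mul, TensorProduct.comul_tmul, Bialgebra.comul_one,
      Algebra.TensorProduct.one_def]
    generalize Coalgebra.comul (R := k) ω = z
    generalize Coalgebra.comul (R := k) a = t
    induction t with
    | zero => simp
    | add x y hx hy =>
      simp only [map_add, LinearMap.add_apply, TensorProduct.add_tmul,
        add_mul, hx, hy]
    | tmul x y =>
      induction z with
      | zero => simp
      | add x y hx hy => simp only [map_add, mul_add, hx, hy]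
      | tmul p q =>
        simp only [TensorProduct.AlgebraTensorModule.tensorTensorTensorComm_tmul,
          Algebra.TensorProduct.tmul_mul_tmul, LinearMap.lTensor_tmul,
          TensorProduct.map₂_apply_tmul]
        congr 1
        induction q with
        | zero => simp
        | add x y hx hy => simp only [map_add, mul_add, hx, hy]
        | tmul p q => simp [mul_assoc]
  coactR_right a ω := by
    simp only [LinearMap.comp_apply]
    change (LinearMap.mul' k A).lTensor (A ⊗[k] A) (Coalgebra.comul (R := k) (ω * ((1 : A) ⊗ₜ[k] a))) = _
    rw [Bialgebra.comul_mul, TensorProduct.comul_tmul, Bialgebra.comul_one,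
      Algebra.TensorProduct.one_def]
    generalize Coalgebra.comul (R := k) ω = z
    generalize Coalgebra.comul (R := k) a = t
    induction t with
    | zero => simp
    | add x y hx hy =>
      simp only [map_add, LinearMap.add_apply, TensorProduct.tmul_add,
        mul_add, hx, hy]
    | tmul x y =>
      induction z with
      | zero => simp
      | add x y hx hy => simp only [map_add, add_mul, hx, hy]
      | tmul p q =>
        simp only [TensorProduct.AlgebraTensorModule.tensorTensorTensorComm_tmul,
          Algebra.TensorProduct.tmul_mul_tmul, LinearMap.lTensor_tmul,
          TensorProduct.map₂_apply_tmul]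
        congr 1
        induction q with
        | zero => simp
        | add x y hx hy => simp only [map_add, add_mul, hx, hy]
        | tmul p q => simp [mul_assoc]

theorem tensorSquare_left (a : A) (t : A ⊗[k] A) : (tensorSquare k A).left a t = (a ⊗ₜ 1) * t := rfl

theorem tensorSquare_right (a : A) (t : A ⊗[k] A) : (tensorSquare k A).right a t = t * (1 ⊗ₜ a) :=
  rfl

theorem tensorSquare_coactL_one_tmul (a : A) : (tensorSquare k A).coactL (1 ⊗ₜ[k] a) =
    (TensorProduct.mk k A A 1).lTensor A (Coalgebra.comul (R := k) a) := by
  simp only [tensorSquare, LinearMap.comp_apply, TensorProduct.comul_tmul, Bialgebra.comul_one,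
    Algebra.TensorProduct.one_def]
  generalize Coalgebra.comul (R := k) a = t
  induction t with
  | zero => simp
  | add x y hx hy => simp only [map_add, TensorProduct.tmul_add, hx, hy]
  | tmul x y => simp

theorem tensorSquare_coactR_one_tmul (a : A) : (tensorSquare k A).coactR (1 ⊗ₜ[k] a) =
    (TensorProduct.mk k A A 1).rTensor A (Coalgebra.comul (R := k) a) := by
  simp only [tensorSquare, LinearMap.comp_apply, TensorProduct.comul_tmul, Bialgebra.comul_one,
    Algebra.TensorProduct.one_def]
  generalize Coalgebra.comul (R := k) a = t
  induction t with
  | zero => simp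
  | add x y hx hy => simp only [map_add, TensorProduct.tmul_add, hx, hy]
  | tmul x y => simp

end HopfBimodule

/-! ### Inner calculi from right ideals stable under the adjoint coaction -/

namespace HopfAlgebra

variable {k A : Type*} [Field k] [Ring A] [HopfAlgebra k A]

/-- The conditions on a subspace `K` of `A` for which `A⁺ ∩ K` is the kernel of the projection
`A⁺ → Λ¹` of a bicovariant calculus. -/
structure IsCalculusIdeal (K : Submodule k A) : Prop where
  mul_mem : ∀ y ∈ K, ∀ a, y * a ∈ K
  coaction : ∀ y ∈ K, K.mkQ.rTensor A (adjointCoaction k A y) = 0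
  exists_counit : ∃ y ∈ K, Coalgebra.counit (R := k) y = 1

end HopfAlgebra

namespace HopfBimodule

open HopfAlgebra

section Generator

variable {k A Ω : Type*} [Field k] [Ring A] [HopfAlgebra k A] [AddCommGroup Ω] [Module k Ω]
  (B : HopfBimodule k A Ω) (θ : Ω)

/-- The map `a ↦ ∑ S(a₁) θ a₂` onto the left coinvariants of the bimodule generated by `θ`. -/
noncomputable def kappa : A →ₗ[k] Ω := B.maurerCartan (B.right.flip θ)

/-- `maurerCartan_mul` with `E = 0` gives `κ(y) ◁ b = κ(y b)`. The adjoint action thus becomes right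
multiplication, which is why `K` has to be a right ideal. -/
theorem right_kappa (y a : A) : B.right a (B.kappa θ y) =
    TensorProduct.lift (B.left.compl₂ (B.kappa θ ∘ₗ LinearMap.mul k A y))
      (Coalgebra.comul (R := k) a) := by
  rw [right_eq_lift_adjoint]
  congr 3
  ext b
  have := B.maurerCartan_mul (D := B.right.flip θ) (E := 0)
    (fun x b => by simp [B.right_mul]) y b
  have h0 : B.maurerCartan (0 : A →ₗ[k] Ω) = 0 := by
    have : TensorProduct.lift ((B.left ∘ₗ antipode k).compl₂ (0 : A →ₗ[k] Ω)) = 0 := by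
      ext; simp
    rw [maurerCartan, this, LinearMap.zero_comp]
  rw [h0, LinearMap.zero_apply, smul_zero, add_zero] at this
  exact this.symm

theorem coactL_right_coinv (hL : B.coactL θ = 1 ⊗ₜ θ) (a : A) : B.coactL (B.right a θ) =
    (B.right.flip θ).lTensor A (Coalgebra.comul (R := k) a) := by
  rw [coactL_right, hL]
  generalize Coalgebra.comul (R := k) a = t
  induction t with
  | zero => simp
  | add x y hx hy => simp only [map_add, LinearMap.add_apply, hx, hy]
  | tmul x y => simp

theorem coactR_right_coinv (hR : B.coactR θ = θ ⊗ₜ 1) (a : A) : B.coactR (B.right a θ) =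
    (B.right.flip θ).rTensor A (Coalgebra.comul (R := k) a) := by
  rw [coactR_right, hR]
  generalize Coalgebra.comul (R := k) a = t
  induction t with
  | zero => simp
  | add x y hx hy => simp only [map_add, LinearMap.add_apply, hx, hy]
  | tmul x y => simp

theorem coactR_left_coinv (hR : B.coactR θ = θ ⊗ₜ 1) (a : A) : B.coactR (B.left a θ) =
    (B.left.flip θ).rTensor A (Coalgebra.comul (R := k) a) := by
  rw [coactR_left, hR]
  generalize Coalgebra.comul (R := k) a = t
  induction t with
  | zero => simp
  | add x y hx hy => simp only [map_add, LinearMap.add_apply, hx, hy]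
  | tmul x y => simp

variable (K : Submodule k A)

/-- The left submodule generated by the image of `K` under `kappa`. -/
noncomputable def spanKappa : Submodule k Ω := Submodule.map₂ B.left ⊤ (K.map (B.kappa θ))

variable {K}

theorem left_kappa_mem (b : A) {y : A} (hy : y ∈ K) :
    B.left b (B.kappa θ y) ∈ B.spanKappa θ K :=
  Submodule.apply_mem_map₂ _ trivial ⟨y, hy, rfl⟩

theorem kappa_mem {y : A} (hy : y ∈ K) : B.kappa θ y ∈ B.spanKappa θ K := by
  simpa [left_one] using B.left_kappa_mem θ 1 hy

theorem spanKappa_le {P : Submodule k Ω}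
    (h : ∀ b, ∀ y ∈ K, B.left b (B.kappa θ y) ∈ P) : B.spanKappa θ K ≤ P := by
  refine Submodule.map₂_le.2 ?_
  rintro b - _ ⟨y, hy, rfl⟩
  exact h b y hy

theorem spanKappa_le_comap_left (a : A) :
    B.spanKappa θ K ≤ (B.spanKappa θ K).comap (B.left a) :=
  B.spanKappa_le θ fun b y hy => by
    rw [Submodule.mem_comap, ← left_mul]
    exact B.left_kappa_mem _ _ hy

theorem spanKappa_le_comap_right (hK : IsCalculusIdeal K) (a : A) :
    B.spanKappa θ K ≤ (B.spanKappa θ K).comap (B.right a) :=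
  B.spanKappa_le θ fun b y hy => by
    rw [Submodule.mem_comap, left_right, right_kappa]
    generalize Coalgebra.comul (R := k) a = t
    induction t with
    | zero => simp
    | add s t hs ht => simp only [map_add]; exact add_mem hs ht
    | tmul c e =>
      simp only [TensorProduct.lift.tmul, LinearMap.compl₂_apply, LinearMap.comp_apply,
        LinearMap.mul_apply']
      rw [← left_mul]
      exact B.left_kappa_mem _ _ (hK.mul_mem _ hy _)

/-- Each `κ(y)` is left-coinvariant because `θ` is, so the coaction of `b κ(y)` is `∑ b₁ ⊗ b₂ κ(y)`.
-/
theorem spanKappa_le_ker_coactL (hL : B.coactL θ = 1 ⊗ₜ θ) : B.spanKappa θ K ≤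
    LinearMap.ker ((B.spanKappa θ K).mkQ.lTensor A ∘ₗ B.coactL) :=
  B.spanKappa_le θ fun b y hy => by
    have h : B.coactL (B.kappa θ y) = 1 ⊗ₜ B.kappa θ y :=
      B.coactL_maurerCartan _ (B.coactL_right_coinv θ hL) y
    rw [LinearMap.mem_ker, LinearMap.comp_apply, coactL_coinv_left _ h]
    generalize Coalgebra.comul (R := k) b = t
    induction t with
    | zero => simp
    | add s t hs ht => simp only [map_add, hs, ht, add_zero]
    | tmul c e =>
      have : (B.spanKappa θ K).mkQ (B.left e (B.kappa θ y)) = 0 := by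
        simpa using B.left_kappa_mem θ e hy
      rw [LinearMap.lTensor_tmul, LinearMap.lTensor_tmul, LinearMap.flip_apply]
      exact (congrArg _ this).trans (TensorProduct.tmul_zero _ _)

/-- The right coaction of `κ(y)` is `κ` applied to the first leg of the adjoint coaction of `y`, and
that leg lies in `K` by hypothesis. -/
theorem spanKappa_le_ker_coactR (hR : B.coactR θ = θ ⊗ₜ 1) (hK : IsCalculusIdeal K) :
    B.spanKappa θ K ≤ LinearMap.ker ((B.spanKappa θ K).mkQ.rTensor A ∘ₗ B.coactR) :=
  B.spanKappa_le θ fun b y hy => by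
    rw [LinearMap.mem_ker, LinearMap.comp_apply, coactR_left, kappa,
      B.coactR_maurerCartan _ (B.coactR_right_coinv θ hR) y]
    have h0 := hK.coaction y hy
    generalize adjointCoaction k A y = z at h0 ⊢
    generalize Coalgebra.comul (R := k) b = t
    induction t with
    | zero => simp
    | add s t hs ht => simp only [map_add, LinearMap.add_apply, hs, ht, add_zero]
    | tmul c e =>
      -- Modulo the span, `y ↦ c κ(y)` factors through `A / K`, so vanishing in `(A / K) ⊗ A`
      -- carries over.
      have hc : K ≤ LinearMap.ker ((B.spanKappa θ K).mkQ ∘ₗ B.left c ∘ₗ B.kappa θ) :=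
        fun y hy => by simpa using B.left_kappa_mem θ c hy
      have h1 : (B.spanKappa θ K).mkQ.rTensor A ∘ₗ
          TensorProduct.map (B.left c) (LinearMap.mul k A e) ∘ₗ (B.kappa θ).rTensor A =
          TensorProduct.map (K.liftQ _ hc) (LinearMap.mul k A e) ∘ₗ K.mkQ.rTensor A := by
        apply TensorProduct.ext'
        intro x y
        simp only [LinearMap.comp_apply, LinearMap.rTensor_tmul, TensorProduct.map_tmul,
          Submodule.mkQ_apply, Submodule.liftQ_apply]
      have h2 := congr($h1 z)
      simp only [LinearMap.comp_apply, h0, map_zero] at h2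
      exact h2

/-- The commutator `a ↦ [θ, a]`. -/
noncomputable def innerD : A →ₗ[k] Ω := B.right.flip θ - B.left.flip θ

theorem innerD_apply (a : A) : B.innerD θ a = B.right a θ - B.left a θ := rfl

theorem innerD_mul (a b : A) : B.innerD θ (a * b) =
    B.left a (B.innerD θ b) + B.right b (B.innerD θ a) := by
  simp [innerD_apply, B.left_mul, B.right_mul, B.left_right]

/-- In `S(x₁)(θ x₂ - x₂ θ)` the second term collapses by the antipode axiom. On `A⁺` the
Maurer-Cartan map of `[θ, ·]` is therefore `κ`. -/
theorem maurerCartan_innerD (x : A) : B.maurerCartan (B.innerD θ) x =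
    B.kappa θ x - Coalgebra.counit (R := k) x • θ := by
  have h : TensorProduct.lift ((B.left ∘ₗ antipode k).compl₂ (B.innerD θ)) =
      TensorProduct.lift ((B.left ∘ₗ antipode k).compl₂ (B.right.flip θ)) -
        B.left.flip θ ∘ₗ LinearMap.mul' k A ∘ₗ TensorProduct.map (antipode k) LinearMap.id := by
    apply TensorProduct.ext'
    intro x y
    simp [innerD_apply, B.left_mul]
  rw [maurerCartan, LinearMap.comp_apply, h, LinearMap.sub_apply]
  simp only [LinearMap.comp_apply, mul'_map_antipode_id]
  congr 1
  simp [Algebra.algebraMap_eq_smul_one, B.left_one]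

variable (K) in
/-- The Hopf bimodule obtained by killing the image of `K` under `kappa`. -/
noncomputable def quotientKappa (hL : B.coactL θ = 1 ⊗ₜ θ) (hR : B.coactR θ = θ ⊗ₜ 1)
    (hK : IsCalculusIdeal K) : HopfBimodule k A (Ω ⧸ B.spanKappa θ K) :=
  B.quotient (B.spanKappa θ K) (B.spanKappa_le_comap_left θ) (B.spanKappa_le_comap_right θ hK)
    (B.spanKappa_le_ker_coactL θ hL) (B.spanKappa_le_ker_coactR θ hR hK)

section Quotient

variable (hL : B.coactL θ = 1 ⊗ₜ θ) (hR : B.coactR θ = θ ⊗ₜ 1) (hK : IsCalculusIdeal K)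

theorem quotientKappa_kappa (a : A) : (B.quotientKappa θ K hL hR hK).kappa
    ((B.spanKappa θ K).mkQ θ) a = (B.spanKappa θ K).mkQ (B.kappa θ a) := by
  have : TensorProduct.lift (((B.quotientKappa θ K hL hR hK).left ∘ₗ antipode k).compl₂
      ((B.quotientKappa θ K hL hR hK).right.flip ((B.spanKappa θ K).mkQ θ))) =
      (B.spanKappa θ K).mkQ ∘ₗ TensorProduct.lift ((B.left ∘ₗ antipode k).compl₂
        (B.right.flip θ)) := by
    apply TensorProduct.ext'
    intro x y
    rfl
  exact congr($this _)

theorem quotientKappa_coactL (t : Ω) : (B.quotientKappa θ K hL hR hK).coactL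
    ((B.spanKappa θ K).mkQ t) = (B.spanKappa θ K).mkQ.lTensor A (B.coactL t) := rfl

theorem quotientKappa_coactR (t : Ω) : (B.quotientKappa θ K hL hR hK).coactR
    ((B.spanKappa θ K).mkQ t) = (B.spanKappa θ K).mkQ.rTensor A (B.coactR t) := rfl

end Quotient

/-- By the Leibniz rule the span of the `a [θ, b]` is a sub-bimodule, so it is enough that it
contains the generator `θ`. The element `y` provides this: `θ = -∑ S(y₁) [θ, y₂]`. -/
theorem innerD_surjective (hθ : ∀ R : Submodule k Ω, (∀ a b, B.left a (B.right b θ) ∈ R) → R = ⊤)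
    {y : A} (hy : B.kappa θ y = 0) (hy1 : Coalgebra.counit (R := k) y = 1) :
    Function.Surjective (TensorProduct.lift (B.left.compl₂ (B.innerD θ))) := by
  set R := LinearMap.range (TensorProduct.lift (B.left.compl₂ (B.innerD θ))) with hR
  have hmem (a b : A) : B.left a (B.innerD θ b) ∈ R := ⟨a ⊗ₜ b, by simp⟩
  have hl (a : A) : R ≤ R.comap (B.left a) := by
    rintro _ ⟨t, rfl⟩
    induction t with
    | zero => simp
    | add s t hs ht => rw [map_add]; exact add_mem hs ht
    | tmul x y =>
      simp only [Submodule.mem_comap, TensorProduct.lift.tmul, LinearMap.compl₂_apply]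
      rw [← B.left_mul]
      exact hmem _ _
  have hr (a : A) : R ≤ R.comap (B.right a) := by
    rintro _ ⟨t, rfl⟩
    induction t with
    | zero => simp
    | add s t hs ht => rw [map_add]; exact add_mem hs ht
    | tmul x y =>
      simp only [Submodule.mem_comap, TensorProduct.lift.tmul, LinearMap.compl₂_apply]
      rw [B.left_right, eq_sub_of_add_eq' (B.innerD_mul θ y a).symm, map_sub, ← B.left_mul]
      exact sub_mem (hmem _ _) (hmem _ _)
  have h1 : θ ∈ R := by
    have := B.maurerCartan_innerD θ y
    rw [hy1, one_smul, hy, zero_sub, eq_comm, neg_eq_iff_eq_neg] at this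
    rw [this]
    refine neg_mem ?_
    rw [maurerCartan, LinearMap.comp_apply]
    generalize Coalgebra.comul (R := k) y = t
    induction t with
    | zero => simp
    | add s t hs ht => rw [map_add]; exact add_mem hs ht
    | tmul x y => exact hmem _ _
  exact LinearMap.range_eq_top.1 (hθ R fun a b => hl a (hr b h1))

/-- The inner bicovariant calculus on a Hopf bimodule generated by a coinvariant element. -/
noncomputable def innerCalculus (hL : B.coactL θ = 1 ⊗ₜ θ) (hR : B.coactR θ = θ ⊗ₜ 1)
    (hs : Function.Surjective (TensorProduct.lift (B.left.compl₂ (B.innerD θ)))) :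
    BicovariantCalculus k A Ω where
  __ := B
  d := B.innerD θ
  leibniz := B.innerD_mul θ
  surjective := hs
  coactL_d a := by
    rw [innerD_apply, map_sub, B.coactL_right_coinv θ hL, B.coactL_coinv_left hL, innerD,
      LinearMap.lTensor_sub, LinearMap.sub_apply]
  coactR_d a := by
    rw [innerD_apply, map_sub, B.coactR_right_coinv θ hR, B.coactR_left_coinv θ hR, innerD,
      LinearMap.rTensor_sub, LinearMap.sub_apply]

/-- Once `κ(K)` is killed, the Maurer-Cartan map of `[θ, ·]` has kernel exactly `A⁺ ∩ K` on `A⁺`;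
the hypothesis `hmem` ensures that nothing more dies. -/
theorem exists_calculus_quotient (hK : IsCalculusIdeal K) (hL : B.coactL θ = 1 ⊗ₜ θ)
    (hR : B.coactR θ = θ ⊗ₜ 1)
    (hgen : ∀ R : Submodule k Ω, (∀ a b, B.left a (B.right b θ) ∈ R) → R = ⊤)
    (hmem : ∀ y, B.kappa θ y ∈ B.spanKappa θ K ↔ y ∈ K) :
    ∃ Γ : BicovariantCalculus k A (Ω ⧸ B.spanKappa θ K), ∀ h : Module.Dual k A,
      h ∈ Γ.tangentSpace ↔ h 1 = 0 ∧ ∀ y ∈ K, Coalgebra.counit (R := k) y = 0 → h y = 0 := by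
  obtain ⟨y, hy, hy1⟩ := hK.exists_counit
  let Q := B.quotientKappa θ K hL hR hK
  have hk (x : A) : Q.kappa ((B.spanKappa θ K).mkQ θ) x = 0 ↔ x ∈ K := by
    rw [quotientKappa_kappa, Submodule.mkQ_apply, Submodule.Quotient.mk_eq_zero, hmem]
  have hs := Q.innerD_surjective ((B.spanKappa θ K).mkQ θ) (fun R hR => by
      have := hgen (R.comap (B.spanKappa θ K).mkQ) hR
      rw [eq_top_iff]
      rintro ω -
      obtain ⟨t, rfl⟩ := (B.spanKappa θ K).mkQ_surjective ω
      exact (this ▸ trivial : t ∈ R.comap (B.spanKappa θ K).mkQ)) ((hk y).2 hy) hy1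
  refine ⟨Q.innerCalculus _ (by rw [quotientKappa_coactL, hL, LinearMap.lTensor_tmul])
    (by rw [quotientKappa_coactR, hR, LinearMap.rTensor_tmul]) hs, fun h =>
      and_congr_right fun _ => forall_congr' fun x => ?_⟩
  have hx : Coalgebra.counit (R := k) x = 0 → ((Q.innerCalculus _
      (by rw [quotientKappa_coactL, hL, LinearMap.lTensor_tmul])
      (by rw [quotientKappa_coactR, hR, LinearMap.rTensor_tmul]) hs).maurerCartan x = 0 ↔
        x ∈ K) := fun hx => by
    rw [← hk]
    have := Q.maurerCartan_innerD ((B.spanKappa θ K).mkQ θ) x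
    rw [hx, zero_smul, sub_zero] at this
    rw [← this]
    rfl
  exact ⟨fun H hy hy0 => H hy0 ((hx hy0).2 hy), fun H hy0 hy => H ((hx hy0).1 hy) hy0⟩

end Generator

/-! ### The calculus of a right ideal, as a quotient of `A ⊗ A` -/

section TensorSquare

variable {k A : Type*} [Field k] [Ring A] [HopfAlgebra k A]

/-- The map `b ⊗ c ↦ ∑ b c₁ ⊗ c₂`. -/
noncomputable def untwist : A ⊗[k] A →ₗ[k] A ⊗[k] A :=
  TensorProduct.lift ((LinearMap.rTensorHom A ∘ₗ LinearMap.mul k A).compl₂ Coalgebra.comul)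

theorem untwist_left (b : A) (t : A ⊗[k] A) : untwist ((tensorSquare k A).left b t) =
    (LinearMap.mul k A b).rTensor A (untwist t) := by
  induction t with
  | zero => simp
  | add x y hx hy => simp only [map_add, hx, hy]
  | tmul x y =>
    have : LinearMap.mul k A (b * x) = LinearMap.mul k A b ∘ₗ LinearMap.mul k A x := by
      ext; simp [mul_assoc]
    simp [untwist, tensorSquare_left, this, LinearMap.rTensor_comp]

/-- Here `κ(y) = ∑ S(y₁) ⊗ y₂`, which is untwisted to `∑ S(y₁) y₂ ⊗ y₃ = 1 ⊗ y`. -/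
theorem untwist_kappa (y : A) : untwist ((tensorSquare k A).kappa (1 ⊗ₜ 1) y) = 1 ⊗ₜ[k] y := by
  have h1 : LinearMap.mul k A 1 = LinearMap.id := by ext; simp
  have hm (a b : A) : LinearMap.mul k A (a * b) = LinearMap.mul k A a ∘ₗ LinearMap.mul k A b := by
    ext; simp [mul_assoc]
  have key := lift_antipode_cancel (LinearMap.rTensorHom A ∘ₗ LinearMap.mul k A)
    (fun w => by simp [h1]) (fun a b w => by simp [hm, LinearMap.rTensor_comp])
    (Coalgebra.comul (R := k)) Coalgebra.coassoc_apply (by simp) _ _ mul'_map_antipode_id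
    (TensorProduct.mk k A A 1) y
  have e1 : TensorProduct.lift (((LinearMap.rTensorHom A ∘ₗ LinearMap.mul k A) ∘ₗ
      LinearMap.id).compl₂ (TensorProduct.mk k A A 1)) = LinearMap.id := by
    ext; simp
  rw [e1, LinearMap.id_comp] at key
  have e2 : untwist ∘ₗ TensorProduct.lift (((tensorSquare k A).left ∘ₗ antipode k).compl₂
      ((tensorSquare k A).right.flip (1 ⊗ₜ 1))) = TensorProduct.lift
      (((LinearMap.rTensorHom A ∘ₗ LinearMap.mul k A) ∘ₗ antipode k).compl₂ Coalgebra.comul) := by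
    apply TensorProduct.ext'
    intro x y
    simp [untwist, tensorSquare_left, tensorSquare_right]
  rw [← e2] at key
  exact key

variable {K : Submodule k A}

/-- Untwisting carries the submodule generated by `κ(K)` to zero in `A ⊗ (A / K)`. So `1 ⊗ y`
vanishes there, and applying the counit to the first factor gives `y ∈ K`. -/
theorem kappa_mem_iff {y : A} : (tensorSquare k A).kappa (1 ⊗ₜ 1) y ∈
    (tensorSquare k A).spanKappa (1 ⊗ₜ 1) K ↔ y ∈ K := by
  refine ⟨fun h => ?_, kappa_mem _ _⟩
  have hle : (tensorSquare k A).spanKappa (1 ⊗ₜ 1) K ≤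
      LinearMap.ker (K.mkQ.lTensor A ∘ₗ untwist) := spanKappa_le _ _ fun b y hy => by
    rw [LinearMap.mem_ker, LinearMap.comp_apply, untwist_left, untwist_kappa]
    simp [(Submodule.Quotient.mk_eq_zero K).2 hy]
  have h2 := hle h
  rw [LinearMap.mem_ker, LinearMap.comp_apply, untwist_kappa] at h2
  have h3 := congrArg (TensorProduct.lid k _ ∘
    (Coalgebra.counit (R := k) (A := A)).rTensor (A ⧸ K)) h2
  simpa using h3

theorem exists_calculus (hK : IsCalculusIdeal K) :
    ∃ Γ : BicovariantCalculus k A ((A ⊗[k] A) ⧸ (tensorSquare k A).spanKappa (1 ⊗ₜ 1) K),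
      ∀ h : Module.Dual k A, h ∈ Γ.tangentSpace ↔
        h 1 = 0 ∧ ∀ y ∈ K, Coalgebra.counit (R := k) y = 0 → h y = 0 := by
  have hL : (tensorSquare k A).coactL (1 ⊗ₜ 1) = 1 ⊗ₜ (1 ⊗ₜ 1) := by
    simp [tensorSquare_coactL_one_tmul, Algebra.TensorProduct.one_def]
  have hR : (tensorSquare k A).coactR (1 ⊗ₜ 1) = (1 ⊗ₜ 1) ⊗ₜ 1 := by
    simp [tensorSquare_coactR_one_tmul, Algebra.TensorProduct.one_def]
  have hgen (R : Submodule k (A ⊗[k] A))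
      (h : ∀ a b, (tensorSquare k A).left a ((tensorSquare k A).right b (1 ⊗ₜ 1)) ∈ R) :
      R = ⊤ := by
    rw [eq_top_iff, ← TensorProduct.span_tmul_eq_top, Submodule.span_le]
    rintro _ ⟨a, b, rfl⟩
    simpa [tensorSquare_left, tensorSquare_right] using h a b
  have hmem (y : A) : (tensorSquare k A).kappa (1 ⊗ₜ 1) y ∈
    (tensorSquare k A).spanKappa (1 ⊗ₜ 1) K ↔ y ∈ K := kappa_mem_iff
  generalize tensorSquare k A = B at hL hR hgen hmem
  generalize (1 ⊗ₜ[k] 1 : A ⊗[k] A) = θ at hL hR hgen hmem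
  exact B.exists_calculus_quotient θ hK hL hR hgen hmem

end TensorSquare

end HopfBimodule

/-! ### Coadjoint operators -/

namespace HopfAlgebra

variable {k A : Type*} [Field k] [Ring A] [HopfAlgebra k A]

/-- The operator `a ↦ ∑ a₂ p(S(a₁) a₃)` of the coadjoint action of a functional `p`. -/
noncomputable def coadjoint (p : Module.Dual k A) : A →ₗ[k] A :=
  (TensorProduct.rid k A).toLinearMap ∘ₗ p.lTensor A ∘ₗ adjointCoaction k A

theorem counit_adjointCoaction (a : A) : (Coalgebra.counit (R := k)).rTensor A
    (adjointCoaction k A a) = 1 ⊗ₜ algebraMap k A (Coalgebra.counit a) := by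
  have h : (Coalgebra.counit (R := k)).rTensor A ∘ₗ
      TensorProduct.lift ((mulSnd k A ∘ₗ antipode k).compl₂ Coalgebra.comul) =
      TensorProduct.mk k k A 1 ∘ₗ LinearMap.mul' k A ∘ₗ
        TensorProduct.map (antipode k) LinearMap.id := by
    apply TensorProduct.ext'
    intro x y
    have h1 : (Coalgebra.counit (R := k)).rTensor A ∘ₗ mulSnd k A (antipode k x) =
        (LinearMap.mul k A (antipode k x)).lTensor k ∘ₗ (Coalgebra.counit (R := k)).rTensor A := by
      ext; simp [mulSnd]
    have h2 := congr($h1 (Coalgebra.comul y))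
    simp only [LinearMap.comp_apply, Coalgebra.rTensor_counit_comul] at h2
    simpa using h2
  rw [adjointCoaction, LinearMap.comp_apply, ← LinearMap.comp_apply, h]
  simp only [LinearMap.comp_apply, mul'_map_antipode_id, TensorProduct.mk_apply]

/-- Applying the counit to `a₂` leaves `p(S(a₁) a₂) = ε(a) p(1)`. In particular the coadjoint
operators preserve `A⁺`. -/
theorem counit_coadjoint (p : Module.Dual k A) (a : A) :
    Coalgebra.counit (R := k) (coadjoint p a) = Coalgebra.counit (R := k) a * p 1 := by
  have h : Coalgebra.counit (R := k) ∘ₗ (TensorProduct.rid k A).toLinearMap ∘ₗ p.lTensor A =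
      p ∘ₗ (TensorProduct.lid k A).toLinearMap ∘ₗ (Coalgebra.counit (R := k)).rTensor A := by
    ext x y; simp [mul_comm]
  have h2 := congr($h (adjointCoaction k A a))
  simp only [LinearMap.comp_apply, counit_adjointCoaction, Algebra.algebraMap_eq_smul_one] at h2
  simpa [coadjoint] using h2

theorem coadjoint_one (p : Module.Dual k A) : coadjoint p 1 = p 1 • (1 : A) := by
  simp [coadjoint, adjointCoaction, Algebra.TensorProduct.one_def, mulSnd_one]

end HopfAlgebra

namespace BicovariantCalculus

open HopfAlgebra

variable {k A Ω : Type*} [Field k] [Ring A] [HopfAlgebra k A] [AddCommGroup Ω] [Module k Ω]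
  (Γ : BicovariantCalculus k A Ω)

/-! ### The pairing of the left-invariant 1-forms with the quantum tangent space -/

theorem maurerCartan_sub_counit (x : A) :
    Γ.maurerCartan (x - algebraMap k A (Coalgebra.counit x)) = Γ.maurerCartan x := by
  rw [map_sub, Algebra.algebraMap_eq_smul_one, map_smul, maurerCartan_one, smul_zero, sub_zero]

/-- The tangent space is the annihilator of `k 1 + (A⁺ ∩ ker π)`. Over a field the double
annihilator returns this subspace, and `π` kills it. -/
theorem maurerCartan_eq_zero {x : A} (hx : Coalgebra.counit (R := k) x = 0)
    (h : ∀ f ∈ Γ.tangentSpace, f x = 0) : Γ.maurerCartan x = 0 := by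
  let W : Subspace k A := Submodule.span k {1} ⊔
    (LinearMap.ker (Coalgebra.counit (R := k) (A := A)) ⊓ LinearMap.ker Γ.maurerCartan)
  have hW : x ∈ W := by
    refine (Subspace.forall_mem_dualAnnihilator_apply_eq_zero_iff W x).1 fun f hf => h f ⟨?_, ?_⟩
    · exact (Submodule.mem_dualAnnihilator f).1 hf 1
        (Submodule.mem_sup_left (Submodule.mem_span_singleton_self 1))
    · intro a ha ha'
      exact (Submodule.mem_dualAnnihilator f).1 hf a (Submodule.mem_sup_right ⟨ha, ha'⟩)
  obtain ⟨y, hy, z, hz, rfl⟩ := Submodule.mem_sup.1 hW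
  obtain ⟨c, rfl⟩ := Submodule.mem_span_singleton.1 hy
  have hz2 : Γ.maurerCartan z = 0 := hz.2
  rw [map_add, hz2, map_smul, maurerCartan_one, smul_zero, add_zero]

/-- The projection of the augmentation ideal onto the left-invariant 1-forms. -/
noncomputable def augmentationProj :
    LinearMap.ker (Coalgebra.counit (R := k) (A := A)) →ₗ[k] Γ.leftInvariant :=
  (Γ.maurerCartan.codRestrict Γ.leftInvariant Γ.maurerCartan_mem).domRestrict _

theorem augmentationProj_surjective : LinearMap.range Γ.augmentationProj = ⊤ := by
  rw [LinearMap.range_eq_top]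
  intro ω
  obtain ⟨x, hx, h⟩ := Γ.exists_maurerCartan_eq ω
  exact ⟨⟨x, hx⟩, Subtype.ext h⟩

/-- A linear choice of representatives in the augmentation ideal of the left-invariant 1-forms. -/
noncomputable def leftInvariantLift : Γ.leftInvariant →ₗ[k]
    LinearMap.ker (Coalgebra.counit (R := k) (A := A)) :=
  (Γ.augmentationProj.exists_rightInverse_of_surjective Γ.augmentationProj_surjective).choose

theorem maurerCartan_leftInvariantLift (ω : Γ.leftInvariant) : Γ.maurerCartan (Γ.leftInvariantLift ω) = ω :=
  congr(($((Γ.augmentationProj.exists_rightInverse_of_surjective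
    Γ.augmentationProj_surjective).choose_spec) ω : Ω))

/-- The pairing of the left-invariant 1-forms with the quantum tangent space. -/
noncomputable def pairing : Γ.leftInvariant →ₗ[k] Module.Dual k Γ.tangentSpace :=
  (Γ.tangentSpace.subtype.flip ∘ₗ Submodule.subtype _) ∘ₗ Γ.leftInvariantLift

theorem pairing_apply (ω : Γ.leftInvariant) (h : Γ.tangentSpace) :
    Γ.pairing ω h = (h : Module.Dual k A) (Γ.leftInvariantLift ω) := rfl

/-- Two representatives of `ω` in `A⁺` differ by an element of `A⁺ ∩ ker π`, where tangent vectors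
vanish. -/
theorem pairing_eq {x : A} (hx : Coalgebra.counit (R := k) x = 0) {ω : Γ.leftInvariant}
    (hω : Γ.maurerCartan x = ω) (h : Γ.tangentSpace) :
    Γ.pairing ω h = (h : Module.Dual k A) x := by
  rw [pairing_apply, ← sub_eq_zero, ← map_sub]
  have h0 : Coalgebra.counit (R := k) (Γ.leftInvariantLift ω : A) = 0 := (Γ.leftInvariantLift ω).2
  exact h.2.2 _ (by rw [map_sub, h0, hx, sub_zero])
    (by rw [map_sub, hω, maurerCartan_leftInvariantLift, sub_self])

theorem pairing_maurerCartan (x : A) (h : Γ.tangentSpace) :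
    Γ.pairing ⟨Γ.maurerCartan x, Γ.maurerCartan_mem x⟩ h = (h : Module.Dual k A) x := by
  rw [Γ.pairing_eq (x := x - algebraMap k A (Coalgebra.counit x)) (by simp)
    (Γ.maurerCartan_sub_counit x), map_sub, Algebra.algebraMap_eq_smul_one, map_smul, h.2.1,
    smul_zero, sub_zero]

theorem pairs_iff (ω : Γ.leftInvariant) (h : Γ.tangentSpace) (c : k) :
    Γ.Pairs ω h c ↔ Γ.pairing ω h = c := by
  constructor
  · rintro ⟨x, hx, hω, rfl⟩
    exact Γ.pairing_eq hx hω h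
  · rintro rfl
    exact ⟨Γ.leftInvariantLift ω, (Γ.leftInvariantLift ω).2, Γ.maurerCartan_leftInvariantLift ω, rfl⟩

theorem pairing_injective : Function.Injective Γ.pairing := by
  rw [injective_iff_map_eq_zero]
  intro ω h
  refine Subtype.ext ?_
  rw [← Γ.maurerCartan_leftInvariantLift]
  exact Γ.maurerCartan_eq_zero (Γ.leftInvariantLift ω).2 fun f hf => congr($h ⟨f, hf⟩)

/-- A functional on a finite-dimensional subspace of `A*` is evaluation at some `x ∈ A`; the form
`π(x)` then induces it. -/
theorem pairing_surjective [FiniteDimensional k Γ.tangentSpace] :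
    Function.Surjective Γ.pairing := by
  intro φ
  obtain ⟨q, hq⟩ := (Subspace.quotDualCoannihilatorToDual_bijective Γ.tangentSpace).2 φ
  obtain ⟨x, rfl⟩ := Submodule.mkQ_surjective _ q
  refine ⟨⟨Γ.maurerCartan x, Γ.maurerCartan_mem x⟩, LinearMap.ext fun h => ?_⟩
  rw [pairing_maurerCartan, ← hq]
  rfl

/-! ### Irreducibility -/

/-- A sub-bimodule of the 1-forms which is a sub-bicomodule. -/
structure IsSub (N : Submodule k Ω) : Prop where
  left : ∀ a, ∀ ω ∈ N, Γ.left a ω ∈ N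
  right : ∀ a, ∀ ω ∈ N, Γ.right a ω ∈ N
  coactL : ∀ ω ∈ N, Γ.coactL ω ∈ LinearMap.range (N.subtype.lTensor A)
  coactR : ∀ ω ∈ N, Γ.coactR ω ∈ LinearMap.range (N.subtype.rTensor A)

variable {Γ} {N : Submodule k Ω}

theorem IsSub.maurerCartan_mul_mem (hN : Γ.IsSub N) {x : A} (hx : Coalgebra.counit (R := k) x = 0)
    (h : Γ.maurerCartan x ∈ N) (b : A) : Γ.maurerCartan (x * b) ∈ N := by
  rw [Γ.maurerCartan_mul, hx, zero_smul, add_zero, HopfBimodule.adjoint, HopfBimodule.maurerCartan,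
    LinearMap.comp_apply]
  generalize Coalgebra.comul (R := k) b = t
  induction t with
  | zero => simp
  | add s t hs ht => rw [map_add]; exact add_mem hs ht
  | tmul y z => exact hN.left _ _ (hN.right _ _ h)

theorem IsSub.maurerCartan_coadjoint_mem (hN : Γ.IsSub N) {x : A} (h : Γ.maurerCartan x ∈ N)
    (p : Module.Dual k A) : Γ.maurerCartan (coadjoint p x) ∈ N := by
  have h1 : Γ.maurerCartan ∘ₗ (TensorProduct.rid k A).toLinearMap ∘ₗ p.lTensor A =
      (TensorProduct.rid k Ω).toLinearMap ∘ₗ p.lTensor Ω ∘ₗ Γ.maurerCartan.rTensor A := by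
    apply TensorProduct.ext'
    intro x y
    simp
  have h2 := congr($h1 (adjointCoaction k A x))
  simp only [LinearMap.comp_apply, ← coactR_maurerCartan] at h2
  change Γ.maurerCartan ((TensorProduct.rid k A).toLinearMap _) ∈ N
  rw [LinearMap.comp_apply, h2]
  obtain ⟨t, ht⟩ := hN.coactR _ h
  rw [← ht]
  generalize t = t
  induction t with
  | zero => simp
  | add s t hs ht => simp only [map_add]; exact add_mem hs ht
  | tmul y z => simpa using N.smul_mem _ y.2

theorem IsSub.coinvProj_mem (hN : Γ.IsSub N) {ω : Ω} (h : ω ∈ N) :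
    Γ.toHopfBimodule.coinvProj ω ∈ N := by
  obtain ⟨t, ht⟩ := hN.coactL _ h
  change TensorProduct.lift (Γ.left ∘ₗ antipode k) (Γ.coactL ω) ∈ N
  rw [← ht]
  generalize t = t
  induction t with
  | zero => simp
  | add s t hs ht => simp only [map_add]; exact add_mem hs ht
  | tmul y z => exact hN.left _ _ z.2

/-- Since `ω = ∑ ω₋₁ P(ω₀)`, `N` is generated by its left-invariant elements, each of which is
`π(x)` for some `x ∈ A⁺`. -/
theorem IsSub.eq_bot (hN : Γ.IsSub N) (h : ∀ x, Coalgebra.counit (R := k) x = 0 →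
    Γ.maurerCartan x ∈ N → Γ.maurerCartan x = 0) : N = ⊥ := by
  have h0 (ω : Ω) (hω : ω ∈ N) : Γ.toHopfBimodule.coinvProj ω = 0 := by
    obtain ⟨x, hx, hx'⟩ := Γ.exists_maurerCartan_eq ⟨_, Γ.coinvProj_mem ω⟩
    have hx' : Γ.maurerCartan x = Γ.toHopfBimodule.coinvProj ω := hx'
    rw [← hx']
    exact h x hx (hx' ▸ hN.coinvProj_mem hω)
  rw [eq_bot_iff]
  intro ω hω
  obtain ⟨t, ht⟩ := hN.coactL _ hω
  have h1 := Γ.toHopfBimodule.eq_lift_coinvProj ω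
  change TensorProduct.lift _ (Γ.coactL ω) = ω at h1
  rw [Submodule.mem_bot, ← h1, ← ht]
  generalize t = t
  induction t with
  | zero => simp
  | add s t hs ht => simp only [map_add, hs, ht, add_zero]
  | tmul y z => simp [h0 _ z.2]

theorem IsSub.eq_top (hN : Γ.IsSub N)
    (h : ∀ x, Coalgebra.counit (R := k) x = 0 → Γ.maurerCartan x ∈ N) : N = ⊤ := by
  rw [eq_top_iff]
  rintro ω -
  induction ω using Γ.induction_on with
  | hadd x y hx hy => exact add_mem hx hy
  | h a b =>
    refine hN.left _ _ ?_
    rw [d_eq_lift]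
    generalize Coalgebra.comul (R := k) b = t
    induction t with
    | zero => simp
    | add s t hs ht => rw [map_add]; exact add_mem hs ht
    | tmul x y =>
      refine hN.left _ _ ?_
      rw [← maurerCartan_sub_counit]
      exact h _ (by simp)

variable (Γ) in
/-- A calculus is irreducible when its quantum tangent space has no proper nonzero subspace stable
under the operations corresponding to the right action and the right coaction of `A`. -/
theorem isIrreducible_of_tangentSpace (h0 : Γ.tangentSpace ≠ ⊥)
    (H : ∀ W ≤ Γ.tangentSpace,
      (∀ h ∈ W, ∀ b : A, h ∘ₗ LinearMap.mulRight k b - h b • Coalgebra.counit ∈ W) →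
      (∀ h ∈ W, ∀ p : Module.Dual k A, h ∘ₗ coadjoint p ∈ W) → W = ⊥ ∨ W = Γ.tangentSpace) :
    Γ.IsIrreducible := by
  have htop (g : Module.Dual k A) (h1 : g 1 = 0)
      (h2 : ∀ x, Coalgebra.counit (R := k) x = 0 → g x = 0) : g = 0 := by
    ext x
    have := h2 (x - algebraMap k A (Coalgebra.counit x)) (by simp)
    rwa [map_sub, Algebra.algebraMap_eq_smul_one, map_smul, h1, smul_zero, sub_zero] at this
  refine ⟨?_, fun N hl hr hL hR => ?_⟩
  · by_contra hn
    rw [not_nontrivial_iff_subsingleton] at hn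
    refine h0 ((Submodule.eq_bot_iff _).2 fun h hh => htop h hh.1 fun x hx => ?_)
    exact hh.2 x hx (Subsingleton.elim _ _)
  have hN : Γ.IsSub N := ⟨hl, hr, hL, hR⟩
  -- The annihilator of `k 1 + {x ∈ A⁺ : π(x) ∈ N}`: morally the tangent space of the quotient
  -- calculus `Ω / N`.
  let W : Submodule k (Module.Dual k A) :=
    Submodule.dualAnnihilator (Submodule.span k {1} ⊔
      (LinearMap.ker (Coalgebra.counit (R := k) (A := A)) ⊓ N.comap Γ.maurerCartan))
  have hW (g : Module.Dual k A) : g ∈ W ↔ g 1 = 0 ∧ ∀ x, Coalgebra.counit (R := k) x = 0 →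
      Γ.maurerCartan x ∈ N → g x = 0 := by
    simp only [W, Submodule.mem_dualAnnihilator]
    constructor
    · intro h
      exact ⟨h 1 (Submodule.mem_sup_left (Submodule.mem_span_singleton_self 1)),
        fun x hx hx' => h x (Submodule.mem_sup_right ⟨hx, hx'⟩)⟩
    · rintro ⟨h1, h2⟩ x hx
      obtain ⟨y, hy, z, hz, rfl⟩ := Submodule.mem_sup.1 hx
      obtain ⟨c, rfl⟩ := Submodule.mem_span_singleton.1 hy
      rw [map_add, map_smul, h1, smul_zero, zero_add, h2 z hz.1 hz.2]
  have hle : W ≤ Γ.tangentSpace := fun g hg =>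
    ⟨((hW g).1 hg).1, fun x hx hx' => ((hW g).1 hg).2 x hx (hx' ▸ N.zero_mem)⟩
  -- The multiple of the counit makes the functional vanish at `1` and does not affect it on `A⁺`.
  have hmul : ∀ h ∈ W, ∀ b : A, h ∘ₗ LinearMap.mulRight k b - h b • Coalgebra.counit ∈ W := by
    intro g hg b
    rw [hW] at hg ⊢
    refine ⟨by simp, fun x hx hx' => ?_⟩
    simp only [LinearMap.sub_apply, LinearMap.comp_apply, LinearMap.mulRight_apply,
      LinearMap.smul_apply, hx, smul_zero, sub_zero]
    exact hg.2 _ (by simp [hx]) (hN.maurerCartan_mul_mem hx hx' b)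
  have hco : ∀ h ∈ W, ∀ p : Module.Dual k A, h ∘ₗ coadjoint p ∈ W := by
    intro g hg p
    rw [hW] at hg ⊢
    refine ⟨by simp [coadjoint_one, hg.1], fun x hx hx' => ?_⟩
    exact hg.2 _ (by rw [counit_coadjoint, hx, zero_mul]) (hN.maurerCartan_coadjoint_mem hx' p)
  rcases H W hle hmul hco with h | h
  · right
    refine hN.eq_top fun x hx => ?_
    -- `W = 0` forces `V = A` by the double annihilator, so `π(A⁺) ⊆ N`.
    let V : Subspace k A := Submodule.span k {1} ⊔
      (LinearMap.ker (Coalgebra.counit (R := k) (A := A)) ⊓ N.comap Γ.maurerCartan)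
    have hV : x ∈ V := by
      refine (Subspace.forall_mem_dualAnnihilator_apply_eq_zero_iff V x).1 fun f hf => ?_
      have hf' : f ∈ W := hf
      rw [h, Submodule.mem_bot] at hf'
      rw [hf', LinearMap.zero_apply]
    obtain ⟨y, hy, z, hz, rfl⟩ := Submodule.mem_sup.1 hV
    obtain ⟨c, rfl⟩ := Submodule.mem_span_singleton.1 hy
    rw [map_add, map_smul, maurerCartan_one, smul_zero, zero_add]
    exact hz.2
  · left
    refine hN.eq_bot fun x hx hx' => Γ.maurerCartan_eq_zero hx fun f hf => ?_
    rw [← h] at hf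
    exact ((hW f).1 hf).2 x hx hx'

end BicovariantCalculus

/-! ### The grading of `kX` and its compatibility with the action of `X` -/

namespace GroupFactorization

variable {X : Type v} [Group X] (F : GroupFactorization X)

/-- Let `x = v t` and `v y = m g`. The result of the action is `g (m⁻¹ t m)`, of degree `(m g)⁻¹ t⁻¹
(m g) = (v y)⁻¹ t⁻¹ (v y)`. -/
theorem deg_act (x y : X) : F.deg (F.act x y) = y⁻¹ * F.deg x * y := by
  obtain ⟨m, g, h⟩ := F.exists_factor (F.fstG x * y)
  have h1 := F.act_eq h
  have hy : y = (F.fstG x : X)⁻¹ * (m * g) := by rw [← h]; group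
  rw [deg, F.fstG_eq h1, F.sndM_eq h1, deg]
  rw [hy]
  push_cast
  group

theorem act_act_inv (x y : X) : F.act (F.act x y) y⁻¹ = x := by
  rw [act_act, mul_inv_cancel, act_one]

theorem act_injective (y : X) : Function.Injective fun x => F.act x y :=
  Function.LeftInverse.injective (g := fun x => F.act x y⁻¹) fun x => F.act_act_inv x y

theorem sndM_act_eq_one_iff (x y : X) : F.sndM (F.act x y) = 1 ↔ F.sndM x = 1 := by
  obtain ⟨m, g, h⟩ := F.exists_factor (F.fstG x * y)
  rw [F.sndM_eq (F.act_eq h)]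
  simp [mul_assoc, inv_mul_eq_one]

theorem fstG_coe_mul (u : F.G) (s : F.M) : F.fstG (u * s) = u := F.fstG_eq rfl

theorem sndM_coe_mul (u : F.G) (s : F.M) : F.sndM (u * s) = s := F.sndM_eq rfl

theorem sndM_coe (s : F.M) : F.sndM s = s := F.sndM_eq (g := 1) (by simp)

theorem fstG_coe (s : F.M) : F.fstG s = 1 := F.fstG_eq (g := 1) (m := s) (by simp)

/-- The left side is `u⁻¹ s u`. Hence the labels `s ◁ u` and `(s ▷ u)⁻¹ u`, which occur in the
product and the adjoint coaction of `A`, are the two parts `⟨z⟩` and `|z|` of the degree `z` of `u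
s`. -/
theorem deg_inv_coe_mul (u : F.G) (s : F.M) :
    (F.deg (u * s))⁻¹ = (u⁻¹ * F.up s u : F.G) * F.dn s u := by
  rw [deg, fstG_coe_mul, sndM_coe_mul]
  push_cast
  rw [mul_assoc (u : X)⁻¹ (F.up s u : X), F.up_mul_dn]
  group

theorem mPart_deg (u : F.G) (s : F.M) : F.mPart (F.deg (u * s)) = F.dn s u :=
  F.sndM_eq (F.deg_inv_coe_mul u s)

theorem gPart_deg (u : F.G) (s : F.M) : F.gPart (F.deg (u * s)) = (F.up s u)⁻¹ * u := by
  rw [gPart, F.fstG_eq (F.deg_inv_coe_mul u s)]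
  simp

theorem act_coe_mul_coeG (u w : F.G) (s : F.M) : F.act (u * s) w = (u * w : F.G) * s := by
  rw [F.act_eq (m := 1) (g := u * w) (by rw [fstG_coe_mul]; simp), sndM_coe_mul]
  simp

theorem act_coe_mul_coeM (u : F.G) (s c : F.M) :
    F.act (u * s) (F.dn c u : X)⁻¹ = F.up c u * (c * s * c⁻¹ : F.M) := by
  rw [F.act_eq (m := c⁻¹) (g := F.up c u), sndM_coe_mul]
  · simp
  · rw [fstG_coe_mul, mul_inv_eq_iff_eq_mul, mul_assoc, F.up_mul_dn]
    simp

section Linear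

variable (k : Type u) [Field k]

theorem actMap_apply (y : X) (f : X →₀ k) (x : X) : F.actMap k y f x = f (F.act x y⁻¹) := by
  have h : x = F.act (F.act x y⁻¹) y := by
    rw [act_act, inv_mul_cancel, act_one]
  conv_lhs => rw [h]
  exact Finsupp.mapDomain_apply (F.act_injective y) f _

theorem actMap_one (f : X →₀ k) : F.actMap k 1 f = f := by
  ext x
  rw [actMap_apply, inv_one, act_one]

open Classical in
/-- The projection onto the span of the elements with degree satisfying `P`. -/
noncomputable def degProj (P : X → Prop) : (X →₀ k) →ₗ[k] (X →₀ k) where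
  toFun f := f.filter fun x => P (F.deg x)
  map_add' _ _ := Finsupp.filter_add
  map_smul' _ _ := Finsupp.filter_smul

open Classical in
theorem degProj_apply (P : X → Prop) (f : X →₀ k) (x : X) :
    F.degProj k P f x = if P (F.deg x) then f x else 0 := Finsupp.filter_apply _ _ _

variable {k}

theorem degProj_of_mem {P : X → Prop} {z : X} (hz : P z) {f : X →₀ k}
    (hf : f ∈ F.homogeneous k z) : F.degProj k P f = f := by
  classical
  ext x
  rw [degProj_apply, ite_eq_left_iff]
  intro h
  by_contra h0
  have : F.deg x = z := hf (Finsupp.mem_support_iff.2 (Ne.symm h0))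
  exact h (this ▸ hz)

theorem degProj_of_mem_of_not {P : X → Prop} {z : X} (hz : ¬ P z) {f : X →₀ k}
    (hf : f ∈ F.homogeneous k z) : F.degProj k P f = 0 := by
  classical
  ext x
  rw [degProj_apply, Finsupp.zero_apply, ite_eq_right_iff]
  intro h
  by_contra h0
  have : F.deg x = z := hf (Finsupp.mem_support_iff.2 h0)
  exact hz (this ▸ h)

theorem apply_eq_zero_of_deg_ne {z x : X} (hx : F.deg x ≠ z) {f : X →₀ k}
    (hf : f ∈ F.homogeneous k z) : f x = 0 := by
  by_contra h0
  exact hx (hf (Finsupp.mem_support_iff.2 h0))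

theorem actMap_mem_homogeneous {z : X} (y : X) {f : X →₀ k} (hf : f ∈ F.homogeneous k z) :
    F.actMap k y f ∈ F.homogeneous k (y⁻¹ * z * y) := by
  intro x hx
  rw [Finset.mem_coe, Finsupp.mem_support_iff, actMap_apply] at hx
  have : F.deg (F.act x y⁻¹) = z := hf (Finsupp.mem_support_iff.2 hx)
  rw [deg_act] at this
  rw [Set.mem_ofPred_eq, ← this]
  group

theorem induced_le {M₀ : Submodule k (X →₀ k)} {P : Submodule k (X →₀ k)}
    (h : ∀ x, ∀ w ∈ M₀, F.actMap k x w ∈ P) : F.induced M₀ ≤ P :=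
  iSup_le fun x => Submodule.map_le_iff_le_comap.2 fun w hw => h x w hw

theorem actMap_mem_induced' {M₀ : Submodule k (X →₀ k)} (x : X) {w : X →₀ k} (hw : w ∈ M₀) :
    F.actMap k x w ∈ F.induced M₀ :=
  Submodule.mem_iSup_of_mem x ⟨w, hw, rfl⟩

theorem le_induced (M₀ : Submodule k (X →₀ k)) : M₀ ≤ F.induced M₀ := fun w hw => by
  simpa [actMap_one] using F.actMap_mem_induced' 1 hw

theorem degProj_mem_homogeneous (z : X) (f : X →₀ k) :
    F.degProj k (· = z) f ∈ F.homogeneous k z := by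
  classical
  intro x hx
  rw [Finset.mem_coe, Finsupp.mem_support_iff, degProj_apply] at hx
  exact (ite_ne_right_iff.1 hx).1

theorem exists_conj_of_apply_ne_zero {z₀ : X} {M₀ : Submodule k (X →₀ k)}
    (hM : M₀ ≤ F.homogeneous k z₀) {f : X →₀ k} (hf : f ∈ F.induced M₀) {x : X} (hx : f x ≠ 0) :
    ∃ y, F.deg x = y⁻¹ * z₀ * y := by
  by_contra! h
  refine hx ((F.induced_le (P := LinearMap.ker (Finsupp.lapply x : (X →₀ k) →ₗ[k] k))
    fun y w hw => ?_) hf)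
  exact F.apply_eq_zero_of_deg_ne (h y) (F.actMap_mem_homogeneous y (hM hw))

/-! ### Graded submodules of `𝓜` -/

namespace IsDatum

variable {F} {z₀ : X} {M₀ : Submodule k (X →₀ k)}

theorem degProj_mem (h : F.IsDatum z₀ M₀) {w : X →₀ k} (hw : w ∈ F.induced M₀) (P : X → Prop) :
    F.degProj k P w ∈ F.induced M₀ := by
  refine (F.induced_le (P := (F.induced M₀).comap (F.degProj k P)) fun x w hw => ?_) hw
  have hx := F.actMap_mem_homogeneous x (h.le hw)
  rw [Submodule.mem_comap]
  by_cases hP : P (x⁻¹ * z₀ * x)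
  · rw [F.degProj_of_mem hP hx]
    exact F.actMap_mem_induced' x hw
  · rw [F.degProj_of_mem_of_not hP hx]
    exact zero_mem _

/-- Projection to degree `z₀` kills `M₀ ◁ x` unless `x` centralizes `z₀`, and in that case `M₀ ◁ x ⊆
M₀`. -/
theorem mem_of_mem_homogeneous (h : F.IsDatum z₀ M₀) {w : X →₀ k} (hw : w ∈ F.induced M₀)
    (hz : w ∈ F.homogeneous k z₀) : w ∈ M₀ := by
  have h1 : F.degProj k (· = z₀) w ∈ M₀ := by
    refine (F.induced_le (P := M₀.comap (F.degProj k (· = z₀))) fun x w hw => ?_) hw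
    have hx := F.actMap_mem_homogeneous x (h.le hw)
    rw [Submodule.mem_comap]
    by_cases hP : x⁻¹ * z₀ * x = z₀
    · rw [F.degProj_of_mem (P := (· = z₀)) hP hx]
      refine h.stable x ?_ w hw
      rw [Subgroup.mem_centralizer_singleton_iff]
      rw [mul_assoc, inv_mul_eq_iff_eq_mul] at hP
      exact hP.symm
    · rw [F.degProj_of_mem_of_not (P := (· = z₀)) hP hx]
      exact zero_mem _
  rwa [F.degProj_of_mem (P := (· = z₀)) rfl hz] at h1

/-- Every degree occurring in `𝓜` is conjugate to `z₀`, so a nonzero homogeneous component of an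
element of `W` can be moved to degree `z₀`. There irreducibility of `M₀` decides. -/
theorem eq_bot_or_eq_induced (h : F.IsDatum z₀ M₀) {W : Submodule k (X →₀ k)}
    (hW : W ≤ F.induced M₀) (hact : ∀ x, ∀ w ∈ W, F.actMap k x w ∈ W)
    (hdeg : ∀ z, ∀ w ∈ W, F.degProj k (· = z) w ∈ W) : W = ⊥ ∨ W = F.induced M₀ := by
  rcases h.irreducible (W ⊓ F.homogeneous k z₀)
    (fun w hw => h.mem_of_mem_homogeneous (hW hw.1) hw.2) (fun x hx w hw => ⟨hact x w hw.1, by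
      have := F.actMap_mem_homogeneous x hw.2
      rw [Subgroup.mem_centralizer_singleton_iff] at hx
      rwa [mul_assoc, ← hx, inv_mul_cancel_left] at this⟩) with h1 | h1
  · left
    rw [eq_bot_iff]
    intro f hf
    rw [Submodule.mem_bot]
    ext x
    by_contra hx
    obtain ⟨y, hy⟩ := F.exists_conj_of_apply_ne_zero h.le (hW hf) hx
    have h2 := F.actMap_mem_homogeneous y⁻¹ (F.degProj_mem_homogeneous (F.deg x) f)
    have h3 : F.actMap k y⁻¹ (F.degProj k (· = F.deg x) f) ∈ W ⊓ F.homogeneous k z₀ := by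
      refine ⟨hact _ _ (hdeg _ _ hf), ?_⟩
      have h4 : y⁻¹⁻¹ * F.deg x * y⁻¹ = z₀ := by rw [hy]; group
      rwa [h4] at h2
    rw [h1, Submodule.mem_bot] at h3
    have h4 := congrArg (F.actMap k y) h3
    rw [actMap_actMap, inv_mul_cancel, actMap_one, map_zero] at h4
    have h5 := DFunLike.congr_fun h4 x
    classical
    rw [degProj_apply, if_pos rfl] at h5
    exact hx h5
  · right
    refine le_antisymm hW (F.induced_le fun x w hw => hact x w ?_)
    rw [← h1] at hw
    exact hw.1

/-- Such an `f` is constant on `G` and zero elsewhere, hence `X`-invariant and of degree `1`. If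
nonzero, it would force `z₀ = 1` and span `M₀`, which would then be the trivial representation. In
dual terms, `𝓜` contains no nonzero multiple of the counit. -/
theorem eq_zero_of_apply_eq (h : F.IsDatum z₀ M₀) {f : X →₀ k} (hf : f ∈ F.induced M₀) {c : k}
    (h1 : ∀ x, F.sndM x = 1 → f x = c) (h0 : ∀ x, F.sndM x ≠ 1 → f x = 0) : f = 0 := by
  by_contra hne
  obtain ⟨x, hx⟩ := DFunLike.ne_iff.1 hne
  have hs : F.sndM x = 1 := by_contra fun h => hx (h0 x h)
  have hd (x : X) (hs : F.sndM x = 1) : F.deg x = 1 := by simp [deg, hs]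
  obtain ⟨y, hy⟩ := F.exists_conj_of_apply_ne_zero h.le hf hx
  have hz : z₀ = 1 := by
    rw [hd x hs] at hy
    have : z₀ = y * (y⁻¹ * z₀ * y) * y⁻¹ := by group
    rw [this, ← hy]; group
  have hhom : f ∈ F.homogeneous k z₀ := by
    intro x hx
    rw [Finset.mem_coe, Finsupp.mem_support_iff] at hx
    rw [hz]
    exact hd x (by_contra fun h => hx (h0 x h))
  have hact (y : X) : F.actMap k y f = f := by
    ext x
    rw [actMap_apply]
    by_cases hs : F.sndM x = 1
    · rw [h1 x hs, h1 _ ((F.sndM_act_eq_one_iff _ _).2 hs)]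
    · rw [h0 x hs, h0 _ (mt (F.sndM_act_eq_one_iff _ _).1 hs)]
  have hfix (y : X) (w : X →₀ k) (hw : w ∈ Submodule.span k {f}) : F.actMap k y w = w := by
    obtain ⟨c, rfl⟩ := Submodule.mem_span_singleton.1 hw
    rw [map_smul, hact]
  rcases h.irreducible (Submodule.span k {f}) ((Submodule.span_singleton_le_iff_mem _ _).2
    (h.mem_of_mem_homogeneous hf hhom)) (fun x _ w hw => by rwa [hfix x w hw]) with h2 | h2
  · exact hne (Submodule.span_singleton_eq_bot.1 h2)
  · obtain ⟨x, w, hw, hw'⟩ := h.nontrivial hz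
    exact hw' (hfix x w (h2 ▸ hw))

end IsDatum

/-! ### The identification of `kX` with the dual of the bicrossproduct -/

/-- The identification of `kX` with the dual of the bicrossproduct, sending `v t` to the
coordinate of `δ_t ⊗ v`. -/
noncomputable def toDual : (X →₀ k) →ₗ[k] Module.Dual k (F.Bicross k) :=
  Finsupp.linearCombination k fun x : X => (Bicross.basis F k).coord (F.sndM x, F.fstG x)

theorem toDual_basis (f : X →₀ k) (s : F.M) (u : F.G) :
    F.toDual f (Bicross.basis F k (s, u)) = f (u * s) := by
  classical
  induction f using Finsupp.induction_linear with
  | zero => simp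
  | add f g hf hg => simp [hf, hg]
  | single x c =>
    rw [toDual, Finsupp.linearCombination_single, LinearMap.smul_apply, Module.Basis.coord_apply,
      Module.Basis.repr_self, Finsupp.single_apply, Finsupp.single_apply]
    have : (s, u) = (F.sndM x, F.fstG x) ↔ x = u * s := by
      rw [Prod.mk_inj]
      refine ⟨fun h => ?_, fun h => ⟨?_, ?_⟩⟩
      · rw [← F.fstG_mul_sndM x, ← h.1, ← h.2]
      · rw [h, F.sndM_coe_mul]
      · rw [h, F.fstG_coe_mul]
    by_cases h : x = u * s
    · rw [if_pos (this.2 h), if_pos h, smul_eq_mul, mul_one]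
    · rw [if_neg (mt this.1 h), if_neg h, smul_zero]

theorem toDual_apply_eq (f : X →₀ k) (x : X) :
    f x = F.toDual f (Bicross.basis F k (F.sndM x, F.fstG x)) := by
  rw [toDual_basis, fstG_mul_sndM]

section Finite

variable [Finite X]

theorem toDual_one (f : X →₀ k) : F.toDual f 1 = ∑ t : F.M, f t := by
  rw [Bicross.one_def, map_sum]
  exact Finset.sum_congr rfl fun t _ => by simp [toDual_basis]

/-- `Π` is the identification of `kX` with `A*` corrected by the multiple of the counit that makes
it vanish at `1`; the two agree on `A⁺`. -/
theorem proj_eq (f : X →₀ k) :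
    F.proj k f = F.toDual f - F.toDual f 1 • (Coalgebra.counit : F.Bicross k →ₗ[k] k) := by
  classical
  induction f using Finsupp.induction_linear with
  | zero => simp
  | add f g hf hg => simp only [map_add, hf, hg, LinearMap.add_apply, add_smul]; abel
  | single x c =>
    have h : F.toDual (Finsupp.single x c) 1 = c * if F.fstG x = 1 then 1 else 0 := by
      rw [toDual_one]
      by_cases hx : F.fstG x = 1
      · have hx' : x = F.sndM x := by
          conv_lhs => rw [← F.fstG_mul_sndM x, hx]
          simp
        rw [Finset.sum_eq_single (F.sndM x)]
        · simp [← hx', hx]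
        · intro t _ ht
          refine Finsupp.single_eq_of_ne fun h => ht ?_
          rw [← h, F.sndM_coe]
        · simp
      · rw [if_neg hx, mul_zero]
        refine Finset.sum_eq_zero fun t _ => Finsupp.single_eq_of_ne fun h => hx ?_
        rw [← h, F.fstG_coe]
    rw [h, proj, toDual, Finsupp.linearCombination_single, Finsupp.linearCombination_single,
      smul_sub]
    by_cases hx : F.fstG x = 1 <;> simp [hx]

theorem proj_apply_of_counit_eq_zero (f : X →₀ k) {a : F.Bicross k}
    (ha : Coalgebra.counit (R := k) a = 0) : F.proj k f a = F.toDual f a := by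
  simp [proj_eq, ha]

theorem proj_one (f : X →₀ k) : F.proj k f 1 = 0 := by
  simp [proj_eq]

theorem IsDatum.eq_zero_of_toDual_eq {F : GroupFactorization X} {z₀ : X}
    {M₀ : Submodule k (X →₀ k)} (h : F.IsDatum z₀ M₀) {f : X →₀ k} (hf : f ∈ F.induced M₀) {c : k}
    (hc : F.toDual f = c • (Coalgebra.counit : F.Bicross k →ₗ[k] k)) : f = 0 := by
  classical
  refine h.eq_zero_of_apply_eq hf (c := c) (fun x hx => ?_) fun x hx => ?_
  · rw [F.toDual_apply_eq, hc]
    simp [Bicross.counit_basis, hx]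
  · rw [F.toDual_apply_eq, hc]
    simp [Bicross.counit_basis, hx]

theorem IsDatum.proj_injOn {F : GroupFactorization X} {z₀ : X} {M₀ : Submodule k (X →₀ k)}
    (h : F.IsDatum z₀ M₀) : Set.InjOn (F.proj k) (F.induced M₀) := by
  intro f hf g hg hfg
  rw [← sub_eq_zero]
  refine h.eq_zero_of_toDual_eq (sub_mem hf hg) (c := F.toDual (f - g) 1) ?_
  rw [← sub_eq_zero, ← proj_eq, map_sub, hfg, sub_self]

/-- The product `(δ_s ⊗ u)(δ_r ⊗ w)` is nonzero only if `s ◁ u = r`, a condition on the degree of `u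
s`, and is then `δ_s ⊗ u w`, where `u w s` is the result of `w` acting on `u s`. -/
theorem toDual_mul_basis (f : X →₀ k) (a : F.Bicross k) (r : F.M) (w : F.G) :
    F.toDual f (a * Bicross.basis F k (r, w)) =
      F.toDual (F.degProj k (fun z => F.mPart z = r) (F.actMap k (w : X)⁻¹ f)) a := by
  classical
  have : F.toDual f ∘ₗ LinearMap.mulRight k (Bicross.basis F k (r, w)) =
      F.toDual (F.degProj k (fun z => F.mPart z = r) (F.actMap k (w : X)⁻¹ f)) := by
    refine Bicross.hom_ext F fun s u => ?_
    rw [LinearMap.comp_apply, LinearMap.mulRight_apply, Bicross.basis_mul, toDual_basis,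
      degProj_apply, mPart_deg, actMap_apply, inv_inv, act_coe_mul_coeG]
    split_ifs
    · rw [toDual_basis]
    · simp
  exact congr($this a)

theorem adjointCoaction_basis (s : F.M) (u : F.G) :
    HopfAlgebra.adjointCoaction k (F.Bicross k) (Bicross.basis F k (s, u)) =
      ∑ c : F.M, Bicross.basis F k (c * s * c⁻¹, F.up c u) ⊗ₜ[k]
        Bicross.basis F k (F.dn c (F.up s u), (F.up s u)⁻¹ * u) := by
  classical
  -- `b` and `c` index the two coproducts. The product with the antipode term vanishes unless `b = c
  -- s`, leaving a single sum over `c`.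
  have hcomp (b c : F.M) : HopfAlgebra.mulSnd k (F.Bicross k)
      (HopfAlgebra.antipode k (Bicross.basis F k (s * b⁻¹, F.up b u)))
      (Bicross.basis F k (b * c⁻¹, F.up c u) ⊗ₜ[k] Bicross.basis F k (c, u)) =
      if b = c * s then Bicross.basis F k (c * s * c⁻¹, F.up c u) ⊗ₜ[k]
        Bicross.basis F k (F.dn c (F.up s u), (F.up s u)⁻¹ * u) else 0 := by
    have hup : F.up (s * b⁻¹) (F.up b u) = F.up s u := by rw [← F.mul_up, inv_mul_cancel_right]
    have hdn := F.inv_dn_inv (s * b⁻¹) (F.up b u)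
    rw [hup] at hdn
    rw [Bicross.antipode_basis, HopfAlgebra.mulSnd, LinearMap.comp_apply,
      LinearMap.coe_lTensorHom, LinearMap.lTensor_tmul, LinearMap.mul_apply', hup,
      Bicross.basis_mul, hdn]
    by_cases hb : b = c * s
    · subst hb
      have hi := F.mul_dn c⁻¹ c (F.up s u)
      rw [inv_mul_cancel, F.one_dn, eq_comm, mul_eq_one_iff_eq_inv] at hi
      rw [if_pos (by group), if_pos rfl, mul_inv_rev, mul_inv_cancel_left, F.mul_up, hi, inv_inv]
    · rw [if_neg hb, if_neg, TensorProduct.tmul_zero]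
      intro hc
      exact hb (by rw [← hc]; group)
  rw [HopfAlgebra.adjointCoaction, LinearMap.comp_apply, Bicross.comul_basis, map_sum]
  simp only [TensorProduct.lift.tmul, LinearMap.compl₂_apply, LinearMap.comp_apply,
    Bicross.comul_basis, map_sum, hcomp]
  rw [Finset.sum_comm]
  simp

/-- Companion of `toDual_mul_basis`: that lemma produces the action of `G` and the part `⟨z⟩` of the
grading, this one the action of `M` and the part `|z|`. -/
theorem toDual_coadjoint (f : X →₀ k) (a : F.Bicross k) (r : F.M) (w : F.G) :
    F.toDual f (HopfAlgebra.coadjoint ((Bicross.basis F k).coord (r, w)) a) =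
      F.toDual (F.degProj k (fun z => F.gPart z = w) (F.actMap k (F.dn r w : X) f)) a := by
  classical
  have : F.toDual f ∘ₗ HopfAlgebra.coadjoint ((Bicross.basis F k).coord (r, w)) =
      F.toDual (F.degProj k (fun z => F.gPart z = w) (F.actMap k (F.dn r w : X) f)) := by
    refine Bicross.hom_ext F fun s u => ?_
    rw [LinearMap.comp_apply, toDual_basis, degProj_apply, gPart_deg, actMap_apply]
    simp only [HopfAlgebra.coadjoint, LinearMap.comp_apply, adjointCoaction_basis, map_sum,
      LinearMap.lTensor_tmul, LinearEquiv.coe_coe, TensorProduct.rid_tmul, map_smul, toDual_basis,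
      Module.Basis.coord_apply, Module.Basis.repr_self, Finsupp.single_apply, Prod.mk.injEq]
    by_cases hw : (F.up s u)⁻¹ * u = w
    -- The equation `c ◁ (s ▷ u) = r` has the unique solution `c = r ◁ (s ▷ u)⁻¹`, and then `c ◁ u =
    -- r ◁ w`.
    · rw [Finset.sum_eq_single (F.dn r (F.up s u)⁻¹)]
      · have hc : F.dn r w = F.dn (F.dn r (F.up s u)⁻¹) u := by rw [← F.dn_mul, hw]
        rw [hc, act_coe_mul_coeM]
        simp [F.dn_inv_dn, hw]
      · intro c _ hc
        rw [if_neg, zero_smul]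
        rintro ⟨h, -⟩
        exact hc (by rw [← h, F.dn_dn_inv])
      · simp
    · simp [hw]
  exact congr($this a)

end Finite

end Linear

end GroupFactorization

/-! ### Degree projections and homogeneous bases -/

namespace GroupFactorization

variable {X : Type v} [Group X] (F : GroupFactorization X) {k : Type u} [Field k]

theorem sum_degProj {α : Type*} [Fintype α] (g : X → α) (f : X →₀ k) :
    ∑ r, F.degProj k (fun z => g z = r) f = f := by
  classical
  ext x
  simp [Finsupp.finsetSum_apply, degProj_apply]

theorem eq_of_parts_eq {y z : X} (hm : F.mPart y = F.mPart z) (hg : F.gPart y = F.gPart z) :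
    y = z := by
  rw [← F.mPart_inv_mul_gPart y, hm, hg, F.mPart_inv_mul_gPart]

theorem degProj_gPart_degProj_mPart (z : X) (f : X →₀ k) :
    F.degProj k (fun y => F.gPart y = F.gPart z) (F.degProj k (fun y => F.mPart y = F.mPart z) f) =
      F.degProj k (· = z) f := by
  classical
  ext x
  simp only [degProj_apply]
  by_cases h : F.deg x = z
  · simp [h]
  · rw [if_neg h, ite_eq_right_iff]
    intro hg
    rw [if_neg fun hm => h (F.eq_of_parts_eq hm hg)]

open Classical in
-- An element `t ∈ M` has degree `t⁻¹`, and `⟨t⁻¹⟩ = t`. A homogeneous vector therefore meets `M` in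
-- at most one point, the source of the single coefficient `c_a`.
theorem apply_coe_of_mem_homogeneous {f : X →₀ k} {z : X} (hf : f ∈ F.homogeneous k z) (t : F.M) :
    f t = if F.mPart z = t then f (F.mPart z : X) else 0 := by
  split_ifs with ht
  · rw [ht]
  · refine F.apply_eq_zero_of_deg_ne (fun hz => ht ?_) hf
    have := F.mPart_deg 1 t
    rwa [Subgroup.coe_one, one_mul, dn_one, hz] at this

/-! ### The basis of the crossed module -/

namespace IsDatum

variable {F} {z₀ : X} {M₀ : Submodule k (X →₀ k)} {J : Type*} {zbar : conjugatesOf z₀ → X}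

/-- Projecting a relation to one degree `z` and acting by `z̄⁻¹` leaves a relation between the basis
vectors of `M₀`. -/
theorem linearIndependent_actMap (h : F.IsDatum z₀ M₀) (b : Module.Basis J k M₀)
    (hz : ∀ z : conjugatesOf z₀, (z : X) = (zbar z)⁻¹ * z₀ * zbar z) :
    LinearIndependent k (fun p : J × conjugatesOf z₀ => F.actMap k (zbar p.2) (b p.1)) := by
  classical
  rw [linearIndependent_iff']
  intro s g hg p hp
  have h1 := congrArg (F.actMap k (zbar p.2)⁻¹ ∘ₗ F.degProj k (· = (p.2 : X))) hg
  rw [map_sum, map_zero] at h1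
  have h2 (q : J × conjugatesOf z₀) :
      (F.actMap k (zbar p.2)⁻¹ ∘ₗ F.degProj k (· = (p.2 : X)))
        (g q • F.actMap k (zbar q.2) (b q.1)) = if q.2 = p.2 then g q • (b q.1 : X →₀ k) else 0 := by
    have hq := F.actMap_mem_homogeneous (zbar q.2) (h.le (b q.1).2)
    rw [← hz] at hq
    rw [map_smul, LinearMap.comp_apply]
    split_ifs with hqp
    · rw [F.degProj_of_mem (P := (· = (p.2 : X))) (congrArg _ hqp) hq, hqp, actMap_actMap,
        mul_inv_cancel, actMap_one]
    · rw [F.degProj_of_mem_of_not (P := (· = (p.2 : X))) (fun h => hqp (Subtype.ext h)) hq,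
        map_zero, smul_zero]
  have h3 : ∑ q ∈ s, (if q.2 = p.2 then g q • b q.1 else 0) = 0 := by
    refine Subtype.ext ?_
    rw [ZeroMemClass.coe_zero, ← h1]
    simp only [h2, Submodule.coe_sum]
    refine Finset.sum_congr rfl fun q _ => ?_
    split_ifs <;> rfl
  have h4 := congrArg (b.coord p.1) h3
  rw [map_sum, map_zero, Finset.sum_eq_single p] at h4
  · simpa using h4
  · intro q _ hq
    split_ifs with hqp
    · have : q.1 ≠ p.1 := fun h => hq (Prod.ext h hqp)
      simp [this]
    · simp
  · exact fun h => absurd hp h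

/-- For `z = x⁻¹ z₀ x` the element `x z̄⁻¹` centralizes `z₀`, so `M₀ ◁ x = (M₀ ◁ x z̄⁻¹) ◁ z̄ ⊆ M₀ ◁
z̄`. -/
theorem span_actMap (h : F.IsDatum z₀ M₀) (b : Module.Basis J k M₀)
    (hz : ∀ z : conjugatesOf z₀, (z : X) = (zbar z)⁻¹ * z₀ * zbar z) :
    Submodule.span k (Set.range fun p : J × conjugatesOf z₀ => F.actMap k (zbar p.2) (b p.1)) =
      F.induced M₀ := by
  apply le_antisymm
  · rw [Submodule.span_le]
    rintro _ ⟨p, rfl⟩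
    exact F.actMap_mem_induced' _ (b p.1).2
  · refine F.induced_le fun x w hw => ?_
    let z : conjugatesOf z₀ := ⟨x⁻¹ * z₀ * x, isConj_iff.2 ⟨x⁻¹, by group⟩⟩
    have hx : x * (zbar z)⁻¹ ∈ Subgroup.centralizer {z₀} := by
      have h1 : x⁻¹ * z₀ * x = (zbar z)⁻¹ * z₀ * zbar z := hz z
      rw [Subgroup.mem_centralizer_singleton_iff]
      calc x * (zbar z)⁻¹ * z₀ = x * ((zbar z)⁻¹ * z₀ * zbar z) * (zbar z)⁻¹ := by group
        _ = z₀ * (x * (zbar z)⁻¹) := by rw [← h1]; group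
    have h2 : F.actMap k x w = F.actMap k (zbar z) (F.actMap k (x * (zbar z)⁻¹) w) := by
      rw [actMap_actMap, inv_mul_cancel_right]
    rw [h2]
    have h3 : M₀ ≤ (Submodule.span k (Set.range fun p : J × conjugatesOf z₀ =>
        F.actMap k (zbar p.2) (b p.1))).comap (F.actMap k (zbar z)) := by
      have := congrArg (Submodule.map M₀.subtype) b.span_eq
      rw [Submodule.map_span, Submodule.map_top, Submodule.range_subtype] at this
      refine this.symm.le.trans (Submodule.span_le.2 ?_)
      rintro _ ⟨_, ⟨j, rfl⟩, rfl⟩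
      exact Submodule.subset_span ⟨(j, z), rfl⟩
    exact h3 (h.stable _ hx w hw)

/-- The projection of `𝓜` onto the span of the homogeneous elements with degree satisfying `P`. -/
noncomputable def degInduced (h : F.IsDatum z₀ M₀) (P : X → Prop) :
    F.induced M₀ →ₗ[k] F.induced M₀ :=
  (F.degProj k P).restrict fun _ hw => h.degProj_mem hw P

open Classical in
theorem coord_degInduced (h : F.IsDatum z₀ M₀) {ι : Type*} (f : Module.Basis ι k (F.induced M₀))
    {deg : ι → X} (hf : ∀ a, (f a : X →₀ k) ∈ F.homogeneous k (deg a)) (P : X → Prop) (a : ι)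
    (w : F.induced M₀) :
    f.coord a (h.degInduced P w) = if P (deg a) then f.coord a w else 0 := by
  have : f.coord a ∘ₗ h.degInduced P = (if P (deg a) then (1 : k) else 0) • f.coord a := by
    refine f.ext fun b => ?_
    have hb : h.degInduced P (f b) = if P (deg b) then f b else 0 := by
      refine Subtype.ext ?_
      split_ifs with hP
      · exact F.degProj_of_mem hP (hf b)
      · exact F.degProj_of_mem_of_not hP (hf b)
    rw [LinearMap.comp_apply, hb]
    by_cases hab : b = a
    · subst hab
      split_ifs <;> simp
    · split_ifs <;> simp [hab]
  rw [← LinearMap.comp_apply, this]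
  split_ifs <;> simp

open Classical in
theorem sum_coord_eq_apply {ι : Type*} [Fintype ι] (f : Module.Basis ι k (F.induced M₀))
    {deg : ι → X} (hf : ∀ a, (f a : X →₀ k) ∈ F.homogeneous k (deg a)) (w : F.induced M₀)
    (t : F.M) :
    ∑ a, (if F.mPart (deg a) = t then (f a : X →₀ k) (F.mPart (deg a) : X) * f.coord a w else 0) =
      (w : X →₀ k) t := by
  conv_rhs => rw [← f.sum_repr w]
  rw [Submodule.coe_sum, Finsupp.finsetSum_apply]
  refine Finset.sum_congr rfl fun a _ => ?_
  rw [Submodule.coe_smul, Finsupp.smul_apply, F.apply_coe_of_mem_homogeneous (hf a) t]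
  split_ifs
  · rw [smul_eq_mul, mul_comm]; rfl
  · simp

end IsDatum

section Finite

variable [Finite X]

/-! ### The calculus attached to a datum -/

/-- With `b = δ_r ⊗ w` and `φ` the uncorrected functional of `f`, both sides are `a ↦ φ(a b) - φ(b)
ε(a)`. -/
theorem proj_comp_mulRight (f : X →₀ k) (r : F.M) (w : F.G) :
    F.proj k f ∘ₗ LinearMap.mulRight k (Bicross.basis F k (r, w)) -
      F.proj k f (Bicross.basis F k (r, w)) • (Coalgebra.counit : F.Bicross k →ₗ[k] k) =
      F.proj k (F.degProj k (fun z => F.mPart z = r) (F.actMap k (w : X)⁻¹ f)) := by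
  ext a
  rw [F.proj_eq, F.proj_eq]
  simp only [LinearMap.sub_apply, LinearMap.comp_apply, LinearMap.smul_apply,
    LinearMap.mulRight_apply, smul_eq_mul, ← toDual_mul_basis, one_mul, Bialgebra.counit_mul]
  ring

theorem proj_comp_coadjoint (f : X →₀ k) (r : F.M) (w : F.G) :
    F.proj k f ∘ₗ HopfAlgebra.coadjoint ((Bicross.basis F k).coord (r, w)) =
      F.proj k (F.degProj k (fun z => F.gPart z = w) (F.actMap k (F.dn r w : X) f)) := by
  ext a
  rw [F.proj_eq, F.proj_eq]
  simp only [LinearMap.sub_apply, LinearMap.comp_apply, LinearMap.smul_apply,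
    smul_eq_mul, ← toDual_coadjoint, HopfAlgebra.counit_coadjoint, HopfAlgebra.coadjoint_one,
    map_smul]
  ring

/-- The subspace of the bicrossproduct annihilated by `𝓜`. -/
noncomputable def annihilator (M₀ : Submodule k (X →₀ k)) : Submodule k (F.Bicross k) :=
  ((F.induced M₀).map F.toDual).dualCoannihilator

variable {F} in
theorem mem_annihilator {M₀ : Submodule k (X →₀ k)} {a : F.Bicross k} :
    a ∈ F.annihilator M₀ ↔ ∀ f ∈ F.induced M₀, F.toDual f a = 0 := by
  simp [annihilator, Submodule.mem_dualCoannihilator]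

namespace IsDatum

variable {F} {z₀ : X} {M₀ : Submodule k (X →₀ k)}

theorem exists_toDual_eq {h : Module.Dual k (F.Bicross k)}
    (hh : ∀ a ∈ F.annihilator M₀, h a = 0) : ∃ f ∈ F.induced M₀, F.toDual f = h := by
  have := (Submodule.mem_dualAnnihilator (W := F.annihilator M₀) h).2 hh
  rwa [annihilator, Subspace.dualCoannihilator_dualAnnihilator_eq] at this

/-- `𝓜` is stable under `X` and under degree projections, hence under the duals of right
multiplications and of coadjoint operators. If the counit vanished on the annihilator it would
belong to `𝓜`, which `eq_zero_of_toDual_eq` forbids. -/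
theorem isCalculusIdeal_annihilator (h : F.IsDatum z₀ M₀) :
    HopfAlgebra.IsCalculusIdeal (F.annihilator M₀) where
  mul_mem y hy a := by
    rw [mem_annihilator] at hy ⊢
    intro f hf
    have : F.toDual f ∘ₗ LinearMap.mulLeft k y = 0 := Bicross.hom_ext F fun r w => by
      rw [LinearMap.comp_apply, LinearMap.mulLeft_apply, toDual_mul_basis]
      exact hy _ (h.degProj_mem (F.actMap_mem_induced M₀ _ f hf) _)
    exact congr($this a)
  coaction y hy := by
    classical
    -- Vanishing in `(A / K) ⊗ A` is tested on the coordinates of the second factor, which are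
    -- coadjoint operators applied to `y`.
    refine (TensorProduct.equivFinsuppOfBasisRight (Bicross.basis F k)).injective ?_
    ext p
    rw [map_zero]
    have h1 : Finsupp.lapply p ∘ₗ (TensorProduct.equivFinsuppOfBasisRight
          (Bicross.basis F k)).toLinearMap ∘ₗ (F.annihilator M₀).mkQ.rTensor (F.Bicross k) =
        (F.annihilator M₀).mkQ ∘ₗ (TensorProduct.rid k _).toLinearMap ∘ₗ
          ((Bicross.basis F k).coord p).lTensor (F.Bicross k) := by
      apply TensorProduct.ext'
      intro a b
      simp
    refine congr($h1 (HopfAlgebra.adjointCoaction k (F.Bicross k) y)).trans ?_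
    refine (Submodule.Quotient.mk_eq_zero _).2 (mem_annihilator.2 fun f hf => ?_)
    refine (F.toDual_coadjoint f y p.1 p.2).trans ?_
    exact mem_annihilator.1 hy _ (h.degProj_mem (F.actMap_mem_induced M₀ _ f hf) _)
  exists_counit := by
    by_contra! h1
    have h2 (y) (hy : y ∈ F.annihilator M₀) : Coalgebra.counit (R := k) y = 0 := by
      by_contra h0
      refine h1 ((Coalgebra.counit (R := k) y)⁻¹ • y) (Submodule.smul_mem _ _ hy) ?_
      rw [map_smul, smul_eq_mul, inv_mul_cancel₀ h0]
    obtain ⟨f, hf, hf'⟩ := exists_toDual_eq h2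
    have h3 := h.eq_zero_of_toDual_eq hf (c := 1) (by rw [hf', one_smul])
    rw [h3, map_zero] at hf'
    simpa using congr($hf' 1)

theorem mem_map_proj_iff (h : F.IsDatum z₀ M₀) (g : Module.Dual k (F.Bicross k)) :
    g ∈ (F.induced M₀).map (F.proj k) ↔
      g 1 = 0 ∧ ∀ y ∈ F.annihilator M₀, Coalgebra.counit (R := k) y = 0 → g y = 0 := by
  constructor
  · rintro ⟨f, hf, rfl⟩
    refine ⟨F.proj_one f, fun y hy h0 => ?_⟩
    rw [F.proj_apply_of_counit_eq_zero f h0]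
    exact mem_annihilator.1 hy f hf
  · rintro ⟨h1, h2⟩
    -- As `ε(y₀) = 1`, the annihilator `K` splits as `k y₀ ⊕ (K ∩ A⁺)`. So `g - g(y₀) ε` vanishes on
    -- all of `K` and comes from `𝓜`.
    obtain ⟨y₀, hy₀, hc⟩ := h.isCalculusIdeal_annihilator.exists_counit
    obtain ⟨f, hf, hf'⟩ := exists_toDual_eq (M₀ := M₀)
      (h := g - g y₀ • (Coalgebra.counit : F.Bicross k →ₗ[k] k)) fun y hy => by
        have := h2 (y - Coalgebra.counit (R := k) y • y₀)
          (sub_mem hy (Submodule.smul_mem _ _ hy₀)) (by simp [hc])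
        rw [map_sub, map_smul, smul_eq_mul] at this
        rw [LinearMap.sub_apply, LinearMap.smul_apply, smul_eq_mul, mul_comm, this]
    refine ⟨f, hf, ?_⟩
    rw [proj_eq, hf']
    ext a
    simp [h1]

theorem map_proj_ne_bot (h : F.IsDatum z₀ M₀) : (F.induced M₀).map (F.proj k) ≠ ⊥ := by
  obtain ⟨f, hf, hne⟩ := Submodule.exists_mem_ne_zero_of_ne_bot h.ne_bot
  intro hbot
  have h1 : F.proj k f ∈ (F.induced M₀).map (F.proj k) := ⟨f, F.le_induced M₀ hf, rfl⟩
  rw [hbot, Submodule.mem_bot] at h1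
  exact hne (h.proj_injOn (F.le_induced M₀ hf) (zero_mem _) (by rw [h1, map_zero]))

/-- Stability under the two families of operators amounts to being a graded `X`-submodule. Summing
over the projections recovers the actions of `G` and of `M`; trivial group elements give the
projections to fixed `⟨z⟩` and fixed `|z|`, which together fix `z`. -/
theorem isIrreducible (h : F.IsDatum z₀ M₀) {Ω : Type*} [AddCommGroup Ω] [Module k Ω]
    {Γ : BicovariantCalculus k (F.Bicross k) Ω}
    (hΓ : Γ.tangentSpace = (F.induced M₀).map (F.proj k)) : Γ.IsIrreducible := by
  classical
  have : Fintype F.G := Fintype.ofFinite _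
  refine Γ.isIrreducible_of_tangentSpace (hΓ ▸ h.map_proj_ne_bot) fun W hW hmul hcoadj => ?_
  rw [hΓ] at hW ⊢
  set V := F.induced M₀ ⊓ W.comap (F.proj k) with hV
  have hm (f) (hf : f ∈ V) (r : F.M) (w : F.G) :
      F.degProj k (fun z => F.mPart z = r) (F.actMap k (w : X)⁻¹ f) ∈ V := by
    refine ⟨h.degProj_mem (F.actMap_mem_induced M₀ _ f hf.1) _, ?_⟩
    rw [SetLike.mem_coe, Submodule.mem_comap, ← proj_comp_mulRight]
    exact hmul _ hf.2 _
  have hg (f) (hf : f ∈ V) (r : F.M) (w : F.G) :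
      F.degProj k (fun z => F.gPart z = w) (F.actMap k (F.dn r w : X) f) ∈ V := by
    refine ⟨h.degProj_mem (F.actMap_mem_induced M₀ _ f hf.1) _, ?_⟩
    rw [SetLike.mem_coe, Submodule.mem_comap, ← proj_comp_coadjoint]
    exact hcoadj _ hf.2 _
  have hG (w : F.G) (f) (hf : f ∈ V) : F.actMap k w f ∈ V := by
    rw [← F.sum_degProj F.mPart (F.actMap k w f)]
    refine sum_mem fun r _ => ?_
    simpa using hm f hf r w⁻¹
  have hM (s : F.M) (f) (hf : f ∈ V) : F.actMap k s f ∈ V := by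
    rw [← F.sum_degProj F.gPart (F.actMap k s f)]
    refine sum_mem fun w _ => ?_
    -- For each `w` the label `r = s ◁ w⁻¹` is the one with `r ◁ w = s`.
    simpa [F.dn_inv_dn] using hg f hf (F.dn s w⁻¹) w
  rcases h.eq_bot_or_eq_induced (W := V) inf_le_left
    (fun x f hf => by
      rw [← F.fstG_mul_sndM x, ← actMap_actMap]
      exact hM _ _ (hG _ _ hf))
    (fun z f hf => by
      have h1 := hm f hf (F.mPart z) 1
      rw [Subgroup.coe_one, inv_one, actMap_one] at h1
      have h2 := hg _ h1 1 (F.gPart z)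
      rwa [one_dn, Subgroup.coe_one, actMap_one, degProj_gPart_degProj_mPart] at h2) with h1 | h1
  · left
    rw [eq_bot_iff]
    intro g hgW
    obtain ⟨f, hf, rfl⟩ := hW hgW
    have : f ∈ V := ⟨hf, hgW⟩
    rw [h1, Submodule.mem_bot] at this
    rw [this, map_zero, Submodule.mem_bot]
  · right
    refine le_antisymm hW ?_
    rintro _ ⟨f, hf, rfl⟩
    have : f ∈ V := h1 ▸ hf
    exact this.2

end IsDatum

end Finite

end GroupFactorization

/-! ### Left-invariant forms as the dual of `𝓜`, and the structure of the calculus -/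

namespace GroupFactorization

variable {X : Type v} [Group X] [Finite X] {F : GroupFactorization X} {k : Type u} [Field k]
  {z₀ : X} {M₀ : Submodule k (X →₀ k)} {Ω : Type*} [AddCommGroup Ω] [Module k Ω]
  {Γ : BicovariantCalculus k (F.Bicross k) Ω}

namespace IsDatum

/-- The identification of `𝓜` with the quantum tangent space. -/
noncomputable def projEquiv (h : F.IsDatum z₀ M₀)
    (hΓ : Γ.tangentSpace = (F.induced M₀).map (F.proj k)) : F.induced M₀ ≃ₗ[k] Γ.tangentSpace :=
  LinearEquiv.ofBijective
    ((F.proj k).restrict fun w hw => hΓ ▸ (⟨w, hw, rfl⟩ : F.proj k w ∈ (F.induced M₀).map _))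
    ⟨fun v w hvw => Subtype.ext (h.proj_injOn v.2 w.2 (congrArg Subtype.val hvw)), fun g => by
      have hg : (g : Module.Dual k (F.Bicross k)) ∈ (F.induced M₀).map (F.proj k) := hΓ ▸ g.2
      obtain ⟨w, hw, hwg⟩ := hg
      exact ⟨⟨w, hw⟩, Subtype.ext hwg⟩⟩

/-- The left-invariant 1-forms as the dual of `𝓜`. -/
noncomputable def formsEquiv (h : F.IsDatum z₀ M₀)
    (hΓ : Γ.tangentSpace = (F.induced M₀).map (F.proj k)) :
    Γ.leftInvariant ≃ₗ[k] Module.Dual k (F.induced M₀) :=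
  have : FiniteDimensional k Γ.tangentSpace := Module.Finite.equiv (h.projEquiv hΓ)
  (LinearEquiv.ofBijective Γ.pairing ⟨Γ.pairing_injective, Γ.pairing_surjective⟩).trans
    (h.projEquiv hΓ).dualMap

theorem pairs_iff (h : F.IsDatum z₀ M₀)
    (hΓ : Γ.tangentSpace = (F.induced M₀).map (F.proj k)) (ω : Γ.leftInvariant)
    (w : F.induced M₀) (r : k) : Γ.Pairs ω (F.proj k w) r ↔ h.formsEquiv hΓ ω w = r :=
  Γ.pairs_iff ω (h.projEquiv hΓ w) r

theorem formsEquiv_maurerCartan (h : F.IsDatum z₀ M₀)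
    (hΓ : Γ.tangentSpace = (F.induced M₀).map (F.proj k)) (x : F.Bicross k)
    (w : F.induced M₀) :
    h.formsEquiv hΓ ⟨Γ.maurerCartan x, Γ.maurerCartan_mem x⟩ w = F.proj k w x :=
  Γ.pairing_maurerCartan x (h.projEquiv hΓ w)

/-- The right action of `X` on the left-invariant 1-forms adjoint to the action on `𝓜`. -/
noncomputable def formsRep (h : F.IsDatum z₀ M₀)
    (hΓ : Γ.tangentSpace = (F.induced M₀).map (F.proj k)) :
    Representation k Xᵐᵒᵖ Γ.leftInvariant where
  toFun x := (h.formsEquiv hΓ).symm.toLinearMap ∘ₗ (F.actInduced M₀ x.unop⁻¹).dualMap ∘ₗ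
    (h.formsEquiv hΓ).toLinearMap
  map_one' := by
    ext1 ω
    refine (h.formsEquiv hΓ).injective (LinearMap.ext fun w => ?_)
    simp only [LinearMap.comp_apply, LinearEquiv.coe_coe, LinearEquiv.apply_symm_apply,
      LinearMap.dualMap_apply, Module.End.one_apply]
    refine congrArg _ (Subtype.ext ?_)
    exact (congrArg (fun y => F.actMap k y (w : X →₀ k)) (by simp)).trans (F.actMap_one k _)
  map_mul' x y := by
    ext1 ω
    refine (h.formsEquiv hΓ).injective (LinearMap.ext fun w => ?_)
    simp only [LinearMap.comp_apply, LinearEquiv.coe_coe, LinearEquiv.apply_symm_apply,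
      LinearMap.dualMap_apply, Module.End.mul_apply]
    refine congrArg _ (Subtype.ext ?_)
    exact ((F.actMap_actMap k _ _ _).trans
      (congrArg (fun y => F.actMap k y (w : X →₀ k)) (by simp))).symm

theorem formsEquiv_formsRep (h : F.IsDatum z₀ M₀)
    (hΓ : Γ.tangentSpace = (F.induced M₀).map (F.proj k)) (x : X) (ω : Γ.leftInvariant)
    (w : F.induced M₀) : h.formsEquiv hΓ (h.formsRep hΓ (MulOpposite.op x) ω) w =
      h.formsEquiv hΓ ω (F.actInduced M₀ x⁻¹ w) := by
  simp [formsRep, LinearMap.dualMap_apply]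

theorem adjoint_mem (ω : Γ.leftInvariant) (a : F.Bicross k) :
    Γ.toHopfBimodule.adjoint (ω : Ω) a ∈ Γ.leftInvariant := by
  obtain ⟨x, hx, hω⟩ := Γ.exists_maurerCartan_eq ω
  have := Γ.maurerCartan_mul x a
  rw [hx, zero_smul, add_zero, hω] at this
  rw [← this]
  exact Γ.maurerCartan_mem _

/-- Writing `ω = π(x)` with `x ∈ A⁺`, the form `ω ◁ b` is `π(x b)`, so the adjoint action is dual to
right multiplication and `toDual_mul_basis` applies. -/
theorem formsEquiv_adjoint (h : F.IsDatum z₀ M₀)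
    (hΓ : Γ.tangentSpace = (F.induced M₀).map (F.proj k)) (ω : Γ.leftInvariant) (r : F.M)
    (u : F.G) (w : F.induced M₀) :
    h.formsEquiv hΓ ⟨Γ.toHopfBimodule.adjoint (ω : Ω) (Bicross.basis F k (r, u)),
      adjoint_mem ω _⟩ w =
      h.formsEquiv hΓ ω
        (h.degInduced (fun z => F.mPart z = r) (F.actInduced M₀ (u : X)⁻¹ w)) := by
  obtain ⟨x, hx, hω⟩ := Γ.exists_maurerCartan_eq ω
  have h1 : ω = ⟨Γ.maurerCartan x, Γ.maurerCartan_mem x⟩ := Subtype.ext hω.symm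
  have h2 : (⟨Γ.toHopfBimodule.adjoint (ω : Ω) (Bicross.basis F k (r, u)), adjoint_mem ω _⟩ :
      Γ.leftInvariant) = ⟨Γ.maurerCartan (x * Bicross.basis F k (r, u)),
        Γ.maurerCartan_mem _⟩ := by
    refine Subtype.ext ?_
    have := Γ.maurerCartan_mul x (Bicross.basis F k (r, u))
    rw [hx, zero_smul, add_zero, hω] at this
    exact this.symm
  rw [h2, h1, formsEquiv_maurerCartan, formsEquiv_maurerCartan,
    F.proj_apply_of_counit_eq_zero _ hx, F.proj_apply_of_counit_eq_zero _ (by simp [hx]),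
    toDual_mul_basis]
  rfl

section DualBasis

variable {ι : Type*} [Fintype ι] [DecidableEq ι]

/-- The basis of left-invariant 1-forms dual to a basis of `𝓜`. -/
noncomputable def formsBasis (h : F.IsDatum z₀ M₀)
    (hΓ : Γ.tangentSpace = (F.induced M₀).map (F.proj k)) (f : Module.Basis ι k (F.induced M₀)) :
    Module.Basis ι k Γ.leftInvariant :=
  f.dualBasis.map (h.formsEquiv hΓ).symm

variable (h : F.IsDatum z₀ M₀) (hΓ : Γ.tangentSpace = (F.induced M₀).map (F.proj k))
  (f : Module.Basis ι k (F.induced M₀))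

theorem formsEquiv_formsBasis (a : ι) :
    h.formsEquiv hΓ (h.formsBasis hΓ f a) = f.coord a := by
  simp [formsBasis]

theorem isDualBasis_iff (e : ι → Γ.leftInvariant) :
    Γ.IsDualBasis (fun a => F.proj k (f a)) e ↔ e = h.formsBasis hΓ f := by
  constructor
  · intro he
    funext a
    refine (h.formsEquiv hΓ).injective (f.ext fun b => ?_)
    rw [(h.pairs_iff hΓ _ _ _).1 (he.pairs a b), formsEquiv_formsBasis]
    simp [Finsupp.single_apply, eq_comm]
  · rintro rfl
    refine ⟨(h.formsBasis hΓ f).linearIndependent, (h.formsBasis hΓ f).span_eq, fun a b => ?_⟩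
    rw [h.pairs_iff hΓ, formsEquiv_formsBasis]
    simp [Finsupp.single_apply, eq_comm]

theorem formsRep_formsBasis (x : X) (a : ι) :
    h.formsRep hΓ (MulOpposite.op x) (h.formsBasis hΓ f a) =
      ∑ b, f.coord a (F.actInduced M₀ x⁻¹ (f b)) • h.formsBasis hΓ f b := by
  refine (h.formsEquiv hΓ).injective (f.ext fun c => ?_)
  rw [formsEquiv_formsRep, map_sum, LinearMap.sum_apply]
  simp only [map_smul, formsEquiv_formsBasis, LinearMap.smul_apply]
  rw [Finset.sum_eq_single c]
  · simp
  · intro b _ hb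
    simp [Ne.symm hb]
  · simp

variable {deg : ι → X}

open Classical in
theorem adjoint_formsBasis
    (hf : ∀ a, (f a : X →₀ k) ∈ F.homogeneous k (deg a))
    (a : ι) (r : F.M) (u : F.G) :
    Γ.toHopfBimodule.adjoint (h.formsBasis hΓ f a : Ω) (Bicross.basis F k (r, u)) =
      if F.mPart (deg a) = r then
        (h.formsRep hΓ (MulOpposite.op (u : X)) (h.formsBasis hΓ f a) : Ω) else 0 := by
  have : (⟨Γ.toHopfBimodule.adjoint (h.formsBasis hΓ f a : Ω) (Bicross.basis F k (r, u)),
      adjoint_mem _ _⟩ : Γ.leftInvariant) = if F.mPart (deg a) = r then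
        h.formsRep hΓ (MulOpposite.op (u : X)) (h.formsBasis hΓ f a) else 0 := by
    refine (h.formsEquiv hΓ).injective (LinearMap.ext fun w => ?_)
    rw [formsEquiv_adjoint, formsEquiv_formsBasis, h.coord_degInduced f hf]
    split_ifs
    · rw [formsEquiv_formsRep, formsEquiv_formsBasis]
    · simp
  refine (congrArg Subtype.val this).trans ?_
  split_ifs <;> rfl

/-- In `e_a b = ∑ b₁ (e_a ◁ b₂)` only the coproduct term with second factor `δ_{⟨f_a⟩} ⊗ u`
survives. Both commutation relations follow, by `u = 1` and by summation over `s`. -/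
theorem right_basis_formsBasis
    (hf : ∀ a, (f a : X →₀ k) ∈ F.homogeneous k (deg a))
    (a : ι) (s : F.M) (u : F.G) :
    Γ.right (Bicross.basis F k (s, u)) (h.formsBasis hΓ f a) =
      Γ.left (Bicross.basis F k (s * (F.mPart (deg a))⁻¹, F.up (F.mPart (deg a)) u))
        (h.formsRep hΓ (MulOpposite.op (u : X)) (h.formsBasis hΓ f a)) := by
  classical
  refine (Γ.toHopfBimodule.right_eq_lift_adjoint _ _).trans ?_
  rw [Bicross.comul_basis, map_sum, Finset.sum_eq_single (F.mPart (deg a))]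
  · rw [TensorProduct.lift.tmul, LinearMap.compl₂_apply, h.adjoint_formsBasis hΓ f hf, if_pos rfl]
    rfl
  · intro b _ hb
    rw [TensorProduct.lift.tmul, LinearMap.compl₂_apply, h.adjoint_formsBasis hΓ f hf,
      if_neg (Ne.symm hb), map_zero]
  · simp

theorem right_delta_formsBasis
    (hf : ∀ a, (f a : X →₀ k) ∈ F.homogeneous k (deg a))
    (a : ι) (s : F.M) :
    Γ.right (Bicross.delta F k s) (h.formsBasis hΓ f a) =
      Γ.left (Bicross.delta F k (s * (F.mPart (deg a))⁻¹)) (h.formsBasis hΓ f a) := by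
  have := h.right_basis_formsBasis hΓ f hf a s 1
  rwa [Subgroup.coe_one, MulOpposite.op_one, map_one, up_one] at this

theorem sum_left_basis (t : F.M) (u : F.G) (ω : Ω) :
    ∑ s : F.M, Γ.left (Bicross.basis F k (s * t, u)) ω = Γ.left (Bicross.grp F k u) ω := by
  rw [Bicross.grp, map_sum, LinearMap.sum_apply]
  exact Fintype.sum_equiv (Equiv.mulRight t) _ _ fun s => rfl

theorem right_grp_formsBasis
    (hf : ∀ a, (f a : X →₀ k) ∈ F.homogeneous k (deg a))
    (a : ι) (u : F.G) :
    Γ.right (Bicross.grp F k u) (h.formsBasis hΓ f a) =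
      Γ.left (Bicross.grp F k (F.up (F.mPart (deg a)) u))
        (h.formsRep hΓ (MulOpposite.op (u : X)) (h.formsBasis hΓ f a)) := by
  rw [← sum_left_basis (F.mPart (deg a))⁻¹, Bicross.grp, map_sum, LinearMap.sum_apply]
  exact Finset.sum_congr rfl fun s _ => h.right_basis_formsBasis hΓ f hf a s u

open Classical in
-- Paired with `w ∈ 𝓜`, the left side is the coefficient of `u b` in `w`, minus the value of `w` on
-- the unit of `A` when `b = 1`. The first is the coefficient of `b ∈ M` in `w ◁ u⁻¹`, the second
-- the sum of the coefficients on `M`; `sum_coord_eq_apply` expands both.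
theorem maurerCartan_basis
    (hf : ∀ a, (f a : X →₀ k) ∈ F.homogeneous k (deg a))
    (b : F.M) (u : F.G) :
    Γ.maurerCartan (Bicross.basis F k (b, u)) =
      ∑ a, (if F.mPart (deg a) = b then (f a : X →₀ k) (F.mPart (deg a) : X) •
        (h.formsRep hΓ (MulOpposite.op (u : X)) (h.formsBasis hΓ f a) : Ω) else 0) -
      if b = 1 then ∑ a, (f a : X →₀ k) (F.mPart (deg a) : X) • (h.formsBasis hΓ f a : Ω)
      else 0 := by
  have h1 : (⟨Γ.maurerCartan (Bicross.basis F k (b, u)), Γ.maurerCartan_mem _⟩ :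
      Γ.leftInvariant) =
      ∑ a, (if F.mPart (deg a) = b then (f a : X →₀ k) (F.mPart (deg a) : X) •
        h.formsRep hΓ (MulOpposite.op (u : X)) (h.formsBasis hΓ f a) else 0) -
      (if b = 1 then (1 : k) else 0) •
        ∑ a, (f a : X →₀ k) (F.mPart (deg a) : X) • h.formsBasis hΓ f a := by
    refine (h.formsEquiv hΓ).injective (LinearMap.ext fun w => ?_)
    have h2 := sum_coord_eq_apply f hf (F.actInduced M₀ (u : X)⁻¹ w) b
    have h3 : (F.actInduced M₀ (u : X)⁻¹ w : X →₀ k) b = (w : X →₀ k) (u * b) := by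
      refine (F.actMap_apply k _ _ _).trans ?_
      have := F.act_coe_mul_coeG 1 u b
      rw [Subgroup.coe_one, one_mul, one_mul] at this
      rw [inv_inv, this]
      rfl
    have h4 : ∑ a, (f a : X →₀ k) (F.mPart (deg a) : X) * f.coord a w = F.toDual w 1 := by
      rw [toDual_one, ← Finset.sum_congr rfl fun t _ => sum_coord_eq_apply f hf w t,
        Finset.sum_comm]
      simp
    rw [formsEquiv_maurerCartan, F.proj_eq, LinearMap.sub_apply, toDual_basis, LinearMap.smul_apply,
      Bicross.counit_basis, map_sub, map_sum, map_smul, map_sum, LinearMap.sub_apply,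
      LinearMap.sum_apply, LinearMap.smul_apply, LinearMap.sum_apply, ← h3, ← h2, ← h4,
      smul_eq_mul, smul_eq_mul, mul_comm]
    congr 1
    · refine Finset.sum_congr rfl fun a _ => ?_
      split_ifs
      · rw [map_smul, LinearMap.smul_apply, formsEquiv_formsRep, formsEquiv_formsBasis,
          smul_eq_mul]
      · simp
    · simp [formsEquiv_formsBasis]
  refine (congrArg Subtype.val h1).trans ?_
  rw [Submodule.coe_sub, Submodule.coe_smul, Submodule.coe_sum, Submodule.coe_sum, ite_smul,
    one_smul, zero_smul]
  congr 1
  refine Finset.sum_congr rfl fun a _ => ?_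
  split_ifs <;> rfl

/-- In `d a = ∑ a₁ π(a₂)` the first part of `maurerCartan_basis` selects, for each index, the
coproduct term with `b = ⟨f_a⟩`; the counit correction selects the term with `b = 1`. -/
theorem d_basis
    (hf : ∀ a, (f a : X →₀ k) ∈ F.homogeneous k (deg a))
    (s : F.M) (u : F.G) :
    Γ.d (Bicross.basis F k (s, u)) =
      ∑ a, (f a : X →₀ k) (F.mPart (deg a) : X) •
        Γ.left (Bicross.basis F k (s * (F.mPart (deg a))⁻¹, F.up (F.mPart (deg a)) u))
          (h.formsRep hΓ (MulOpposite.op (u : X)) (h.formsBasis hΓ f a)) -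
      ∑ a, (f a : X →₀ k) (F.mPart (deg a) : X) •
        Γ.left (Bicross.basis F k (s, u)) (h.formsBasis hΓ f a) := by
  classical
  rw [Γ.d_eq_lift, Bicross.comul_basis, map_sum]
  simp only [TensorProduct.lift.tmul, LinearMap.compl₂_apply, h.maurerCartan_basis hΓ f hf, map_sub,
    Finset.sum_sub_distrib, map_sum]
  congr 1
  · rw [Finset.sum_comm]
    refine Finset.sum_congr rfl fun a _ => ?_
    rw [Finset.sum_eq_single (F.mPart (deg a))]
    · rw [if_pos rfl, map_smul]
    · intro b _ hb
      rw [if_neg (Ne.symm hb), map_zero]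
    · simp
  · rw [Finset.sum_eq_single 1]
    · simp
    · intro b _ hb
      rw [if_neg hb, map_zero]
    · simp

theorem d_delta
    (hf : ∀ a, (f a : X →₀ k) ∈ F.homogeneous k (deg a))
    (s : F.M) :
    Γ.d (Bicross.delta F k s) = ∑ a, (f a : X →₀ k) (F.mPart (deg a) : X) •
      Γ.left (Bicross.delta F k (s * (F.mPart (deg a))⁻¹) - Bicross.delta F k s)
        (h.formsBasis hΓ f a) := by
  have := h.d_basis hΓ f hf s 1
  simp only [Subgroup.coe_one, MulOpposite.op_one, map_one, up_one, Module.End.one_apply,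
    ← Finset.sum_sub_distrib, ← smul_sub] at this
  simpa only [map_sub, LinearMap.sub_apply, Bicross.delta] using this

theorem d_grp
    (hf : ∀ a, (f a : X →₀ k) ∈ F.homogeneous k (deg a))
    (u : F.G) :
    Γ.d (Bicross.grp F k u) = ∑ a, (f a : X →₀ k) (F.mPart (deg a) : X) •
      Γ.left (Bicross.grp F k (F.up (F.mPart (deg a)) u))
        (h.formsRep hΓ (MulOpposite.op (u : X)) (h.formsBasis hΓ f a)) -
      ∑ a, (f a : X →₀ k) (F.mPart (deg a) : X) •
        Γ.left (Bicross.grp F k u) (h.formsBasis hΓ f a) := by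
  have h1 : Γ.d (Bicross.grp F k u) = ∑ s : F.M, Γ.d (Bicross.basis F k (s, u)) := by
    rw [Bicross.grp, map_sum]
  rw [h1]
  simp only [h.d_basis hΓ f hf, Finset.sum_sub_distrib]
  congr 1
  · rw [Finset.sum_comm]
    refine Finset.sum_congr rfl fun a _ => ?_
    rw [← Finset.smul_sum, sum_left_basis]
  · rw [Finset.sum_comm]
    refine Finset.sum_congr rfl fun a _ => ?_
    rw [← Finset.smul_sum, Bicross.grp, map_sum, LinearMap.sum_apply]

end DualBasis

end IsDatum

end GroupFactorization

/-! ### The theorem -/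

theorem mainTheorem1 {k : Type u} [Field k] [CharZero k] {X : Type v} [Group X] [Finite X]
    (F : GroupFactorization X) (z₀ : X) (M₀ : Submodule k (X →₀ k)) (hM₀ : F.IsDatum z₀ M₀) :
    -- the vectors `f_{iz} = f_i ◁ z̄` form a basis of `𝓜`, and `f_{iz}` has `X`-degree `z`
    (∀ (J : Type w₁) (b : Module.Basis J k M₀) (zbar : conjugatesOf z₀ → X),
      (∀ z : conjugatesOf z₀, (z : X) = (zbar z)⁻¹ * z₀ * zbar z) →
      LinearIndependent k (fun p : J × conjugatesOf z₀ => F.actMap k (zbar p.2) (b p.1)) ∧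
      Submodule.span k (Set.range fun p : J × conjugatesOf z₀ => F.actMap k (zbar p.2) (b p.1)) =
        F.induced M₀ ∧
      ∀ p : J × conjugatesOf z₀, F.actMap k (zbar p.2) (b p.1) ∈ F.homogeneous k p.2) ∧
    -- `L = Π(𝓜)`, isomorphic to `𝓜`, is the quantum tangent space of an irreducible calculus
    Set.InjOn (F.proj k) (F.induced M₀) ∧
    (∃ (Ω : Type (max u v)) (_ : AddCommGroup Ω) (_ : Module k Ω)
      (Γ : BicovariantCalculus k (F.Bicross k) Ω),
      Γ.IsIrreducible ∧ Γ.tangentSpace = (F.induced M₀).map (F.proj k)) ∧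
    -- the calculus with this quantum tangent space, for any homogeneous basis `f` of `𝓜`
    (∀ (Ω : Type w) [AddCommGroup Ω] [Module k Ω] (Γ : BicovariantCalculus k (F.Bicross k) Ω),
      Γ.tangentSpace = (F.induced M₀).map (F.proj k) →
      -- `Ω¹ = A ⊗ Λ¹` as left modules
      Function.Bijective Γ.leftFree ∧
      ∀ (ι : Type w₁) [Fintype ι] [DecidableEq ι] (f : Module.Basis ι k (F.induced M₀))
        (deg : ι → X), (∀ a, (f a : X →₀ k) ∈ F.homogeneous k (deg a)) →
      -- with `m a = ⟨f_a⟩` and `c a = ⟨δ_{⟨f_a⟩}, f_a⟩`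
      let m : ι → F.M := fun a => F.mPart (deg a)
      let c : ι → k := fun a => (f a : X →₀ k) (m a : X)
      ∃ e : ι → Γ.leftInvariant,
        -- `e` is the basis of `Λ¹` dual to `f`
        Γ.IsDualBasis (fun a => F.proj k (f a)) e ∧
        (∀ e', Γ.IsDualBasis (fun a => F.proj k (f a)) e' → e' = e) ∧
        -- `star (op x) ω = ω * x` is the right action adjoint to the left action `x * f = f ◁ x⁻¹`
        ∃ star : Representation k Xᵐᵒᵖ Γ.leftInvariant,
          (∀ (x : X) (ω : Γ.leftInvariant) (w : F.induced M₀) (r : k),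
            Γ.Pairs (star (MulOpposite.op x) ω) (F.proj k w) r ↔
              Γ.Pairs ω (F.proj k (F.actInduced M₀ x⁻¹ w)) r) ∧
          (∀ (x : X) (a : ι), star (MulOpposite.op x) (e a) =
            ∑ b, f.coord a (F.actInduced M₀ x⁻¹ (f b)) • e b) ∧
          -- the right module structure
          (∀ (a : ι) (s : F.M), Γ.right (GroupFactorization.Bicross.delta F k s) (e a) =
            Γ.left (GroupFactorization.Bicross.delta F k (s * (m a)⁻¹)) (e a)) ∧
          (∀ (a : ι) (u : F.G), Γ.right (GroupFactorization.Bicross.grp F k u) (e a) =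
            Γ.left (GroupFactorization.Bicross.grp F k (F.up (m a) u)) (star (MulOpposite.op (u : X)) (e a))) ∧
          -- the exterior differential
          (∀ s : F.M, Γ.d (GroupFactorization.Bicross.delta F k s) =
            ∑ a, c a • Γ.left (GroupFactorization.Bicross.delta F k (s * (m a)⁻¹) - GroupFactorization.Bicross.delta F k s) (e a)) ∧
          (∀ u : F.G, Γ.d (GroupFactorization.Bicross.grp F k u) =
            ∑ a, c a • Γ.left (GroupFactorization.Bicross.grp F k (F.up (m a) u))
              (star (MulOpposite.op (u : X)) (e a)) -
            ∑ a, c a • Γ.left (GroupFactorization.Bicross.grp F k u) (e a))) := by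
  refine ⟨fun J b zbar hz => ⟨hM₀.linearIndependent_actMap b hz, hM₀.span_actMap b hz, fun p => ?_⟩,
    hM₀.proj_injOn, ?_, ?_⟩
  · have := F.actMap_mem_homogeneous (zbar p.2) (hM₀.le (b p.1).2)
    rwa [← hz] at this
  · obtain ⟨Γ, hΓ⟩ := HopfBimodule.exists_calculus hM₀.isCalculusIdeal_annihilator
    have hL : Γ.tangentSpace = (F.induced M₀).map (F.proj k) :=
      Submodule.ext fun g => (hΓ g).trans (hM₀.mem_map_proj_iff g).symm
    exact ⟨_, _, _, Γ, hM₀.isIrreducible hL, hL⟩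
  · intro Ω _ _ Γ hΓ
    refine ⟨Γ.leftFree_bijective, fun ι _ _ f deg hf => ⟨hM₀.formsBasis hΓ f,
      (hM₀.isDualBasis_iff hΓ f _).2 rfl, fun e' => (hM₀.isDualBasis_iff hΓ f e').1,
      hM₀.formsRep hΓ, fun x ω w r => ?_, hM₀.formsRep_formsBasis hΓ f,
      hM₀.right_delta_formsBasis hΓ f hf, hM₀.right_grp_formsBasis hΓ f hf,
      hM₀.d_delta hΓ f hf, hM₀.d_grp hΓ f hf⟩⟩
    rw [hM₀.pairs_iff hΓ, hM₀.pairs_iff hΓ, hM₀.formsEquiv_formsRep]
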